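/- Let $d\ge 2$, $k\ge 0$, and let $\Omega\subset\mathbb R^d$ be a bounded polyhedral domain. Let $\mathcal K_h$ be a partition of $\overline\Omega$ into closed, possibly non-convex, polytopes $K$, with $\mathcal F_h$ the set of its $(d-1)$-dimensional flat faces: each $\partial K$ is the union of the faces it contains, distinct faces overlap only in sets of zero $(d-1)$-measure, a face on $\partial\Omega$ belongs to one element and any other (interior) face to exactly two. Assume shape regularity with constants $\gamma,\eta$: each $K$ is star-shaped with respect to a ball of centre $x_K$ and radius at least $h_K/\gamma$, each face $F$ is star-shaped with respect to a $(d-1)$-dimensional ball of radius at least $h_F/\gamma$, and $h_K\le\eta h_F$ for $F\subset\partial K$, where $h_K=\operatorname{diam}K$, $h_F=\operatorname{diam}F$. Let $\mathcal T_h$ consist of the cones $T$ with apex $x_K$ and base $F$, for $K\in\mathcal K_h$ and faces $F\subset\partial K$; let $n$ be the outward unit normal and $Q_b$ the $L^2(F)$-projection onto $\mathbb P_k(F)$. Set $$\Sigma_h^{-1}=\{\sigma\in L^2(\Omega;\mathbb R^d):\sigma|_T\in\mathbb P_k(T;\mathbb R^d)\ \forall T\in\mathcal T_h\},\qquad \Sigma_h=\{\sigma\in\Sigma_h^{-1}: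 [\sigma\cdot n]_F=0\text{ on every interior face }F\in\mathcal F_h\},$$ where $[\sigma\cdot n]_F$ is the sum of the two outward normal traces, $$U_h=\prod_{K}\mathbb P_{k+1}(K),\qquad M_h^0=\{(u_0,u_b): u_0\in U_h,\ u_b|_F\in\mathbb P_k(F)\ \forall F\in\mathcal F_h,\ u_b|_F=0\text{ if }F\subset\partial\Omega\}.$$ For $\sigma,\tau\in\Sigma_h^{-1}$ and $u=(u_0,u_b)\in M_h^0$ put $a_h(\sigma,\tau)=\sum_{T}(\sigma,\tau)_T$, $$b_h(\sigma,u)=\sum_{K}\{-(\sigma,\nabla u_0)_K+\langle\sigma\cdot n,Q_bu_0-u_b\rangle_{\partial K}\},$$ $$\|\sigma\|_{0,h}^2=\sum_K\|\sigma\|_K^2+\sum_K h_K\|\sigma\cdot n\|_{\partial K}^2,\qquad \|u\|_{1,h}^2=\sum_K\|\nabla u_0\|_K^2+\sum_K h_K^{-1}\|u_0-u_b\|_{\partial K}^2,$$ all traces on $\partial K$ being taken from inside $K$. Then there is a constant $C$, depending only on $d$, $k$, $\Omega$, $\gamma$, $\eta$ (not on the mesh), such that for every such mesh and every $f\in L^2(\Omega)$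 the hybridized problem: find $\sigma_h\in\Sigma_h^{-1}$, $u_h=(u_0,u_b)\in M_h^0$ with $$a_h(\sigma_h,\tau)+b_h(\tau,u_h)=0\quad\forall\tau\in\Sigma_h^{-1},\qquad b_h(\sigma_h,v)=-(f,v_0)\quad\forall v=(v_0,v_b)\in M_h^0,$$ has a unique solution, and $$\|\sigma_h\|_{0,h}+\|u_h\|_{1,h}\le C\|f\|_{L^2(\Omega)}.$$ Moreover $\sigma_h\in\Sigma_h$, and $(\sigma_h,u_0)\in\Sigma_h\times U_h$ solves the staggered DG problem $$a_h(\sigma_h,\tau)+\tilde b_h(\tau,u_0)=0\quad\forall\tau\in\Sigma_h,\qquad \tilde b_h(\sigma_h,v)=-(f,v)\quad\forall v\in U_h,$$ $$\tilde b_h(\sigma,v)=-\sum_K(\sigma,\nabla v)_K+\sum_{F\in\mathcal F_h}\langle\sigma\cdot n,Q_b[v]\rangle_F,$$ where for an interior face $F$ of $K_1,K_2$ (in a chosen order) $n$ is outward to $K_1$ and $[v]_F=v|_{K_1}-v|_{K_2}$, while on a boundary face $n$ is outward to $\Omega$ and $[v]_F=v|_F$. -/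

import Mathlib

open MeasureTheory
open scoped RealInnerProductSpace

noncomputable section

namespace SDG

/-- The ambient Euclidean space `ℝ^d`. -/
abbrev Space (d : ℕ) : Type := EuclideanSpace ℝ (Fin d)

/-! ### Polytopes, star-shapedness and meshes -/

/-- A (not necessarily convex) polytope: a finite union of convex hulls of finite sets. -/
def IsPolytope {d : ℕ} (S : Set (Space d)) : Prop :=
  ∃ P : Finset (Finset (Space d)), S = ⋃ V ∈ P, convexHull ℝ (V : Set (Space d))

/-- `S` is star-shaped with respect to every point of the ball of radius `ρ` centred at `x ∈ S`, the
ball being taken in the affine hull of `S`. This ball is then contained in `S`. For a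
full-dimensional `S` it is a ball of `ℝ^d`, for a `(d-1)`-dimensional face it is a ball of the
hyperplane of that face. -/
def IsStarShapedWrtBall {d : ℕ} (S : Set (Space d)) (x : Space d) (ρ : ℝ) : Prop :=
  0 < ρ ∧ x ∈ S ∧ ∀ b ∈ affineSpan ℝ S, dist b x ≤ ρ → StarConvex ℝ b S

/-- A polytopal partition of the domain `Ω` of `ℝ^d`, with its `(d-1)`-dimensional faces, and with
a point `x_K` chosen for each element `K`. Elements and faces are closed sets. Elements need not be
convex, and an element may have several coplanar faces (hanging nodes). -/
structure PolytopalMesh (d : ℕ) (Ω : Set (Space d)) where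
  /-- the elements `K` -/
  cells : Finset (Set (Space d))
  /-- the `(d-1)`-dimensional faces of the elements -/
  faces : Finset (Set (Space d))
  /-- the point `x_K` of the element `K` -/
  center : Set (Space d) → Space d
  isPolytope_cell : ∀ K ∈ cells, IsPolytope K
  finrank_cell : ∀ K ∈ cells, Module.finrank ℝ (vectorSpan ℝ K) = d
  isPolytope_face : ∀ F ∈ faces, IsPolytope F
  /-- every face spans a hyperplane -/
  finrank_face : ∀ F ∈ faces, Module.finrank ℝ (vectorSpan ℝ F) + 1 = d
  /-- the elements cover the domain -/
  interior_iUnion_cells : interior (⋃ K ∈ cells, K) = Ω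
  /-- the elements do not overlap -/
  disjoint_cells : ∀ K ∈ cells, ∀ K' ∈ cells, K ≠ K' → Disjoint (interior K) (interior K')
  /-- the boundary of an element is the union of its faces -/
  frontier_cell : ∀ K ∈ cells, frontier K = ⋃ F ∈ faces, ⋃ _ : F ⊆ frontier K, F
  /-- the faces do not overlap -/
  null_inter_faces : ∀ F ∈ faces, ∀ F' ∈ faces, F ≠ F' → μHE[d - 1] (F ∩ F') = 0
  /-- a face on `∂Ω` is a face of exactly one element -/
  boundary_face : ∀ F ∈ faces, F ⊆ frontier Ω →
    {K : Set (Space d) | K ∈ cells ∧ F ⊆ frontier K}.ncard = 1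
  /-- any other face is a face of exactly two elements -/
  interior_face : ∀ F ∈ faces, ¬ F ⊆ frontier Ω →
    {K : Set (Space d) | K ∈ cells ∧ F ⊆ frontier K}.ncard = 2

/-- Value at the point `x` of a polynomial in `d` variables. -/
def evalAt {d : ℕ} (p : MvPolynomial (Fin d) ℝ) (x : Space d) : ℝ :=
  MvPolynomial.eval (fun i => x i) p

/-- The restriction to `S` (extended by zero) of a polynomial in `d` variables, as a linear map. -/
def restrictPoly {d : ℕ} (S : Set (Space d)) :
    MvPolynomial (Fin d) ℝ →ₗ[ℝ] (Space d → ℝ) where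
  toFun p := S.indicator (evalAt p)
  map_add' p q := by
    ext x; by_cases hx : x ∈ S <;> simp [hx, evalAt]
  map_smul' c p := by
    ext x; by_cases hx : x ∈ S <;> simp [hx, evalAt]

/-- Gradient at the point `x` of a polynomial in `d` variables. -/
def gradAt {d : ℕ} (p : MvPolynomial (Fin d) ℝ) (x : Space d) : Space d :=
  WithLp.toLp 2 fun i => evalAt (MvPolynomial.pderiv i p) x

/-- Polynomials of degree at most `m` in `d` variables. This is `ℙ_m(S)` for every set `S` with
nonempty interior, since polynomial functions on such a set determine the polynomial. -/
abbrev Poly (d m : ℕ) : Type := MvPolynomial.restrictTotalDegree (Fin d) ℝ m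

/-- Vector fields with components in `ℙ_m`, i.e. `ℙ_m(T; ℝ^d)`. -/
abbrev VecPoly (d m : ℕ) : Type := Fin d → Poly d m

/-- Value at the point `x` of a polynomial vector field. -/
def vecAt {d m : ℕ} (s : VecPoly d m) (x : Space d) : Space d :=
  WithLp.toLp 2 fun i => evalAt (s i : MvPolynomial (Fin d) ℝ) x

/-- The space `ℙ_m(F)` of polynomial functions on a face `F`: restrictions to `F` of polynomials of
degree at most `m`. The functions are extended by zero outside `F`, so that they are determined by
their values on `F`. -/
def facePoly {d : ℕ} (m : ℕ) (F : Set (Space d)) : Submodule ℝ (Space d → ℝ) :=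
  (MvPolynomial.restrictTotalDegree (Fin d) ℝ m).map (restrictPoly F)

/-- `n` is the unit normal of the flat face `F` that points away from the point `x`. -/
def IsOutwardNormal {d : ℕ} (x : Space d) (F : Set (Space d)) (n : Space d) : Prop :=
  ‖n‖ = 1 ∧ ∀ y ∈ F, 0 < ⟪n, y - x⟫ ∧ ∀ z ∈ F, ⟪n, z - y⟫ = 0

/-- `q` is the `L²(F)`-orthogonal projection of `g` onto `ℙ_m(F)`. -/
def IsFaceProj {d : ℕ} (m : ℕ) (F : Set (Space d)) (g q : Space d → ℝ) : Prop :=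
  q ∈ facePoly m F ∧ ∀ r ∈ facePoly m F, ∫ x in F, (g x - q x) * r x ∂μHE[d - 1] = 0

/-- The `L²(F)`-orthogonal projection `Q_b` onto `ℙ_m(F)`. -/
def faceProj {d : ℕ} (m : ℕ) (F : Set (Space d)) (g : Space d → ℝ) : Space d → ℝ :=
  Classical.epsilon (IsFaceProj m F g)

namespace PolytopalMesh

variable {d : ℕ} {Ω : Set (Space d)}

/-- Shape regularity with constants `γ` and `η`: each element is star-shaped with respect to a ball
centred at `x_K`, each face is star-shaped with respect to a `(d-1)`-dimensional ball, in both cases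
with chunkiness parameter (diameter over radius) at most `γ`; and `h_K ≤ η h_F` for every face `F`
of `K`. -/
def IsRegular (M : PolytopalMesh d Ω) (γ η : ℝ) : Prop :=
  (∀ K ∈ M.cells, ∃ ρ, IsStarShapedWrtBall K (M.center K) ρ ∧ Metric.diam K ≤ γ * ρ) ∧
  (∀ F ∈ M.faces, ∃ y ρ, IsStarShapedWrtBall F y ρ ∧ Metric.diam F ≤ γ * ρ) ∧
  (∀ K ∈ M.cells, ∀ F ∈ M.faces, F ⊆ frontier K → Metric.diam K ≤ η * Metric.diam F)

variable (M : PolytopalMesh d Ω)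

/-- Index type of the elements. -/
abbrev Cell : Type := {K : Set (Space d) // K ∈ M.cells}

/-- Index type of the primal faces. -/
abbrev Face : Type := {F : Set (Space d) // F ∈ M.faces}

/-- Index type of the submesh `𝒯_h`: its elements `T` are indexed by the pairs `(K, F)` with `F` a
face of the element `K`. Sums over `𝒯_h` are thus also sums over all `K` and all `F ⊆ ∂K`. -/
abbrev SubCell : Type :=
  {t : M.Cell × M.Face // (t.2 : Set (Space d)) ⊆ frontier (t.1 : Set (Space d))}

instance : Fintype M.SubCell := Fintype.ofFinite _

variable {M}

/-- The element `K` containing the subelement `T`. -/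
def SubCell.cell (t : M.SubCell) : M.Cell := t.1.1

/-- The primal face `F` of the subelement `T`. -/
def SubCell.face (t : M.SubCell) : M.Face := t.1.2

/-- The subelement `T` as a set: the cone with apex `x_K` and base `F`. -/
def SubCell.toSet (t : M.SubCell) : Set (Space d) :=
  convexJoin ℝ {M.center t.cell} (t.face : Set (Space d))

/-- The unit normal on the primal face `F` of `T`, outward to `T` (and to `K`). -/
def SubCell.normal (t : M.SubCell) : Space d :=
  Classical.epsilon (IsOutwardNormal (M.center t.cell) (t.face : Set (Space d)))

/-- `h_K`, the diameter of the element `K`. -/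
def Cell.h (K : M.Cell) : ℝ := Metric.diam (K : Set (Space d))

/-- The face `F` lies on the boundary of the domain. -/
def Face.IsBoundary (F : M.Face) : Prop := (F : Set (Space d)) ⊆ frontier Ω

variable (M) (k : ℕ)

/-! ### Discrete spaces -/

/-- `Σ_h^{-1}`: piecewise `ℙ_k` vector fields on `𝒯_h`. -/
abbrev SigmaDisc : Type := M.SubCell → VecPoly d k

/-- `U_h`: piecewise `ℙ_{k+1}` functions on `𝒦_h`. -/
abbrev U : Type := M.Cell → Poly d (k + 1)

/-- `M_h`: pairs `(u_0, u_b)` with `u_0|_K ∈ ℙ_{k+1}(K)` and `u_b|_F ∈ ℙ_k(F)`. -/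
abbrev MSpace : Type := M.U k × ((F : M.Face) → facePoly k (F : Set (Space d)))

/-- `M_h^0`: the pairs of `M_h` with `u_b = 0` on the boundary faces. -/
def MZero : Submodule ℝ (M.MSpace k) where
  carrier := {u | ∀ F : M.Face, F.IsBoundary → u.2 F = 0}
  zero_mem' := fun F _ => rfl
  add_mem' := by
    intro u v hu hv F hF
    simp [hu F hF, hv F hF]
  smul_mem' := by
    intro c u hu F hF
    simp [hu F hF]

variable {M k}

/-- The trace `σ · n` on the primal face `F` of `T`, taken from inside `T`. -/
def normalTrace (σ : M.SigmaDisc k) (t : M.SubCell) (x : Space d) : ℝ :=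
  ⟪vecAt (σ t) x, t.normal⟫

open Classical in
/-- The jump `[σ · n]` across the primal face `F`: sum of the outward normal traces from the
elements containing `F`. -/
def normalJump (σ : M.SigmaDisc k) (F : M.Face) (x : Space d) : ℝ :=
  ∑ t : M.SubCell with t.face = F, normalTrace σ t x

variable (M k)

/-- `Σ_h`: the fields of `Σ_h^{-1}` whose normal component is continuous across the interior primal
faces. -/
def Sigma : Set (M.SigmaDisc k) :=
  {σ | ∀ F : M.Face, ¬ F.IsBoundary → ∀ x ∈ (F : Set (Space d)), normalJump σ F x = 0}

variable {M k}

/-! ### Forms and norms -/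

/-- `a_h(σ, τ) = ∑_T (σ, τ)_T`. -/
def aForm (σ τ : M.SigmaDisc k) : ℝ :=
  ∑ t : M.SubCell, ∫ x in t.toSet, ⟪vecAt (σ t) x, vecAt (τ t) x⟫

/-- `∑_K (σ, ∇u)_K`, each `K` being split into its subelements. -/
def gradForm (σ : M.SigmaDisc k) (u : M.U k) : ℝ :=
  ∑ t : M.SubCell, ∫ x in t.toSet, ⟪vecAt (σ t) x, gradAt (u t.cell : MvPolynomial (Fin d) ℝ) x⟫

/-- The hybridized form
`b_h(σ, (u_0, u_b)) = ∑_K { -(σ, ∇u_0)_K + ⟨σ · n, Q_b u_0 - u_b⟩_{∂K} }`. -/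
def bHybrid (σ : M.SigmaDisc k) (u : M.MSpace k) : ℝ :=
  -gradForm σ u.1 +
    ∑ t : M.SubCell, ∫ x in (t.face : Set (Space d)),
      normalTrace σ t x *
        (faceProj k (t.face : Set (Space d)) (evalAt (u.1 t.cell : MvPolynomial (Fin d) ℝ)) x
          - (u.2 t.face : Space d → ℝ) x) ∂μHE[d - 1]

/-- `(f, v) = ∑_K ∫_K f v`. -/
def load (f : Space d → ℝ) (v : M.U k) : ℝ :=
  ∑ K : M.Cell, ∫ x in (K : Set (Space d)), f x * evalAt (v K : MvPolynomial (Fin d) ℝ) x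

/-- The hybridized problem: `a_h(σ, τ) + b_h(τ, u) = 0` for all `τ ∈ Σ_h^{-1}` and
`b_h(σ, v) = -(f, v_0)` for all `v ∈ M_h^0`. -/
def SolvesHybrid (f : Space d → ℝ) (σ : M.SigmaDisc k) (u : M.MZero k) : Prop :=
  (∀ τ : M.SigmaDisc k, aForm σ τ + bHybrid τ (u : M.MSpace k) = 0) ∧
  (∀ v ∈ M.MZero k, bHybrid σ v = -load f v.1)

open Classical in
/-- The jump `[u]_F = u|_{T₁} - u|_{T₂}` on an interior face and `[u]_F = u|_{T₁}` on a boundary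
face, where `T₁` is the first subelement at `F`. -/
def jump (T₁ : M.Face → M.SubCell) (u : M.U k) (F : M.Face) (x : Space d) : ℝ :=
  ∑ t : M.SubCell with t.face = F,
    (if t = T₁ F then 1 else -1) * evalAt (u t.cell : MvPolynomial (Fin d) ℝ) x

/-- The form of the staggered DG method,
`b_h(σ, u) = -∑_K (σ, ∇u)_K + ∑_F ⟨σ · n, Q_b [u]⟩_F`, where on `F` the normal `n` is outward to
the first subelement `T₁` at `F`. -/
def bForm (T₁ : M.Face → M.SubCell) (σ : M.SigmaDisc k) (u : M.U k) : ℝ :=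
  -gradForm σ u +
    ∑ F : M.Face, ∫ x in (F : Set (Space d)),
      normalTrace σ (T₁ F) x * faceProj k (F : Set (Space d)) (jump T₁ u F) x ∂μHE[d - 1]

/-- The staggered DG problem: `σ ∈ Σ_h`, `a_h(σ, τ) + b_h(τ, u) = 0` for all `τ ∈ Σ_h` and
`b_h(σ, v) = -(f, v)` for all `v ∈ U_h`. -/
def SolvesSDG (T₁ : M.Face → M.SubCell) (f : Space d → ℝ) (σ : M.SigmaDisc k) (u : M.U k) : Prop :=
  σ ∈ M.Sigma k ∧
  (∀ τ ∈ M.Sigma k, aForm σ τ + bForm T₁ τ u = 0) ∧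
  (∀ v : M.U k, bForm T₁ σ v = -load f v)

/-- `‖σ‖_{0,h} = (∑_K ‖σ‖_K² + ∑_K h_K ‖σ · n‖_{∂K}²)^{1/2}`. -/
def norm0 (σ : M.SigmaDisc k) : ℝ :=
  √(∑ t : M.SubCell, (∫ x in t.toSet, ‖vecAt (σ t) x‖ ^ 2) +
    ∑ t : M.SubCell, t.cell.h *
      ∫ x in (t.face : Set (Space d)), normalTrace σ t x ^ 2 ∂μHE[d - 1])

/-- `‖(u_0, u_b)‖_{1,h} = (∑_K ‖∇u_0‖_K² + ∑_K h_K⁻¹ ‖u_0 - u_b‖_{∂K}²)^{1/2}`. -/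
def norm1 (u : M.MSpace k) : ℝ :=
  √(∑ K : M.Cell, (∫ x in (K : Set (Space d)),
      ‖gradAt (u.1 K : MvPolynomial (Fin d) ℝ) x‖ ^ 2) +
    ∑ t : M.SubCell, t.cell.h⁻¹ *
      ∫ x in (t.face : Set (Space d)),
        (evalAt (u.1 t.cell : MvPolynomial (Fin d) ℝ) x
          - (u.2 t.face : Space d → ℝ) x) ^ 2 ∂μHE[d - 1])

end PolytopalMesh

end SDG

end

namespace SDG

/-! ### Polynomials on Euclidean space -/

section Polynomials

/-! The system is square and finite-dimensional, so unique solvability reduces to the triviality of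
homogeneous solutions. That triviality and the stability bound both come from an inf-sup estimate
and a discrete Poincaré inequality, with constants depending only on shape regularity and on a ball
containing `Ω`.

Inf-sup (`exists_energy_le`). Suppose `a(σ,τ) + b(τ,u) = 0` for all `τ`; the claim is that
`‖u‖_{1,h}` is bounded by `‖σ‖`. Taking for `τ` minus the part of `∇u_0` tangential to the face of
each subcell makes the normal trace vanish, so `σ` controls these tangential parts. They control the
whole gradient (`norm_sq_le_sum_tangential`): for `w ⟂ ∇u_0`, the ray from `x_K` in direction `w`
leaves `K` through a face whose normal satisfies `n · w ≥ 1/γ`, so `n` is far from parallel to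
`∇u_0`. A polynomial on all of `K` is bounded by its norm on any one subcell, so each tangential
part is only needed on its own subcell. Next, `τ = h_K⁻¹ E(Q_b u_0 - u_b) n`, with `E` a polynomial
extension from the face, controls the gap `Q_b u_0 - u_b`. The rest, `u_0 - Q_b u_0`, is a best
approximation error and is bounded by the gradient.

Poincaré (`exists_poincare`). The divergence theorem for `u_0² x` on each element gives `d ∑‖u_0‖²`
as a gradient term plus boundary terms in `u_0² n · x`. Since `u_b` is single valued and vanishes on
`∂Ω`, the terms `u_b² n · x` sum to zero and may be subtracted. What remains is absorbed by Young's
inequality and the discrete trace inequality. No regularity theory on `Ω` is needed.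

Stability. Testing with the solution gives `‖σ‖² = (f, u_0)`; Poincaré and inf-sup bound `‖u_0‖` by
`‖σ‖`. The traces in `‖σ‖_{0,h}` follow from the trace inequality.

Geometry. The divergence theorem on an element is obtained by hand: on a cone it is the fundamental
theorem of calculus along rays, and a star-shaped body is the almost disjoint union of the cones
over its faces. The scaled estimates hold because each subcell contains a ball of radius comparable
to `h_K`.

Equivalence with staggered DG. Testing with face functions forces the normal jumps of `σ_h` to
vanish, and on `Σ_h` the variable `u_b` cancels from `b_h`. -/

theorem totalDegree_aeval_le {σ τ : Type*} (g : σ → MvPolynomial τ ℝ)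
    (hg : ∀ i, (g i).totalDegree ≤ 1) (p : MvPolynomial σ ℝ) :
    (MvPolynomial.aeval g p).totalDegree ≤ p.totalDegree := by
  rw [MvPolynomial.aeval_def, MvPolynomial.eval₂_eq]
  refine MvPolynomial.totalDegree_finsetSum_le fun s hs => ?_
  refine (MvPolynomial.totalDegree_mul _ _).trans ?_
  have h1 : (algebraMap ℝ (MvPolynomial τ ℝ) (p.coeff s)).totalDegree = 0 := by
    rw [MvPolynomial.algebraMap_eq, MvPolynomial.totalDegree_C]
  rw [h1, zero_add]
  refine (MvPolynomial.totalDegree_finsetProd _ _).trans ?_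
  refine le_trans (Finset.sum_le_sum (g := fun i => s i) fun i _ => ?_)
    (MvPolynomial.le_totalDegree hs)
  refine (MvPolynomial.totalDegree_pow _ _).trans ?_
  simpa using Nat.mul_le_mul_left (s i) (hg i)

theorem totalDegree_pderiv_le {σ : Type*} {m : ℕ} (i : σ) (p : MvPolynomial σ ℝ)
    (hp : p.totalDegree ≤ m + 1) : (MvPolynomial.pderiv i p).totalDegree ≤ m := by
  classical
  rw [p.as_sum, map_sum]
  refine MvPolynomial.totalDegree_finsetSum_le fun s hs => ?_
  rw [MvPolynomial.pderiv_monomial]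
  by_cases h0 : s i = 0
  · simp [h0]
  refine (MvPolynomial.totalDegree_monomial_le _ _).trans ?_
  have h1 := (MvPolynomial.le_totalDegree hs).trans hp
  have h2 : (Finsupp.single i 1 : σ →₀ ℕ) ≤ s := by
    rw [Finsupp.single_le_iff]; omega
  have h3 : (s - Finsupp.single i 1) + Finsupp.single i 1 = s := tsub_add_cancel_of_le h2
  have h4 : (s.sum fun _ e => e) =
      ((s - Finsupp.single i 1).sum fun _ e => e) + 1 := by
    conv_lhs => rw [← h3]
    rw [Finsupp.sum_add_index' (by simp) (by simp)]
    simp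
  change ((s - Finsupp.single i 1).sum fun _ e => e) ≤ m
  omega

variable {d : ℕ}

theorem evalAt_add (p q : MvPolynomial (Fin d) ℝ) (x : Space d) :
    evalAt (p + q) x = evalAt p x + evalAt q x := by simp [evalAt]

theorem evalAt_smul (c : ℝ) (p : MvPolynomial (Fin d) ℝ) (x : Space d) :
    evalAt (c • p) x = c * evalAt p x := by simp [evalAt]

theorem evalAt_C (c : ℝ) (x : Space d) : evalAt (MvPolynomial.C c) x = c := by simp [evalAt]

theorem evalAt_sum {ι : Type*} (s : Finset ι) (p : ι → MvPolynomial (Fin d) ℝ) (x : Space d) :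
    evalAt (∑ i ∈ s, p i) x = ∑ i ∈ s, evalAt (p i) x := by simp [evalAt]

@[fun_prop]
theorem continuous_evalAt (p : MvPolynomial (Fin d) ℝ) : Continuous (evalAt p) := by
  unfold evalAt
  exact (MvPolynomial.continuous_eval p).comp (by fun_prop)

@[fun_prop]
theorem continuous_gradAt (p : MvPolynomial (Fin d) ℝ) : Continuous (gradAt p) := by
  unfold gradAt
  fun_prop

@[fun_prop]
theorem continuous_vecAt {m : ℕ} (s : VecPoly d m) : Continuous (vecAt s) := by
  unfold vecAt
  fun_prop

theorem hasFDerivAt_evalAt (p : MvPolynomial (Fin d) ℝ) (x : Space d) :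
    HasFDerivAt (evalAt p) (innerSL ℝ (gradAt p x)) x := by
  induction p using MvPolynomial.induction_on with
  | C a =>
    have : innerSL ℝ (gradAt (MvPolynomial.C a) x) = 0 := by
      ext v; simp [gradAt, evalAt, PiLp.inner_apply]
    rw [this]
    have h : evalAt (d := d) (MvPolynomial.C a) = fun _ => a := by ext; simp [evalAt]
    rw [h]; exact hasFDerivAt_const _ _
  | add p q hp hq =>
    have : innerSL ℝ (gradAt (p + q) x) = innerSL ℝ (gradAt p x) + innerSL ℝ (gradAt q x) := by
      ext v; simp [gradAt, evalAt, PiLp.inner_apply, mul_add, Finset.sum_add_distrib]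
    rw [this]
    exact (hp.add hq).congr_of_eventuallyEq (.of_forall fun y => by simp [evalAt])
  | mul_X p i hp =>
    have hX : HasFDerivAt (fun y : Space d => y i) (EuclideanSpace.proj i : Space d →L[ℝ] ℝ) x :=
      (EuclideanSpace.proj i : Space d →L[ℝ] ℝ).hasFDerivAt
    have h := hp.mul hX
    have hL : innerSL ℝ (gradAt (p * MvPolynomial.X i) x) =
        evalAt p x • (EuclideanSpace.proj i : Space d →L[ℝ] ℝ) +
          x.ofLp i • innerSL ℝ (gradAt p x) := by
      ext v
      simp only [gradAt, evalAt, innerSL_apply_apply, PiLp.inner_apply, MvPolynomial.pderiv_mul,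
        MvPolynomial.pderiv_X, Pi.single_apply, map_add, map_mul, MvPolynomial.eval_X,
        RCLike.inner_apply, conj_trivial, mul_add, Finset.sum_add_distrib,
        add_apply, smul_apply, smul_eq_mul,
        Finset.mul_sum, apply_ite (MvPolynomial.eval _), map_zero, mul_ite, mul_one,
        mul_zero, Finset.sum_ite_eq, Finset.mem_univ, if_true]
      rw [add_comm]
      congr 1
      · simp [mul_comm]
      exact Finset.sum_congr rfl fun j _ => by ring
    rw [hL]
    exact h.congr_of_eventuallyEq (.of_forall fun y => by simp [evalAt])

theorem contDiff_evalAt (p : MvPolynomial (Fin d) ℝ) : ContDiff ℝ 1 (evalAt p) := by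
  rw [contDiff_one_iff_fderiv]
  refine ⟨fun x => (hasFDerivAt_evalAt p x).differentiableAt, ?_⟩
  have : fderiv ℝ (evalAt p) = fun x => innerSL ℝ (gradAt p x) :=
    funext fun x => (hasFDerivAt_evalAt p x).fderiv
  rw [this]
  fun_prop

/-- Affine substitution does not raise the degree. It serves three purposes: scaling to the unit
ball, passing to coordinates of a hyperplane, and extending from a face along its normal. -/
theorem exists_poly_comp_affine {d' m : ℕ} (p : Poly d m) (A : Space d' →ₗ[ℝ] Space d)
    (b : Space d) :
    ∃ q : Poly d' m, ∀ x, evalAt (q : MvPolynomial (Fin d') ℝ) x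
      = evalAt (p : MvPolynomial (Fin d) ℝ) (b + A x) := by
  classical
  let g : Fin d → MvPolynomial (Fin d') ℝ := fun i =>
    MvPolynomial.C (b i) +
      ∑ j, MvPolynomial.C (A (EuclideanSpace.single j 1) i) * MvPolynomial.X j
  have hg : ∀ i, (g i).totalDegree ≤ 1 := fun i => by
    refine (MvPolynomial.totalDegree_add _ _).trans (max_le (by simp) ?_)
    refine MvPolynomial.totalDegree_finsetSum_le fun j _ => ?_
    refine (MvPolynomial.totalDegree_mul _ _).trans ?_
    simp
  refine ⟨⟨MvPolynomial.aeval g (p : MvPolynomial (Fin d) ℝ), ?_⟩, fun x => ?_⟩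
  · rw [MvPolynomial.mem_restrictTotalDegree]
    exact (totalDegree_aeval_le g hg _).trans ((MvPolynomial.mem_restrictTotalDegree _ _ _).1 p.2)
  · have hA : ∀ i, MvPolynomial.eval (fun j => x j) (g i) = (b + A x) i := fun i => by
      have hx : x = ∑ j, x j • (EuclideanSpace.single j 1 : Space d') := by
        ext l; simp [Pi.single_apply]
      conv_rhs => rw [hx]
      simp [g, mul_comm]
    unfold evalAt
    rw [MvPolynomial.map_aeval, funext hA]
    congr 1
    ext <;> simp

theorem poly_eq_zero_of_ball {p : MvPolynomial (Fin d) ℝ} {z : Space d} {r : ℝ} (hr : 0 < r)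
    (h : ∀ x ∈ Metric.ball z r, evalAt p x = 0) : p = 0 := by
  -- A sup-norm ball inside the Euclidean ball is a product of infinite sets, on which a vanishing
  -- polynomial is zero.
  have ho : IsOpen {y : Fin d → ℝ | (WithLp.toLp 2 y : Space d) ∈ Metric.ball z r} :=
    Metric.isOpen_ball.preimage (PiLp.continuous_toLp 2 _)
  obtain ⟨ε, hε, hs⟩ := Metric.isOpen_iff.1 ho (fun i => z i) (by simpa using hr)
  refine MvPolynomial.funext_set (fun i => Metric.ball (z i) ε) (fun i => ?_) fun y hy => ?_
  · rw [Real.ball_eq_Ioo]; exact Set.Ioo_infinite (by linarith)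
  · have : y ∈ Metric.ball (fun i => z i) ε := by
      rw [← ball_pi _ hε] at *
      simpa using hy
    simpa [evalAt] using h _ (hs this)

theorem poly_eq_zero_of_integral {p : MvPolynomial (Fin d) ℝ} {z : Space d} {r : ℝ} (hr : 0 < r)
    (h : ∫ x in Metric.ball z r, evalAt p x ^ 2 = 0) : p = 0 := by
  refine poly_eq_zero_of_ball hr (z := z) fun x hx => ?_
  have hc : Continuous fun x => evalAt p x ^ 2 := by fun_prop
  have hi : IntegrableOn (fun x => evalAt p x ^ 2) (Metric.ball z r) :=
    (hc.continuousOn.integrableOn_compact (isCompact_closedBall z r)).mono_set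
      Metric.ball_subset_closedBall
  rw [setIntegral_eq_zero_iff_of_nonneg_ae (.of_forall fun x => sq_nonneg _) hi] at h
  have := Measure.eqOn_open_of_ae_eq h Metric.isOpen_ball hc.continuousOn continuousOn_const hx
  simpa using this

end Polynomials


/-! ### Scaled norm equivalence for polynomials -/

section NormEquivalence

variable {d : ℕ}

theorem integrableOn_ball_of_continuous {f : Space d → ℝ} (hf : Continuous f) (z : Space d)
    (r : ℝ) : IntegrableOn f (Metric.ball z r) :=
  (hf.continuousOn.integrableOn_compact (isCompact_closedBall z r)).mono_set
    Metric.ball_subset_closedBall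

/-- A linear map on a finite-dimensional space is bounded by any inner product. -/
theorem exists_sq_norm_le_of_core {V G : Type*} [AddCommGroup V] [Module ℝ V]
    [FiniteDimensional ℝ V] [NormedAddCommGroup G] [NormedSpace ℝ G]
    (c : InnerProductSpace.Core ℝ V) (B : V →ₗ[ℝ] G) :
    ∃ C : ℝ, 0 < C ∧ ∀ v, ‖B v‖ ^ 2 ≤ C * c.inner v v := by
  let : NormedAddCommGroup V := c.toNormedAddCommGroup
  let : InnerProductSpace ℝ V := InnerProductSpace.ofCore c.toCore
  let B' := B.toContinuousLinearMap
  refine ⟨‖B'‖ ^ 2 + 1, by positivity, fun v => ?_⟩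
  have h : c.inner v v = ‖v‖ ^ 2 := real_inner_self_eq_norm_sq v
  rw [h]
  calc ‖B v‖ ^ 2 ≤ (‖B'‖ * ‖v‖) ^ 2 := by gcongr; exact B'.le_opNorm v
    _ ≤ (‖B'‖ ^ 2 + 1) * ‖v‖ ^ 2 := by nlinarith [sq_nonneg ‖v‖]

/-- The `L²` inner product on the unit ball as an inner product on polynomials. -/
noncomputable abbrev ballInnerCore (d m : ℕ) : InnerProductSpace.Core ℝ (Poly d m) where
  inner p q := ∫ x in Metric.ball (0 : Space d) 1,
    evalAt (p : MvPolynomial (Fin d) ℝ) x * evalAt (q : MvPolynomial (Fin d) ℝ) x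
  conj_inner_symm p q := by simp [mul_comm]
  re_inner_nonneg p := by
    simpa using integral_nonneg fun x => mul_self_nonneg _
  add_left p q r := by
    rw [← integral_add]
    · simp [evalAt_add, add_mul]
    all_goals exact integrableOn_ball_of_continuous (by fun_prop) _ _
  smul_left p q c := by
    rw [← integral_const_mul]
    simp [evalAt_smul, mul_assoc]
  definite p h := by
    refine Subtype.ext (poly_eq_zero_of_integral (z := 0) one_pos ?_)
    simpa [sq] using h

/-- Equivalence of norms in finite dimension: the sup norm on the ball of radius `κ` against the
`L²` norm on the unit ball, which is definite on polynomials. -/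
theorem exists_sq_evalAt_le_unit (d m : ℕ) (κ : ℝ) :
    ∃ C : ℝ, 0 < C ∧ ∀ (p : Poly d m) (x : Space d), ‖x‖ ≤ κ →
      evalAt (p : MvPolynomial (Fin d) ℝ) x ^ 2 ≤
        C * ∫ y in Metric.ball (0 : Space d) 1, evalAt (p : MvPolynomial (Fin d) ℝ) y ^ 2 := by
  have : CompactSpace (Metric.closedBall (0 : Space d) κ) :=
    isCompact_iff_compactSpace.1 (isCompact_closedBall _ _)
  let B : Poly d m →ₗ[ℝ] C(Metric.closedBall (0 : Space d) κ, ℝ) :=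
    { toFun := fun p => ⟨fun x => evalAt (p : MvPolynomial (Fin d) ℝ) x, by fun_prop⟩
      map_add' := fun p q => by ext; simp [evalAt_add]
      map_smul' := fun c p => by ext; simp [evalAt_smul] }
  obtain ⟨C, hC, h⟩ := exists_sq_norm_le_of_core (ballInnerCore d m) B
  refine ⟨C, hC, fun p x hx => ?_⟩
  have h1 : |evalAt (p : MvPolynomial (Fin d) ℝ) x| ≤ ‖B p‖ :=
    (B p).norm_coe_le_norm ⟨x, by simpa using hx⟩
  have h2 : ‖B p‖ ^ 2 ≤ C * ∫ y in Metric.ball (0 : Space d) 1,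
      evalAt (p : MvPolynomial (Fin d) ℝ) y ^ 2 := by
    refine (h p).trans_eq ?_
    congr 1
    exact integral_congr_ae (.of_forall fun y => (sq _).symm)
  rw [← sq_abs]
  exact le_trans (by gcongr) h2

/-- A polynomial is controlled on a large ball by its `L²`-norm on a smaller one. -/
theorem exists_sq_evalAt_le (d m : ℕ) (κ : ℝ) :
    ∃ C : ℝ, 0 < C ∧ ∀ (p : Poly d m) (z x : Space d) (r : ℝ), 0 < r → dist x z ≤ κ * r →
      r ^ d * evalAt (p : MvPolynomial (Fin d) ℝ) x ^ 2 ≤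
        C * ∫ y in Metric.ball z r, evalAt (p : MvPolynomial (Fin d) ℝ) y ^ 2 := by
  obtain ⟨C, hC, h⟩ := exists_sq_evalAt_le_unit d m κ
  refine ⟨C, hC, fun p z x r hr hx => ?_⟩
  -- Rescaling by `y ↦ z + r y` reduces to the unit ball; the Jacobian produces the factor `r ^ d`.
  obtain ⟨q, hq⟩ := exists_poly_comp_affine p (r • (LinearMap.id : Space d →ₗ[ℝ] Space d)) z
  have h1 := h q (r⁻¹ • (x - z)) (by
    rw [norm_smul, Real.norm_eq_abs, abs_of_pos (inv_pos.2 hr), ← dist_eq_norm]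
    rw [inv_mul_le_iff₀ hr, mul_comm]; exact hx)
  have h2 : evalAt (q : MvPolynomial (Fin d) ℝ) (r⁻¹ • (x - z)) =
      evalAt (p : MvPolynomial (Fin d) ℝ) x := by
    rw [hq]; simp [smul_smul, hr.ne']
  have h3 : ∫ y in Metric.ball (0 : Space d) 1, evalAt (q : MvPolynomial (Fin d) ℝ) y ^ 2 =
      (r ^ d)⁻¹ * ∫ y in Metric.ball z r, evalAt (p : MvPolynomial (Fin d) ℝ) y ^ 2 := by
    have h4 := Measure.setIntegral_comp_smul_of_pos (volume : Measure (Space d))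
      (fun y => evalAt (p : MvPolynomial (Fin d) ℝ) (z + y) ^ 2) (Metric.ball 0 1) hr
    simp only [finrank_euclideanSpace, Fintype.card_fin, smul_eq_mul] at h4
    rw [smul_unitBall_of_pos hr] at h4
    simp only [hq, LinearMap.smul_apply, LinearMap.id_apply]
    rw [h4]
    congr 1
    have h5 := (measurePreserving_add_left (volume : Measure (Space d)) z).setIntegral_preimage_emb
      (measurableEmbedding_addLeft z) (fun y => evalAt (p : MvPolynomial (Fin d) ℝ) y ^ 2)
      (Metric.ball z r)
    simpa [preimage_add_ball] using h5
  rw [h2, h3] at h1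
  have hrd : 0 < r ^ d := by positivity
  calc r ^ d * evalAt (p : MvPolynomial (Fin d) ℝ) x ^ 2 ≤ r ^ d * (C * ((r ^ d)⁻¹ *
        ∫ y in Metric.ball z r, evalAt (p : MvPolynomial (Fin d) ℝ) y ^ 2)) := by gcongr
    _ = _ := by field_simp

end NormEquivalence


/-! ### Orthonormal frames adapted to a hyperplane -/

section Frames

variable {d : ℕ}

/-- `n` is a unit vector and `L` an isometric parametrization of the hyperplane orthogonal to it. -/
structure IsFrame (n : Space d) (L : Space (d - 1) →ₗᵢ[ℝ] Space d) : Prop where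
  norm_eq_one : ‖n‖ = 1
  inner_eq_zero : ∀ w, ⟪n, L w⟫ = 0
  exists_eq : ∀ v, ⟪n, v⟫ = 0 → ∃ w, L w = v

theorem exists_isFrame {n : Space d} (hn : ‖n‖ = 1) :
    ∃ L : Space (d - 1) →ₗᵢ[ℝ] Space d, IsFrame n L := by
  have hn0 : n ≠ 0 := fun h => by simp [h] at hn
  have hf : Module.finrank ℝ (ℝ ∙ n)ᗮ = d - 1 := by
    have h1 := (ℝ ∙ n).finrank_add_finrank_orthogonal
    rw [finrank_span_singleton hn0, finrank_euclideanSpace, Fintype.card_fin] at h1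
    omega
  let e := ((stdOrthonormalBasis ℝ (ℝ ∙ n)ᗮ).reindex (finCongr hf)).repr.symm
  refine ⟨(ℝ ∙ n)ᗮ.subtypeₗᵢ.comp e.toLinearIsometry, hn, fun w => ?_, fun v hv => ?_⟩
  · exact Submodule.mem_orthogonal_singleton_iff_inner_right.1 (e w).2
  · exact ⟨e.symm ⟨v, Submodule.mem_orthogonal_singleton_iff_inner_right.2 hv⟩, by simp⟩

/-- The measure preserving coordinates `(a, v) ↦ x + a n + L v`. -/
theorem IsFrame.exists_measurableEquiv {n : Space d} {L : Space (d - 1) →ₗᵢ[ℝ] Space d}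
    (h : IsFrame n L) (x : Space d) :
    ∃ e : ℝ × Space (d - 1) ≃ᵐ Space d, (∀ q, e q = x + (q.1 • n + L q.2)) ∧
      MeasurePreserving e := by
  -- With the `L²` product norm this map is a linear isometry, hence volume preserving.
  let l : WithLp 2 (ℝ × Space (d - 1)) →ₗ[ℝ] Space d :=
    { toFun := fun q => q.fst • n + L q.snd
      map_add' := fun p q => by simp [add_smul]; abel
      map_smul' := fun c p => by simp [mul_smul] }
  have hl : ∀ q, ‖l q‖ = ‖q‖ := fun q => by
    have h1 : ‖l q‖ ^ 2 = ‖q‖ ^ 2 := by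
      change ‖q.fst • n + L q.snd‖ ^ 2 = _
      rw [norm_add_sq_real, real_inner_smul_left, h.inner_eq_zero, norm_smul, h.norm_eq_one,
        WithLp.prod_norm_sq_eq_of_L2]
      simp
    exact (sq_eq_sq₀ (norm_nonneg _) (norm_nonneg _)).1 h1
  let e' := LinearIsometryEquiv.ofSurjective (⟨l, hl⟩ : _ →ₗᵢ[ℝ] Space d) (fun v => by
    obtain ⟨w, hw⟩ := h.exists_eq (v - ⟪n, v⟫ • n) (by
      rw [inner_sub_right, real_inner_smul_right, real_inner_self_eq_norm_sq, h.norm_eq_one]; simp)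
    refine ⟨WithLp.toLp 2 (⟪n, v⟫, w), ?_⟩
    change ⟪n, v⟫ • n + L w = v
    rw [hw]; abel)
  refine ⟨((MeasurableEquiv.toLp 2 _).trans e'.toMeasurableEquiv).trans
    (MeasurableEquiv.addLeft x), fun q => rfl, ?_⟩
  exact ((WithLp.volume_preserving_toLp ℝ (Space (d - 1))).trans
    e'.measurePreserving).trans (measurePreserving_add_left volume x)

theorem IsFrame.isometry {n : Space d} {L : Space (d - 1) →ₗᵢ[ℝ] Space d} (_ : IsFrame n L)
    (o : Space d) : Isometry fun w => o + L w :=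
  (IsometryEquiv.addLeft o).isometry.comp L.isometry

/-- The normalized Hausdorff measure agrees with Lebesgue measure on `Space (d - 1)` and is
transported by isometries, so surface integrals over flat sets become Lebesgue integrals. -/
theorem setIntegral_euclideanHausdorffMeasure (L : Space (d - 1) →ₗᵢ[ℝ] Space d) (o : Space d)
    {F : Set (Space d)} (hF : F ⊆ Set.range fun w => o + L w) (g : Space d → ℝ) :
    ∫ y in F, g y ∂μHE[d - 1] = ∫ w in (fun w => o + L w) ⁻¹' F, g (o + L w) := by
  have hi : Isometry fun w => o + L w := (IsometryEquiv.addLeft o).isometry.comp L.isometry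
  have he : MeasurableEmbedding fun w => o + L w := hi.isClosedEmbedding.measurableEmbedding
  have h1 := he.setIntegral_map (μ := volume) g F
  rw [← EuclideanSpace.euclideanHausdorffMeasure_eq_volume (d - 1),
    hi.map_euclideanHausdorffMeasure, Measure.restrict_restrict_of_subset hF] at h1
  rw [h1, EuclideanSpace.euclideanHausdorffMeasure_eq_volume]

theorem euclideanHausdorffMeasure_eq_volume_preimage (L : Space (d - 1) →ₗᵢ[ℝ] Space d)
    (o : Space d) {F : Set (Space d)} (hF : F ⊆ Set.range fun w => o + L w) :
    μHE[d - 1] F = volume ((fun w => o + L w) ⁻¹' F) := by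
  have hi : Isometry fun w => o + L w := (IsometryEquiv.addLeft o).isometry.comp L.isometry
  rw [← EuclideanSpace.euclideanHausdorffMeasure_eq_volume (d - 1),
    hi.euclideanHausdorffMeasure_preimage, Set.inter_eq_left.2 hF]

end Frames

/-! ### Integration and the divergence theorem on cones -/

section Cone

variable {d : ℕ}

theorem isCompact_cone (x : Space d) {F : Set (Space d)} (hF : IsCompact F) :
    IsCompact (convexJoin ℝ {x} F) := by
  have : convexJoin ℝ {x} F =
      (fun q : ℝ × Space d => x + q.1 • (q.2 - x)) '' (Set.Icc (0 : ℝ) 1 ×ˢ F) := by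
    ext z
    simp only [mem_convexJoin, Set.mem_singleton_iff, exists_eq_left, segment_eq_image',
      Set.mem_image, Set.mem_prod, Prod.exists]
    constructor
    · rintro ⟨b, hb, s, hs, rfl⟩; exact ⟨s, b, ⟨hs, hb⟩, rfl⟩
    · rintro ⟨s, b, ⟨hs, hb⟩, rfl⟩; exact ⟨b, hb, s, hs, rfl⟩
  rw [this]
  exact (isCompact_Icc.prod hF).image (by fun_prop)

open scoped Pointwise in
/-- Integration over the cone with apex `x` and base `{x + H n + L w | w ∈ A}`. -/
theorem setIntegral_cone {n : Space d} {L : Space (d - 1) →ₗᵢ[ℝ] Space d}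
    (h : IsFrame n L) (x : Space d) {H : ℝ} (hH : 0 < H) {A : Set (Space (d - 1))}
    (hA : IsCompact A) {g : Space d → ℝ} (hg : Continuous g) :
    ∫ z in convexJoin ℝ {x} ((fun w => x + H • n + L w) '' A), g z =
      ∫ w in A, ∫ a in (0 : ℝ)..H, (a / H) ^ (d - 1) * g (x + (a • n + (a / H) • L w)) := by
  obtain ⟨e, he, hm⟩ := h.exists_measurableEquiv x
  set F := (fun w => x + H • n + L w) '' A with hF
  have hFc : IsCompact F := hA.image (by fun_prop)
  have hTc : IsCompact (convexJoin ℝ {x} F) := isCompact_cone x hFc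
  have hmem : ∀ a v, e (a, v) ∈ convexJoin ℝ {x} F ↔
      ∃ s ∈ Set.Icc (0 : ℝ) 1, ∃ w ∈ A, a = s * H ∧ v = s • w := by
    intro a v
    simp only [mem_convexJoin, Set.mem_singleton_iff, exists_eq_left, segment_eq_image',
        Set.mem_image, hF, exists_exists_and_eq_and]
    constructor
    · rintro ⟨w, hw, s, hs, hz⟩
      refine ⟨s, hs, w, hw, ?_⟩
      have : e (a, v) = e (s * H, s • w) := by
        rw [← hz, he]; simp only [map_smul, mul_smul, smul_sub, smul_add]; abel
      simpa using this
    · rintro ⟨s, hs, w, hw, rfl, rfl⟩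
      refine ⟨w, hw, s, hs, ?_⟩
      rw [he]; simp only [map_smul, mul_smul, smul_sub, smul_add]; abel
  have hgi : IntegrableOn (fun q => g (e q)) (e ⁻¹' convexJoin ℝ {x} F) := by
    have := hm.integrableOn_comp_preimage (f := g) (s := convexJoin ℝ {x} F) e.measurableEmbedding
    exact this.2 (hg.continuousOn.integrableOn_compact hTc)
  rw [← hm.setIntegral_preimage_emb e.measurableEmbedding]
  have hSm : MeasurableSet (e ⁻¹' convexJoin ℝ {x} F) := e.measurable hTc.measurableSet
  rw [← integral_indicator hSm, Measure.volume_eq_prod, integral_prod]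
  swap
  · exact hgi.integrable_indicator hSm
  -- The slice at height `a ∈ (0, H]` is the base scaled by `a / H`, and is empty at the other
  -- nonzero heights. Height `0` is a null set of heights and is discarded.
  have hslice : ∀ a : ℝ, a ≠ 0 →
      ∫ v, (e ⁻¹' convexJoin ℝ {x} F).indicator (fun q => g (e q)) (a, v) =
      (Set.Ioc 0 H).indicator (fun a => ∫ w in A,
        (a / H) ^ (d - 1) * g (x + (a • n + (a / H) • L w))) a := by
    intro a ha
    by_cases haH : a ∈ Set.Ioc 0 H
    · rw [Set.indicator_of_mem haH]
      have hpos : 0 < a / H := div_pos haH.1 hH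
      have h1 : ∀ v, (e ⁻¹' convexJoin ℝ {x} F).indicator (fun q => g (e q)) (a, v) =
          ((a / H) • A).indicator (fun v => g (e (a, v))) v := by
        intro v
        have : e (a, v) ∈ convexJoin ℝ {x} F ↔ v ∈ (a / H) • A := by
          rw [hmem]
          constructor
          · rintro ⟨s, hs, w, hw, rfl, rfl⟩
            rw [mul_div_cancel_right₀ _ hH.ne']
            exact Set.smul_mem_smul_set hw
          · rintro ⟨w, hw, rfl⟩
            exact ⟨a / H, ⟨hpos.le, (div_le_one hH).2 haH.2⟩, w, hw, by field_simp, rfl⟩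
        by_cases hv : v ∈ (a / H) • A
        · rw [Set.indicator_of_mem hv,
            Set.indicator_of_mem (show (a, v) ∈ e ⁻¹' convexJoin ℝ {x} F from this.2 hv)]
        · rw [Set.indicator_of_notMem hv,
            Set.indicator_of_notMem
              (show (a, v) ∉ e ⁻¹' convexJoin ℝ {x} F from fun h' => hv (this.1 h'))]
      simp only [h1]
      rw [integral_indicator (hA.smul _).measurableSet]
      have h2 := Measure.setIntegral_comp_smul_of_pos volume (fun v => g (e (a, v))) A hpos
      simp only [finrank_euclideanSpace, Fintype.card_fin, smul_eq_mul] at h2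
      rw [integral_const_mul]
      have h3 : ∀ w, g (x + (a • n + (a / H) • L w)) = g (e (a, (a / H) • w)) := fun w => by
        rw [he]; simp
      simp only [h3]
      rw [h2]
      field_simp
    · rw [Set.indicator_of_notMem haH]
      have h1 : ∀ v, (e ⁻¹' convexJoin ℝ {x} F).indicator (fun q => g (e q)) (a, v) = 0 := by
        intro v
        refine Set.indicator_of_notMem (fun hv => haH ?_) _
        obtain ⟨s, hs, w, hw, rfl, rfl⟩ := (hmem _ _).1 hv
        have : 0 < s := lt_of_le_of_ne hs.1 (fun h0 => ha (by simp [← h0]))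
        exact ⟨by positivity, by nlinarith [hs.2]⟩
      simp only [h1, integral_zero]
  have hae : (fun a : ℝ => ∫ v, (e ⁻¹' convexJoin ℝ {x} F).indicator (fun q => g (e q)) (a, v))
      =ᵐ[volume] (Set.Ioc 0 H).indicator (fun a => ∫ w in A,
        (a / H) ^ (d - 1) * g (x + (a • n + (a / H) • L w))) := by
    have : ∀ᵐ a : ℝ, a ≠ 0 := by simp [ae_iff]
    filter_upwards [this] with a ha using hslice a ha
  rw [integral_congr_ae hae, integral_indicator measurableSet_Ioc, integral_integral_swap]
  · simp only [intervalIntegral.integral_of_le hH.le]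
  · rw [Measure.prod_restrict]
    refine IntegrableOn.mono_set (t := Set.Icc 0 H ×ˢ A) ?_
      (Set.prod_mono Set.Ioc_subset_Icc_self subset_rfl)
    refine ContinuousOn.integrableOn_compact (isCompact_Icc.prod hA) ?_
    refine Continuous.continuousOn ?_
    unfold Function.uncurry
    fun_prop

/-- The divergence theorem for the field `p (z - x)` on the cone with apex `x`. -/
theorem setIntegral_cone_div (hd : 1 ≤ d) {n : Space d} {L : Space (d - 1) →ₗᵢ[ℝ] Space d}
    (h : IsFrame n L) (x : Space d) {H : ℝ} (hH : 0 < H) {A : Set (Space (d - 1))}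
    (hA : IsCompact A) {p : Space d → ℝ} (hp : ContDiff ℝ 1 p) :
    ∫ z in convexJoin ℝ {x} ((fun w => x + H • n + L w) '' A), (d * p z + fderiv ℝ p z (z - x)) =
      H * ∫ w in A, p (x + H • n + L w) := by
  have hf : Continuous (fderiv ℝ p) := hp.continuous_fderiv (by simp)
  have hp0 := hp.continuous
  rw [setIntegral_cone h x hH hA (by fun_prop), ← integral_const_mul]
  refine integral_congr_ae (.of_forall fun w => ?_)
  dsimp only
  -- Along the ray through `w` one has `z - x = a (n + H⁻¹ L w)`, so the integrand is an exact
  -- derivative in `a`. Its primitive is `H p` at the base and `0` at the apex.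
  have hder : ∀ a : ℝ, HasDerivAt
      (fun a : ℝ => a * (a / H) ^ (d - 1) * p (x + (a • n + (a / H) • L w)))
      ((a / H) ^ (d - 1) * (d * p (x + (a • n + (a / H) • L w)) +
        fderiv ℝ p (x + (a • n + (a / H) • L w)) (x + (a • n + (a / H) • L w) - x))) a := by
    intro a
    have hd1 : HasDerivAt (fun a : ℝ => a / H) (1 / H) a := (hasDerivAt_id a).div_const H
    have h1 : HasDerivAt (fun a : ℝ => x + (a • n + (a / H) • L w))
        ((1 : ℝ) • n + (1 / H) • L w) a :=
      (((hasDerivAt_id a).smul_const n).add (hd1.smul_const (L w))).const_add x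
    have h2 := ((hp.differentiable (by simp)
      (x + (a • n + (a / H) • L w))).hasFDerivAt).comp_hasDerivAt a h1
    have h3 : HasDerivAt (fun a : ℝ => a * (a / H) ^ (d - 1)) (d * (a / H) ^ (d - 1)) a := by
      obtain ⟨m, hm⟩ := Nat.exists_eq_add_of_le' hd
      have hdm : d - 1 = m := by omega
      rw [hdm, hm]
      refine ((hasDerivAt_id a).mul (hd1.pow m)).congr_deriv ?_
      cases m with
      | zero => simp
      | succ m => simp [pow_succ]; field_simp; ring
    have h5 := h3.mul h2
    refine h5.congr_deriv ?_
    have h6 : x + (a • n + (a / H) • L w) - x = a • ((1 : ℝ) • n + (1 / H) • L w) := by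
      rw [add_sub_cancel_left, smul_add, smul_smul, smul_smul]; congr 2 <;> ring
    rw [h6, map_smul, smul_eq_mul, Function.comp_apply]
    ring
  rw [intervalIntegral.integral_eq_sub_of_hasDerivAt (fun a _ => hder a)
    (Continuous.intervalIntegrable (by fun_prop) _ _)]
  rw [div_self hH.ne']
  simp [add_assoc]

end Cone


/-! ### Star-shaped bodies and the divergence theorem -/

section StarBody

variable {d : ℕ}

/-- `K` is compact and star-shaped with respect to every point of the closed ball of radius `ρ`
around its element `x`. -/
structure IsStarBody (K : Set (Space d)) (x : Space d) (ρ : ℝ) : Prop where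
  pos : 0 < ρ
  isCompact : IsCompact K
  mem : x ∈ K
  starConvex : ∀ b, dist b x ≤ ρ → StarConvex ℝ b K

namespace IsStarBody

variable {K : Set (Space d)} {x : Space d} {ρ : ℝ}

theorem closedBall_subset (h : IsStarBody K x ρ) : Metric.closedBall x ρ ⊆ K :=
  fun b hb => (h.starConvex b hb).mem ⟨x, h.mem⟩

/-- The apex may be perturbed at the price of half the radius; this freedom gives the divergence
theorem with an arbitrary centre. -/
theorem move (h : IsStarBody K x ρ) {x' : Space d} (hx : dist x' x ≤ ρ / 2) :
    IsStarBody K x' (ρ / 2) where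
  pos := half_pos h.pos
  isCompact := h.isCompact
  mem := h.closedBall_subset (by have := h.pos; simp only [Metric.mem_closedBall]; linarith)
  starConvex b hb := h.starConvex b (by linarith [dist_triangle b x' x])

/-- The homothety with centre `y` and ratio `s` carries a small ball around `b`, still inside the
kernel ball, to a ball contained in `K`. -/
theorem mem_interior (h : IsStarBody K x ρ) {y b : Space d} (hy : y ∈ K) (hb : dist b x < ρ)
    {s : ℝ} (hs : 0 < s) (hs1 : s ≤ 1) : y + s • (b - y) ∈ interior K := by
  rw [_root_.mem_interior]
  refine ⟨Metric.ball (y + s • (b - y)) (s * (ρ - dist b x)), fun z hz => ?_,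
    Metric.isOpen_ball, Metric.mem_ball_self (mul_pos hs (by linarith))⟩
  have hz' : dist (y + s⁻¹ • (z - y)) x ≤ ρ := by
    have h1 : y + s⁻¹ • (z - y) - b = s⁻¹ • (z - (y + s • (b - y))) := by
      rw [← sub_sub, smul_sub s⁻¹ (z - y), inv_smul_smul₀ hs.ne']; abel
    have h2 : dist (y + s⁻¹ • (z - y)) b ≤ ρ - dist b x := by
      rw [dist_eq_norm, h1, norm_smul, Real.norm_eq_abs, abs_of_pos (inv_pos.2 hs),
        inv_mul_le_iff₀ hs, ← dist_eq_norm]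
      exact (Metric.mem_ball.1 hz).le
    linarith [dist_triangle (y + s⁻¹ • (z - y)) b x]
  have h3 := (h.starConvex _ hz') hy hs.le (by linarith : (0 : ℝ) ≤ 1 - s) (by ring)
  convert h3 using 1
  rw [smul_add, smul_inv_smul₀ hs.ne', sub_smul, one_smul]
  abel

theorem segment_subset (h : IsStarBody K x ρ) {y : Space d} (hy : y ∈ K) : segment ℝ x y ⊆ K :=
  (h.starConvex x (by simp [h.pos.le])).segment_subset hy

theorem subset_closure_interior (h : IsStarBody K x ρ) : K ⊆ closure (interior K) := by
  intro y hy
  have ht : Filter.Tendsto (fun s : ℝ => y + s • (x - y)) (nhdsWithin 0 (Set.Ioi 0)) (nhds y) := by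
    have : Continuous fun s : ℝ => y + s • (x - y) := by fun_prop
    simpa using (this.tendsto 0).mono_left nhdsWithin_le_nhds
  refine mem_closure_of_tendsto ht ?_
  filter_upwards [Ioc_mem_nhdsGT (zero_lt_one' ℝ)] with s hs
  exact h.mem_interior hy (by simpa using h.pos) hs.1 hs.2

/-- Every point of a star-shaped body lies on a segment from the centre to a boundary point. -/
theorem exists_frontier (h : IsStarBody K x ρ) {z : Space d} (hz : z ∈ K) (hzx : z ≠ x) :
    ∃ y ∈ frontier K, z ∈ segment ℝ x y := by
  have hv : 0 < ‖z - x‖ := norm_pos_iff.2 (sub_ne_zero.2 hzx)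
  -- The boundary point is the last point of `K` on the ray: if it were interior, the ray would stay
  -- in `K` a little longer.
  let S : Set ℝ := {s | x + s • (z - x) ∈ K}
  have hcont : Continuous fun s : ℝ => x + s • (z - x) := by fun_prop
  have hScl : IsClosed S := h.isCompact.isClosed.preimage hcont
  obtain ⟨R, hR⟩ := h.isCompact.isBounded.subset_closedBall x
  have hSb : BddAbove S := ⟨R / ‖z - x‖, fun s hs => by
    have := hR hs
    rw [Metric.mem_closedBall, dist_eq_norm, add_sub_cancel_left, norm_smul] at this
    rw [le_div_iff₀ hv]
    exact (mul_le_mul_of_nonneg_right (le_abs_self s) hv.le).trans this⟩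
  have h1S : (1 : ℝ) ∈ S := by simpa [S] using hz
  have hmem : sSup S ∈ S := hScl.csSup_mem ⟨1, h1S⟩ hSb
  have h1 : 1 ≤ sSup S := le_csSup hSb h1S
  refine ⟨x + sSup S • (z - x), ⟨subset_closure hmem, fun hint => ?_⟩, ?_⟩
  · have hnear : ∀ᶠ s in nhds (sSup S), x + s • (z - x) ∈ K :=
      (hcont.tendsto (sSup S)).eventually (mem_interior_iff_mem_nhds.1 hint)
    obtain ⟨s, hs, hs'⟩ := (hnear.filter_mono (nhdsWithin_le_nhds (s := Set.Ioi (sSup S)))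
      |>.and self_mem_nhdsWithin).exists
    exact absurd (le_csSup hSb hs) (not_le.2 hs')
  · rw [segment_eq_image']
    refine ⟨(sSup S)⁻¹, ⟨by positivity, inv_le_one_of_one_le₀ h1⟩, ?_⟩
    simp [inv_smul_smul₀ (by positivity : sSup S ≠ 0)]

/-- A ray from the centre meets the boundary only once. -/
theorem frontier_unique (h : IsStarBody K x ρ) {y₁ y₂ : Space d} (h1 : y₁ ∈ frontier K)
    (h2 : y₂ ∈ frontier K) {s₁ s₂ : ℝ} (hs₁ : 0 < s₁) (hs₂ : 0 < s₂)
    (he : s₁ • (y₁ - x) = s₂ • (y₂ - x)) : y₁ = y₂ := by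
  -- If `s₂ < s₁`, then `y₁` lies strictly between the centre and `y₂`, hence in the interior.
  have key : ∀ {y₁ y₂ : Space d} {s₁ s₂ : ℝ}, y₁ ∈ frontier K → y₂ ∈ frontier K → 0 < s₁ →
      0 < s₂ → s₁ • (y₁ - x) = s₂ • (y₂ - x) → ¬ s₂ < s₁ := by
    intro y₁ y₂ s₁ s₂ h1 h2 hs₁ hs₂ he hlt
    refine h1.2 ?_
    have hy : y₁ = y₂ + (1 - s₂ / s₁) • (x - y₂) := by
      have h3 : y₁ - x = (s₂ / s₁) • (y₂ - x) := by
        rw [div_eq_inv_mul, mul_smul, ← he, inv_smul_smul₀ hs₁.ne']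
      rw [← sub_add_cancel y₁ x, h3, sub_smul, one_smul, smul_sub, smul_sub]; abel
    rw [hy]
    have h4 : s₂ / s₁ < 1 := (div_lt_one hs₁).2 hlt
    have h5 : 0 < s₂ / s₁ := by positivity
    exact h.mem_interior (h.isCompact.isClosed.frontier_subset h2) (by simpa using h.pos)
      (by linarith) (by linarith)
  have hs : s₁ = s₂ :=
    le_antisymm (not_lt.1 (key h1 h2 hs₁ hs₂ he)) (not_lt.1 (key h2 h1 hs₂ hs₁ he.symm))
  subst hs
  simpa using smul_right_injective _ hs₁.ne' he

end IsStarBody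

/-- `F` is a compact subset of the hyperplane through `o` with unit normal `n`, and it contains the
`(d-1)`-dimensional ball of radius `r` around `o`. -/
structure IsFlatFace (F : Set (Space d)) (n : Space d) (L : Space (d - 1) →ₗᵢ[ℝ] Space d)
    (o : Space d) (r : ℝ) : Prop extends IsFrame n L where
  isCompact : IsCompact F
  pos : 0 < r
  inner_sub : ∀ z ∈ F, ⟪n, z - o⟫ = 0
  mem_ball : ∀ w, ‖w‖ ≤ r → o + L w ∈ F

namespace IsFlatFace

variable {F : Set (Space d)} {n : Space d} {L : Space (d - 1) →ₗᵢ[ℝ] Space d} {o : Space d} {r : ℝ}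

theorem center_mem (h : IsFlatFace F n L o r) : o ∈ F := by
  simpa using h.mem_ball 0 (by simpa using h.pos.le)

theorem subset_range (h : IsFlatFace F n L o r) : F ⊆ Set.range fun w => o + L w := fun z hz => by
  obtain ⟨w, hw⟩ := h.exists_eq _ (h.inner_sub z hz)
  exact ⟨w, by simp [hw]⟩

theorem inner_eq (h : IsFlatFace F n L o r) (x : Space d) {z : Space d} (hz : z ∈ F) :
    ⟪n, z - x⟫ = ⟪n, o - x⟫ := by
  have := h.inner_sub z hz
  rw [inner_sub_right] at *
  rw [inner_sub_right]
  linarith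

/-- The hyperplane of a boundary face stays away from the kernel ball of a star-shaped body. -/
theorem le_abs_height (h : IsFlatFace F n L o r) {K : Set (Space d)} {x : Space d} {ρ : ℝ}
    (hK : IsStarBody K x ρ) (hF : F ⊆ frontier K) : ρ ≤ |⟪n, o - x⟫| := by
  by_contra! hlt
  set c := ⟪n, o - x⟫ with hc
  have hb : dist (x + c • n) x < ρ := by
    rw [dist_eq_norm, add_sub_cancel_left, norm_smul, h.norm_eq_one, mul_one]; exact hlt
  -- Were the height below `ρ`, the foot of the perpendicular from `x` would lie in the open kernel
  -- ball. A short step from `o` towards it stays in `F`, yet lands in the interior of `K`,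
  -- contradicting `F ⊆ frontier K`.
  obtain ⟨w, hw⟩ := h.exists_eq (x + c • n - o) (by
    have : x + c • n - o = c • n - (o - x) := by abel
    rw [this, inner_sub_right, real_inner_smul_right, real_inner_self_eq_norm_sq, h.norm_eq_one,
      ← hc]; ring)
  obtain ⟨s, hs0, hs1, hs⟩ : ∃ s : ℝ, 0 < s ∧ s ≤ 1 ∧ ‖s • w‖ ≤ r := by
    refine ⟨min 1 (r / (‖w‖ + 1)), lt_min one_pos (div_pos h.pos (by positivity)), min_le_left _ _, ?_⟩
    rw [norm_smul, Real.norm_eq_abs, abs_of_pos (lt_min one_pos (div_pos h.pos (by positivity)))]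
    calc min 1 (r / (‖w‖ + 1)) * ‖w‖ ≤ r / (‖w‖ + 1) * (‖w‖ + 1) := by
          have := h.pos
          gcongr
          · exact min_le_right _ _
          · linarith
      _ = r := by field_simp
  have h1 := h.mem_ball _ hs
  rw [map_smul, hw] at h1
  exact (hF h1).2 (hK.mem_interior (hK.isCompact.isClosed.frontier_subset (hF h.center_mem))
    hb hs0 hs1)

/-- Takes the foot of the perpendicular from `x` as origin of the hyperplane, which is the form of
the base required for integrating over a cone. -/
theorem subset_range_foot (h : IsFlatFace F n L o r) (x : Space d) {G : Set (Space d)} (hG : G ⊆ F) :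
    G ⊆ Set.range fun w => x + ⟪n, o - x⟫ • n + L w := by
  obtain ⟨c, hc⟩ := h.exists_eq (o - (x + ⟪n, o - x⟫ • n)) (by
    rw [← sub_sub, inner_sub_right, real_inner_smul_right, real_inner_self_eq_norm_sq,
      h.norm_eq_one]; ring)
  intro z hz
  obtain ⟨w, hw⟩ := h.subset_range (hG hz)
  refine ⟨c + w, ?_⟩
  dsimp only at hw ⊢
  rw [map_add, hc, ← hw]; abel

/-- The divergence theorem for the field `p (z - x)` on the cone with apex `x` over a part of a
flat face. -/
theorem setIntegral_cone_div (h : IsFlatFace F n L o r) (hd : 1 ≤ d) {x : Space d}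
    (hH : 0 < ⟪n, o - x⟫) {G : Set (Space d)} (hG : G ⊆ F) (hGc : IsCompact G)
    {p : Space d → ℝ} (hp : ContDiff ℝ 1 p) :
    ∫ z in convexJoin ℝ {x} G, (d * p z + fderiv ℝ p z (z - x)) =
      ⟪n, o - x⟫ * ∫ y in G, p y ∂μHE[d - 1] := by
  have hr := h.subset_range_foot x hG
  have hi := (h.toIsFrame.isometry (x + ⟪n, o - x⟫ • n)).isClosedEmbedding
  have h1 := SDG.setIntegral_cone_div hd h.toIsFrame x hH (hi.isCompact_preimage hGc) hp
  rw [Set.image_preimage_eq_iff.2 hr] at h1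
  rw [h1, setIntegral_euclideanHausdorffMeasure L _ hr]

/-- The divergence theorem with `p = 1` gives volume equal to height times base area over `d`. -/
theorem volume_cone_eq_zero (h : IsFlatFace F n L o r) (hd : 1 ≤ d) {x : Space d}
    (hH : 0 < ⟪n, o - x⟫) {G : Set (Space d)} (hG : G ⊆ F) (hGc : IsCompact G)
    (h0 : μHE[d - 1] G = 0) : volume (convexJoin ℝ {x} G) = 0 := by
  have h1 := h.setIntegral_cone_div hd hH hG hGc (p := fun _ => 1) contDiff_const
  have hlt := (isCompact_cone x hGc).measure_lt_top (μ := volume)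
  rw [Measure.restrict_eq_zero.2 h0, integral_zero_measure, mul_zero] at h1
  have hd0 : (d : ℝ) ≠ 0 := by positivity
  simpa [hd0, measureReal_def, ENNReal.toReal_eq_zero_iff, hlt.ne, -convexJoin_singleton_left]
    using h1

end IsFlatFace

/-! ### Decomposition of star-shaped bodies into cones -/

section Divergence

variable {K : Set (Space d)} {x : Space d} {ρ : ℝ} {ι : Type*} {F : ι → Set (Space d)}
  {n : ι → Space d} {L : ι → Space (d - 1) →ₗᵢ[ℝ] Space d} {o : ι → Space d} {r : ι → ℝ}

/-- The cones over the boundary faces cover a star-shaped body. -/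
theorem IsStarBody.eq_iUnion_cone (hK : IsStarBody K x ρ) (hd : 1 ≤ d)
    (hF : frontier K = ⋃ i, F i) : K = ⋃ i, convexJoin ℝ {x} (F i) := by
  refine Set.Subset.antisymm (fun z hz => ?_) (Set.iUnion_subset fun i z hz => ?_)
  · simp only [Set.mem_iUnion, mem_convexJoin, Set.mem_singleton_iff, exists_eq_left]
    by_cases hzx : z = x
    · subst hzx
      have : Nonempty (Fin d) := ⟨⟨0, hd⟩⟩
      obtain ⟨v, hv⟩ := exists_ne (0 : Space d)
      have hb : z + (ρ / ‖v‖) • v ∈ K := hK.closedBall_subset (by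
        simp [norm_smul, abs_of_pos hK.pos, hv])
      obtain ⟨y, hy, -⟩ := hK.exists_frontier hb (by simp [hK.pos.ne', hv])
      rw [hF, Set.mem_iUnion] at hy
      obtain ⟨i, hi⟩ := hy
      exact ⟨i, y, hi, left_mem_segment ℝ _ _⟩
    · obtain ⟨y, hy, hzy⟩ := hK.exists_frontier hz hzx
      rw [hF, Set.mem_iUnion] at hy
      obtain ⟨i, hi⟩ := hy
      exact ⟨i, y, hi, hzy⟩
  · simp only [mem_convexJoin, Set.mem_singleton_iff, exists_eq_left] at hz
    obtain ⟨y, hy, hzy⟩ := hz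
    exact hK.segment_subset (hK.isCompact.isClosed.frontier_subset
      (hF ▸ Set.mem_iUnion_of_mem i hy)) hzy

/-- Each ray from the apex meets the boundary once, so two cones share only the apex and the cone
over the common part of their bases, which is null. -/
theorem IsStarBody.aedisjoint_cone (hK : IsStarBody K x ρ) (hd : 1 ≤ d)
    (hface : ∀ i, IsFlatFace (F i) (n i) (L i) (o i) (r i)) (hF : frontier K = ⋃ i, F i)
    (hnull : ∀ i j, i ≠ j → μHE[d - 1] (F i ∩ F j) = 0) (hH : ∀ i, 0 < ⟪n i, o i - x⟫) {i j : ι}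
    (hij : i ≠ j) : AEDisjoint volume (convexJoin ℝ {x} (F i)) (convexJoin ℝ {x} (F j)) := by
  refine measure_mono_null (t := convexJoin ℝ {x} (F i ∩ F j) ∪ {x}) ?_
    (measure_union_null ?_ ?_)
  · rintro z ⟨hzi, hzj⟩
    simp only [mem_convexJoin, Set.mem_singleton_iff, exists_eq_left, segment_eq_image',
      Set.mem_image] at hzi hzj
    obtain ⟨y₁, hy₁, s₁, hs₁, h1⟩ := hzi
    obtain ⟨y₂, hy₂, s₂, hs₂, h2⟩ := hzj
    by_cases hzx : z = x
    · exact Or.inr hzx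
    have hp₁ : 0 < s₁ := lt_of_le_of_ne hs₁.1 fun h0 => hzx (by rw [← h1, ← h0]; simp)
    have hp₂ : 0 < s₂ := lt_of_le_of_ne hs₂.1 fun h0 => hzx (by rw [← h2, ← h0]; simp)
    have he : y₁ = y₂ := hK.frontier_unique (hF ▸ Set.mem_iUnion_of_mem i hy₁)
      (hF ▸ Set.mem_iUnion_of_mem j hy₂) hp₁ hp₂ (add_left_cancel (h1.trans h2.symm))
    left
    simp only [mem_convexJoin, Set.mem_singleton_iff, exists_eq_left, segment_eq_image',
      Set.mem_image]
    exact ⟨y₁, ⟨hy₁, he ▸ hy₂⟩, s₁, hs₁, h1⟩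
  · exact (hface i).volume_cone_eq_zero hd (hH i) Set.inter_subset_left
      ((hface i).isCompact.inter (hface j).isCompact) (hnull i j hij)
  · have : Nonempty (Fin d) := ⟨⟨0, hd⟩⟩
    exact measure_singleton x

theorem IsStarBody.setIntegral_eq_sum_cone [Fintype ι] (hK : IsStarBody K x ρ) (hd : 1 ≤ d)
    (hface : ∀ i, IsFlatFace (F i) (n i) (L i) (o i) (r i)) (hF : frontier K = ⋃ i, F i)
    (hnull : ∀ i j, i ≠ j → μHE[d - 1] (F i ∩ F j) = 0) (hH : ∀ i, 0 < ⟪n i, o i - x⟫)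
    {g : Space d → ℝ} (hg : IntegrableOn g K) :
    ∫ z in K, g z = ∑ i, ∫ z in convexJoin ℝ {x} (F i), g z := by
  have hU := hK.eq_iUnion_cone hd hF
  rw [hU] at hg
  conv_lhs => rw [hU]
  rw [integral_iUnion_ae
    (fun i => (isCompact_cone x (hface i).isCompact).measurableSet.nullMeasurableSet)
    (fun i j hij => hK.aedisjoint_cone hd hface hF hnull hH hij) hg, tsum_fintype]

/-- The divergence theorem for the field `p (z - x')`, with any centre `x'`, on a star-shaped body
with flat boundary faces. -/
theorem IsStarBody.setIntegral_div [Fintype ι] (hK : IsStarBody K x ρ) (hd : 1 ≤ d)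
    (hface : ∀ i, IsFlatFace (F i) (n i) (L i) (o i) (r i)) (hF : frontier K = ⋃ i, F i)
    (hnull : ∀ i j, i ≠ j → μHE[d - 1] (F i ∩ F j) = 0) (hH : ∀ i, 0 < ⟪n i, o i - x⟫)
    {p : Space d → ℝ} (hp : ContDiff ℝ 1 p) (x' : Space d) :
    ∫ z in K, (d * p z + fderiv ℝ p z (z - x')) =
      ∑ i, ⟪n i, o i - x'⟫ * ∫ y in F i, p y ∂μHE[d - 1] := by
  have hf : Continuous (fderiv ℝ p) := hp.continuous_fderiv (by simp)
  have hp0 := hp.continuous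
  have hint : ∀ {g : Space d → ℝ}, Continuous g → IntegrableOn g K := fun hg =>
    hg.continuousOn.integrableOn_compact hK.isCompact
  -- For `x'` within `ρ / 2` of `x` the body is still star-shaped about `x'` and all heights remain
  -- positive, so the cones with apex `x'` may be summed.
  have near : ∀ x', dist x' x ≤ ρ / 2 → ∫ z in K, (d * p z + fderiv ℝ p z (z - x')) =
      ∑ i, ⟪n i, o i - x'⟫ * ∫ y in F i, p y ∂μHE[d - 1] := by
    intro x' hx'
    have hH' : ∀ i, 0 < ⟪n i, o i - x'⟫ := fun i => by
      have h1 := (hface i).le_abs_height hK (hF ▸ Set.subset_iUnion F i)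
      rw [abs_of_pos (hH i)] at h1
      have h2 : ⟪n i, o i - x'⟫ = ⟪n i, o i - x⟫ - ⟪n i, x' - x⟫ := by
        rw [← inner_sub_right]; congr 1; abel
      have h3 := real_inner_le_norm (n i) (x' - x)
      rw [(hface i).norm_eq_one, one_mul, ← dist_eq_norm] at h3
      have := hK.pos
      linarith
    rw [(hK.move hx').setIntegral_eq_sum_cone hd hface hF hnull hH' (hint (by fun_prop))]
    refine Finset.sum_congr rfl fun i _ => ?_
    exact (hface i).setIntegral_cone_div hd (hH' i) subset_rfl (hface i).isCompact hp
  obtain ⟨s, hs, hsx⟩ : ∃ s : ℝ, 0 < s ∧ dist (x + s • (x' - x)) x ≤ ρ / 2 := by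
    refine ⟨ρ / 2 / (‖x' - x‖ + 1), by have := hK.pos; positivity, ?_⟩
    have := hK.pos
    rw [dist_eq_norm, add_sub_cancel_left, norm_smul, Real.norm_eq_abs, abs_of_pos (by positivity),
      div_mul_eq_mul_div, div_le_iff₀ (by positivity)]
    gcongr
    linarith
  have e0 := near x (by simpa using (half_pos hK.pos).le)
  have e1 := near _ hsx
  -- Both sides are affine in the centre. Agreement at `x` and at the nearby point `x + s (x' - x)`
  -- therefore gives agreement on the whole line, in particular at `x'`.
  have l1 : ∫ z in K, (d * p z + fderiv ℝ p z (z - (x + s • (x' - x)))) =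
      (∫ z in K, (d * p z + fderiv ℝ p z (z - x))) - s * ∫ z in K, fderiv ℝ p z (x' - x) := by
    rw [← integral_const_mul, ← integral_sub (hint (by fun_prop)) (hint (by fun_prop))]
    refine integral_congr_ae (.of_forall fun z => ?_)
    simp only [map_sub, map_add, map_smul, smul_eq_mul]; ring
  have l2 : ∫ z in K, (d * p z + fderiv ℝ p z (z - x')) =
      (∫ z in K, (d * p z + fderiv ℝ p z (z - x))) - ∫ z in K, fderiv ℝ p z (x' - x) := by
    rw [← integral_sub (hint (by fun_prop)) (hint (by fun_prop))]
    refine integral_congr_ae (.of_forall fun z => ?_)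
    simp only [map_sub]; ring
  have r1 : ∑ i, ⟪n i, o i - (x + s • (x' - x))⟫ * ∫ y in F i, p y ∂μHE[d - 1] =
      ∑ i, ⟪n i, o i - x⟫ * ∫ y in F i, p y ∂μHE[d - 1] -
        s * ∑ i, ⟪n i, x' - x⟫ * ∫ y in F i, p y ∂μHE[d - 1] := by
    rw [Finset.mul_sum, ← Finset.sum_sub_distrib]
    refine Finset.sum_congr rfl fun i _ => ?_
    simp only [inner_sub_right, inner_add_right, real_inner_smul_right]; ring
  have r2 : ∑ i, ⟪n i, o i - x'⟫ * ∫ y in F i, p y ∂μHE[d - 1] =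
      ∑ i, ⟪n i, o i - x⟫ * ∫ y in F i, p y ∂μHE[d - 1] -
        ∑ i, ⟪n i, x' - x⟫ * ∫ y in F i, p y ∂μHE[d - 1] := by
    rw [← Finset.sum_sub_distrib]
    refine Finset.sum_congr rfl fun i _ => ?_
    simp only [inner_sub_right]; ring
  have h3 : s * ∫ z in K, fderiv ℝ p z (x' - x) =
      s * ∑ i, ⟪n i, x' - x⟫ * ∫ y in F i, p y ∂μHE[d - 1] := by
    linarith
  rw [l2, r2, e0, mul_left_cancel₀ hs.ne' h3]

end Divergence

end StarBody


/-! ### Geometry of the mesh -/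

section FlatFaces

variable {d : ℕ}

theorem IsPolytope.isCompact {S : Set (Space d)} (h : IsPolytope S) : IsCompact S := by
  obtain ⟨P, rfl⟩ := h
  exact P.finite_toSet.isCompact_biUnion fun V _ => V.finite_toSet.isCompact_convexHull (𝕜 := ℝ)

theorem vectorSpan_eq_orthogonal {F : Set (Space d)}
    (hF : Module.finrank ℝ (vectorSpan ℝ F) + 1 = d) {n : Space d} (hn : ‖n‖ = 1)
    (h : ∀ y ∈ F, ∀ z ∈ F, ⟪n, z - y⟫ = 0) : vectorSpan ℝ F = (ℝ ∙ n)ᗮ := by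
  have hn0 : n ≠ 0 := fun h => by simp [h] at hn
  refine Submodule.eq_of_le_of_finrank_eq ?_ ?_
  · rw [vectorSpan_def, Submodule.span_le]
    rintro _ ⟨z, hz, y, hy, rfl⟩
    exact Submodule.mem_orthogonal_singleton_iff_inner_right.2 (h y hy z hz)
  · have h1 := (ℝ ∙ n).finrank_add_finrank_orthogonal
    rw [finrank_span_singleton hn0, finrank_euclideanSpace, Fintype.card_fin] at h1
    omega

theorem exists_unit_normal {F : Set (Space d)}
    (hF : Module.finrank ℝ (vectorSpan ℝ F) + 1 = d) :
    ∃ n : Space d, ‖n‖ = 1 ∧ ∀ y ∈ F, ∀ z ∈ F, ⟪n, z - y⟫ = 0 := by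
  have h1 := (vectorSpan ℝ F).finrank_add_finrank_orthogonal
  rw [finrank_euclideanSpace, Fintype.card_fin] at h1
  have h2 : 0 < Module.finrank ℝ (vectorSpan ℝ F)ᗮ := by omega
  obtain ⟨⟨v, hv⟩, hv0⟩ := (Module.finrank_pos_iff_exists_ne_zero (R := ℝ)).1 h2
  have hv0' : v ≠ 0 := fun h => hv0 (Subtype.ext h)
  refine ⟨‖v‖⁻¹ • v, by simp [norm_smul, hv0'], fun y hy z hz => ?_⟩
  have := Submodule.inner_right_of_mem_orthogonal (vsub_mem_vectorSpan ℝ hz hy) hv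
  rw [vsub_eq_sub] at this
  rw [real_inner_smul_left, real_inner_comm, this, mul_zero]

/-- By dimension count the direction of the affine hull of `F` is all of `n^⊥`, so the kernel ball
in the affine hull is the full ball parametrized by `L`. -/
theorem IsStarShapedWrtBall.isFlatFace {F : Set (Space d)} {o : Space d} {r : ℝ}
    (hs : IsStarShapedWrtBall F o r) (hp : IsPolytope F)
    (hF : Module.finrank ℝ (vectorSpan ℝ F) + 1 = d) {n : Space d} (hn : ‖n‖ = 1)
    (h : ∀ y ∈ F, ∀ z ∈ F, ⟪n, z - y⟫ = 0) :
    ∃ L : Space (d - 1) →ₗᵢ[ℝ] Space d, IsFlatFace F n L o r := by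
  obtain ⟨L, hL⟩ := exists_isFrame hn
  refine ⟨L, hL, hp.isCompact, hs.1, fun z hz => h o hs.2.1 z hz, fun w hw => ?_⟩
  refine (hs.2.2 _ ?_ (by simpa [dist_eq_norm] using hw)).mem ⟨o, hs.2.1⟩
  have h1 : L w ∈ vectorSpan ℝ F := by
    rw [vectorSpan_eq_orthogonal hF hn h]
    exact Submodule.mem_orthogonal_singleton_iff_inner_right.2 (hL.inner_eq_zero w)
  have := AffineSubspace.vadd_mem_of_mem_direction (s := affineSpan ℝ F)
    (by rwa [direction_affineSpan]) (subset_affineSpan ℝ F hs.2.1)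
  rwa [vadd_eq_add, add_comm] at this

namespace IsFlatFace

variable {F : Set (Space d)} {n : Space d} {L : Space (d - 1) →ₗᵢ[ℝ] Space d} {o : Space d} {r : ℝ}

theorem mem_of_dist_le (h : IsFlatFace F n L o r) {y : Space d} (hy : ⟪n, y - o⟫ = 0)
    (hr : dist y o ≤ r) : y ∈ F := by
  obtain ⟨w, hw⟩ := h.exists_eq _ hy
  have := h.mem_ball w (by rw [← L.norm_map, hw, ← dist_eq_norm]; exact hr)
  rwa [hw, add_sub_cancel] at this

theorem mem_cone (h : IsFlatFace F n L o r) {x z : Space d} {s : ℝ} (hs : 0 < s) (hs1 : s ≤ 1)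
    (hz : ⟪n, z - x⟫ = s * ⟪n, o - x⟫) (hr : dist (x + s⁻¹ • (z - x)) o ≤ r) :
    z ∈ convexJoin ℝ {x} F := by
  simp only [mem_convexJoin, Set.mem_singleton_iff, exists_eq_left, segment_eq_image',
    Set.mem_image]
  refine ⟨x + s⁻¹ • (z - x), h.mem_of_dist_le ?_ hr, s, ⟨hs.le, hs1⟩, ?_⟩
  · have : x + s⁻¹ • (z - x) - o = s⁻¹ • (z - x) - (o - x) := by abel
    rw [this, inner_sub_right, real_inner_smul_right, hz, inv_mul_cancel_left₀ hs.ne', sub_self]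
  · rw [add_sub_cancel_left, smul_inv_smul₀ hs.ne']; abel

/-- A cone over a flat face contains a ball of comparable size. -/
theorem closedBall_subset_cone (h : IsFlatFace F n L o r) {x : Space d} {D δ : ℝ}
    (hH : 0 < ⟪n, o - x⟫) (hD : dist o x ≤ D) (hδ : δ ≤ ⟪n, o - x⟫ / 4)
    (hr : 4 * δ * D / ⟪n, o - x⟫ + 4 * δ ≤ r) :
    Metric.closedBall (x + (1 / 2 : ℝ) • (o - x)) δ ⊆ convexJoin ℝ {x} F := by
  intro z hz
  set H := ⟪n, o - x⟫ with hHdef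
  set v := z - (x + (1 / 2 : ℝ) • (o - x)) with hv
  have hvn : ‖v‖ ≤ δ := by rwa [Metric.mem_closedBall, dist_eq_norm] at hz
  have hδ0 : 0 ≤ δ := (norm_nonneg v).trans hvn
  have hzx : z - x = (1 / 2 : ℝ) • (o - x) + v := by rw [hv]; abel
  have hin : |⟪n, v⟫| ≤ δ := by
    have := abs_real_inner_le_norm n v
    rw [h.norm_eq_one, one_mul] at this
    exact this.trans hvn
  -- `s` is the relative height of `z`. It lies in `[1/4, 1]`, so projecting `z` from the apex onto
  -- the base displaces it from `o` by at most `4δD/H + 4δ`.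
  set s := 1 / 2 + ⟪n, v⟫ / H with hs
  have hq : |⟪n, v⟫ / H| ≤ δ / H := by rw [abs_div, abs_of_pos hH]; gcongr
  have hq4 : δ / H ≤ 1 / 4 := by rw [div_le_iff₀ hH]; linarith
  have hs4 : 1 / 4 ≤ s := by linarith [(abs_le.1 hq).1]
  have hs1 : s ≤ 1 := by linarith [(abs_le.1 hq).2]
  have hs0 : 0 < s := by linarith
  have hsi : s⁻¹ ≤ 4 := by rw [inv_le_comm₀ hs0 (by norm_num)]; linarith
  refine h.mem_cone hs0 hs1 ?_ ?_
  · rw [hzx, inner_add_right, real_inner_smul_right, ← hHdef, hs]; field_simp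
  · have h1 : x + s⁻¹ • (z - x) - o = (s⁻¹ * (1 / 2 - s)) • (o - x) + s⁻¹ • v := by
      rw [hzx, smul_add, smul_smul, mul_sub, sub_smul, inv_mul_cancel₀ hs0.ne', one_smul]; abel
    rw [dist_eq_norm, h1]
    refine (norm_add_le _ _).trans (le_trans ?_ hr)
    rw [norm_smul, norm_smul, norm_mul, Real.norm_eq_abs, Real.norm_eq_abs,
      abs_of_pos (inv_pos.2 hs0), ← dist_eq_norm]
    have h2 : |1 / 2 - s| ≤ δ / H := by
      rw [hs, sub_add_cancel_left, abs_neg]; exact hq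
    have hD0 : 0 ≤ D := dist_nonneg.trans hD
    calc s⁻¹ * |1 / 2 - s| * dist o x + s⁻¹ * ‖v‖ ≤ 4 * (δ / H) * D + 4 * δ := by gcongr
      _ = _ := by ring

/-- The cone fills one side of the hyperplane near `o`. This local picture decides the orientation
of the two normals on a shared face. -/
theorem eventually_mem_cone (h : IsFlatFace F n L o r) {x : Space d} (hH : 0 < ⟪n, o - x⟫) :
    ∀ᶠ z in nhds o, ⟪n, z - o⟫ ≤ 0 → z ∈ convexJoin ℝ {x} F := by
  have h1 : ContinuousAt (fun z => ⟪n, z - x⟫) o := by fun_prop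
  have h2 : ContinuousAt (fun z => x + (⟪n, z - x⟫ / ⟪n, o - x⟫)⁻¹ • (z - x)) o := by
    have h3 : ContinuousAt (fun z => ⟪n, z - x⟫ / ⟪n, o - x⟫) o := by fun_prop
    have h4 : ContinuousAt (fun z => z - x) o := by fun_prop
    exact continuousAt_const.add ((h3.inv₀ (by rw [div_self hH.ne']; exact one_ne_zero)).smul h4)
  have e1 := h1.eventually (lt_mem_nhds hH)
  have e2 := h2.eventually (Metric.closedBall_mem_nhds _ h.pos)
  filter_upwards [e1, e2] with z hz1 hz2 hz
  have hle : ⟪n, z - x⟫ ≤ ⟪n, o - x⟫ := by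
    have : z - x = (z - o) + (o - x) := by abel
    rw [this, inner_add_right]; linarith
  refine h.mem_cone (div_pos hz1 hH) ((div_le_one hH).2 hle) (by field_simp) ?_
  rw [div_self hH.ne'] at hz2
  simpa using hz2

theorem neg (h : IsFlatFace F n L o r) : IsFlatFace F (-n) L o r where
  norm_eq_one := by rw [norm_neg, h.norm_eq_one]
  inner_eq_zero w := by rw [inner_neg_left, h.inner_eq_zero, neg_zero]
  exists_eq v hv := h.exists_eq v (by simpa using hv)
  isCompact := h.isCompact
  pos := h.pos
  inner_sub z hz := by rw [inner_neg_left, h.inner_sub z hz, neg_zero]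
  mem_ball := h.mem_ball

/-- The part of `n'` orthogonal to `n` is tangent to `F`. Since `F` contains a ball of the
hyperplane, `n'` is orthogonal to that part, which is therefore zero. -/
theorem normal_eq_or_eq_neg {n' : Space d} {L' : Space (d - 1) →ₗᵢ[ℝ] Space d}
    (h : IsFlatFace F n L o r) (h' : IsFlatFace F n' L' o r) : n' = n ∨ n' = -n := by
  set v := n' - ⟪n, n'⟫ • n with hv
  have h1 : ⟪n, v⟫ = 0 := by
    rw [hv, inner_sub_right, real_inner_smul_right, real_inner_self_eq_norm_sq, h.norm_eq_one]
    ring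
  obtain ⟨w, hw⟩ := h.exists_eq v h1
  have h2 : ⟪n', v⟫ = 0 := by
    have hpos := h.pos
    set s := r / (‖w‖ + 1) with hs
    have hs0 : 0 < s := by positivity
    have hm := h.mem_ball (s • w) (by
      rw [norm_smul, Real.norm_eq_abs, abs_of_pos hs0, hs, div_mul_eq_mul_div,
        div_le_iff₀ (by positivity)]
      gcongr
      linarith)
    have := h'.inner_sub _ hm
    rw [add_sub_cancel_left, map_smul, hw, real_inner_smul_right] at this
    exact (mul_eq_zero.1 this).resolve_left hs0.ne'
  have h3 : v = 0 := by
    have h4 : ⟪v, v⟫ = ⟪n', v⟫ - ⟪n, n'⟫ * ⟪n, v⟫ := by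
      rw [← real_inner_smul_left, ← inner_sub_left]
    rw [h1, h2, mul_zero, sub_zero] at h4
    exact inner_self_eq_zero.1 h4
  have h4 : n' = ⟪n, n'⟫ • n := sub_eq_zero.1 h3
  have h5 : |⟪n, n'⟫| = 1 := by
    have := congrArg norm h4
    rwa [norm_smul, h.norm_eq_one, h'.norm_eq_one, mul_one, Real.norm_eq_abs, eq_comm] at this
  rcases eq_or_eq_neg_of_abs_eq h5 with h6 | h6
  · left; rw [h4, h6, one_smul]
  · right; rw [h4, h6, neg_one_smul]

/-- `F` lies in a hyperplane. This makes element boundaries null, so elements can be replaced by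
their interiors. -/
theorem volume_eq_zero (h : IsFlatFace F n L o r) : volume F = 0 := by
  refine measure_mono_null (t := (AffineSubspace.mk' o (ℝ ∙ n)ᗮ : Set (Space d))) (fun z hz => ?_)
    (Measure.addHaar_affineSubspace _ _ fun htop => ?_)
  · exact AffineSubspace.mem_mk'.2
      (Submodule.mem_orthogonal_singleton_iff_inner_right.2 (h.inner_sub z hz))
  · have h1 : n ∈ (ℝ ∙ n)ᗮ := by
      rw [← AffineSubspace.direction_mk' o (ℝ ∙ n)ᗮ, htop, AffineSubspace.direction_top]
      trivial
    have := Submodule.mem_orthogonal_singleton_iff_inner_right.1 h1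
    rw [real_inner_self_eq_norm_sq, h.norm_eq_one] at this
    norm_num at this

end IsFlatFace

end FlatFaces

/-! ### Elements, faces and subcells of a regular mesh -/

namespace PolytopalMesh

variable {d : ℕ} {Ω : Set (Space d)} {M : PolytopalMesh d Ω} {γ η : ℝ}

theorem IsRegular.exists_isStarBody (hreg : M.IsRegular γ η) (K : M.Cell) :
    ∃ ρ, IsStarBody (K : Set (Space d)) (M.center K) ρ ∧ K.h ≤ γ * ρ := by
  obtain ⟨ρ, ⟨hρ, hx, hs⟩, hle⟩ := hreg.1 K K.2
  refine ⟨ρ, ⟨hρ, (M.isPolytope_cell K K.2).isCompact, hx, fun b hb => hs b ?_ hb⟩, hle⟩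
  have : affineSpan ℝ (K : Set (Space d)) = ⊤ := by
    rw [← AffineSubspace.direction_eq_top_iff_of_nonempty ⟨_, subset_affineSpan ℝ _ hx⟩,
      direction_affineSpan]
    refine Submodule.eq_top_of_finrank_eq ?_
    rw [M.finrank_cell K K.2, finrank_euclideanSpace, Fintype.card_fin]
  rw [this]; trivial

/-- Existence of the outward normal, and the flatness of the face with respect to it. -/
theorem IsRegular.exists_isFlatFace (hreg : M.IsRegular γ η) (F : M.Face) :
    ∃ o r, Metric.diam (F : Set (Space d)) ≤ γ * r ∧
      ∀ t : M.SubCell, t.face = F →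
        (∃ L, IsFlatFace (F : Set (Space d)) t.normal L o r) ∧
          0 < ⟪t.normal, o - M.center t.cell⟫ := by
  obtain ⟨o, r, hs, hle⟩ := hreg.2.1 F F.2
  refine ⟨o, r, hle, ?_⟩
  rintro t rfl
  obtain ⟨n, hn, hn0⟩ := exists_unit_normal (M.finrank_face t.face t.face.2)
  obtain ⟨L, hL⟩ := hs.isFlatFace (M.isPolytope_face _ t.face.2) (M.finrank_face _ t.face.2) hn hn0
  obtain ⟨ρ, hK, -⟩ := hreg.exists_isStarBody t.cell
  have habs := hL.le_abs_height hK t.2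
  -- The height of the face over `x_K` is nonzero by `le_abs_height`, so exactly one choice of sign
  -- points outward; existence makes the `epsilon` in `SubCell.normal` meaningful.
  have hex : ∃ n, IsOutwardNormal (M.center t.cell) (t.face : Set (Space d)) n := by
    rcases lt_or_ge 0 ⟪n, o - M.center t.cell⟫ with h | h
    · exact ⟨n, hn, fun y hy => ⟨by rw [hL.inner_eq _ hy]; exact h, hn0 y hy⟩⟩
    · refine ⟨-n, by rw [norm_neg, hn], fun y hy => ⟨?_, fun z hz => ?_⟩⟩
      · rw [hL.neg.inner_eq _ hy, inner_neg_left]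
        have := hK.pos
        rw [abs_of_nonpos h] at habs
        linarith
      · rw [inner_neg_left, hn0 y hy z hz, neg_zero]
  have hsp : IsOutwardNormal (M.center t.cell) (t.face : Set (Space d)) t.normal :=
    Classical.epsilon_spec hex
  exact ⟨hs.isFlatFace (M.isPolytope_face _ t.face.2) (M.finrank_face _ t.face.2) hsp.1
    fun y hy => (hsp.2 y hy).2, (hsp.2 o hs.2.1).1⟩

/-- The geometric data of a subcell: `h_K ≤ γ ρ`, `h_F ≤ γ r`, and the height is at least `ρ`. -/
theorem IsRegular.exists_subCell_data (hreg : M.IsRegular γ η) (t : M.SubCell) :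
    ∃ L o r ρ, IsStarBody (t.cell : Set (Space d)) (M.center t.cell) ρ ∧ t.cell.h ≤ γ * ρ ∧
      IsFlatFace (t.face : Set (Space d)) t.normal L o r ∧
      Metric.diam (t.face : Set (Space d)) ≤ γ * r ∧ ρ ≤ ⟪t.normal, o - M.center t.cell⟫ := by
  obtain ⟨o, r, hle, h⟩ := hreg.exists_isFlatFace t.face
  obtain ⟨⟨L, hL⟩, hH⟩ := h t rfl
  obtain ⟨ρ, hK, hKρ⟩ := hreg.exists_isStarBody t.cell
  refine ⟨L, o, r, ρ, hK, hKρ, hL, hle, ?_⟩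
  have := hL.le_abs_height hK t.2
  rwa [abs_of_pos hH] at this

theorem SubCell.face_subset_frontier (t : M.SubCell) :
    (t.face : Set (Space d)) ⊆ frontier (t.cell : Set (Space d)) := t.2

theorem SubCell.isCompact_face (t : M.SubCell) : IsCompact (t.face : Set (Space d)) :=
  (M.isPolytope_face _ t.face.2).isCompact

theorem Cell.isCompact (K : M.Cell) : IsCompact (K : Set (Space d)) :=
  (M.isPolytope_cell _ K.2).isCompact

theorem SubCell.isCompact_toSet (t : M.SubCell) : IsCompact t.toSet :=
  isCompact_cone _ t.isCompact_face

theorem SubCell.face_subset_cell (t : M.SubCell) :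
    (t.face : Set (Space d)) ⊆ (t.cell : Set (Space d)) :=
  t.face_subset_frontier.trans t.cell.isCompact.isClosed.frontier_subset

theorem IsRegular.toSet_subset (hreg : M.IsRegular γ η) (t : M.SubCell) :
    t.toSet ⊆ (t.cell : Set (Space d)) := by
  obtain ⟨ρ, hK, -⟩ := hreg.exists_isStarBody t.cell
  intro z hz
  simp only [SubCell.toSet, mem_convexJoin, Set.mem_singleton_iff, exists_eq_left] at hz
  obtain ⟨y, hy, hzy⟩ := hz
  exact hK.segment_subset (t.face_subset_cell hy) hzy

theorem SubCell.ext {t t' : M.SubCell} (h1 : t.cell = t'.cell) (h2 : t.face = t'.face) : t = t' :=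
  Subtype.ext (Prod.ext h1 h2)

/-- With equal normals, both cones would fill the same side of the face near its centre, and the two
elements would have overlapping interiors. -/
theorem IsRegular.normal_add_normal (hreg : M.IsRegular γ η) {t t' : M.SubCell} (hne : t ≠ t')
    (hf : t.face = t'.face) : t.normal + t'.normal = 0 := by
  obtain ⟨o, r, -, h⟩ := hreg.exists_isFlatFace t.face
  obtain ⟨⟨L, hL⟩, hH⟩ := h t rfl
  obtain ⟨⟨L', hL'⟩, hH'⟩ := h t' hf.symm
  rcases hL.normal_eq_or_eq_neg hL' with he | he
  · exfalso
    have hcell : t.cell ≠ t'.cell := fun hc => hne (SubCell.ext hc hf)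
    have e1 := hL.eventually_mem_cone hH
    have e2 := hL'.eventually_mem_cone hH'
    rw [he] at e2
    obtain ⟨U, hU, hUo, hoU⟩ := eventually_nhds_iff.1 (e1.and e2)
    have hO : IsOpen (U ∩ {z | ⟪t.normal, z - o⟫ < 0}) :=
      hUo.inter (isOpen_lt (by fun_prop) continuous_const)
    have hsub1 : U ∩ {z | ⟪t.normal, z - o⟫ < 0} ⊆ interior (t.cell : Set (Space d)) :=
      interior_maximal (fun z hz => hreg.toSet_subset t ((hU z hz.1).1 (le_of_lt hz.2))) hO
    have hsub2 : U ∩ {z | ⟪t.normal, z - o⟫ < 0} ⊆ interior (t'.cell : Set (Space d)) :=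
      interior_maximal (fun z hz => hreg.toSet_subset t' (by
        have := (hU z hz.1).2 (le_of_lt hz.2)
        rw [hf] at this
        exact this)) hO
    have hdis := M.disjoint_cells t.cell t.cell.2 t'.cell t'.cell.2
      fun h => hcell (Subtype.ext h)
    have hc : Filter.Tendsto (fun s : ℝ => o - s • t.normal) (nhdsWithin 0 (Set.Ioi 0))
        (nhds o) := by
      have : Continuous fun s : ℝ => o - s • t.normal := by fun_prop
      simpa using (this.tendsto 0).mono_left nhdsWithin_le_nhds
    obtain ⟨s, hs, hs0⟩ := ((hc.eventually (hUo.mem_nhds hoU)).and self_mem_nhdsWithin).exists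
    have hz : o - s • t.normal ∈ U ∩ {z | ⟪t.normal, z - o⟫ < 0} := by
      refine ⟨hs, ?_⟩
      simp only [Set.mem_ofPred_eq, sub_sub_cancel_left, inner_neg_right, real_inner_smul_right,
        real_inner_self_eq_norm_sq, hL.norm_eq_one]
      have : 0 < s := hs0
      linarith
    exact Set.disjoint_left.1 hdis (hsub1 hz) (hsub2 hz)
  · rw [he]; abel

/-- Turns the incidence axioms of the mesh, stated for sets, into statements about the index type of
subcells. -/
theorem card_filter_face [DecidableEq M.Face] (F : M.Face) :
    (Finset.univ.filter fun t : M.SubCell => t.face = F).card =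
      {K : Set (Space d) | K ∈ M.cells ∧ (F : Set (Space d)) ⊆ frontier K}.ncard := by
  rw [← Set.ncard_coe_finset]
  refine Set.ncard_congr (fun t _ => (t.cell : Set (Space d))) ?_ ?_ ?_
  · intro t ht
    simp only [Finset.coe_filter, Finset.mem_univ, true_and, Set.mem_ofPred_eq] at ht
    exact ⟨t.cell.2, ht ▸ t.2⟩
  · intro t t' ht ht' he
    simp only [Finset.coe_filter, Finset.mem_univ, true_and, Set.mem_ofPred_eq] at ht ht'
    exact SubCell.ext (Subtype.ext he) (ht.trans ht'.symm)
  · rintro K ⟨hK, hF⟩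
    exact ⟨⟨(⟨K, hK⟩, F), hF⟩, by
      rw [Finset.mem_coe, Finset.mem_filter]; exact ⟨Finset.mem_univ _, rfl⟩, rfl⟩

theorem filter_face_of_isBoundary [DecidableEq M.Face] {F : M.Face} (hF : F.IsBoundary)
    {t : M.SubCell} (ht : t.face = F) :
    (Finset.univ.filter fun t : M.SubCell => t.face = F) = {t} := by
  have h := (card_filter_face F).trans (M.boundary_face F F.2 hF)
  obtain ⟨a, ha⟩ := Finset.card_eq_one.1 h
  have : t ∈ (Finset.univ.filter fun t : M.SubCell => t.face = F) := by simp [ht]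
  rw [ha, Finset.mem_singleton] at this
  rw [ha, this]

theorem exists_filter_face_of_not_isBoundary [DecidableEq M.Face] [DecidableEq M.SubCell]
    {F : M.Face} (hF : ¬ F.IsBoundary) {t : M.SubCell} (ht : t.face = F) :
    ∃ t' : M.SubCell, t'.face = F ∧ t ≠ t' ∧
      (Finset.univ.filter fun t : M.SubCell => t.face = F) = {t, t'} := by
  have h := (card_filter_face F).trans (M.interior_face F F.2 hF)
  obtain ⟨a, b, hab, he⟩ := Finset.card_eq_two.1 h
  have hm : ∀ s : M.SubCell, s.face = F ↔ s = a ∨ s = b := fun s => by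
    have := Finset.ext_iff.1 he s
    simpa using this
  rcases (hm t).1 ht with rfl | rfl
  · exact ⟨b, (hm b).2 (Or.inr rfl), hab, he⟩
  · exact ⟨a, (hm a).2 (Or.inl rfl), hab.symm, by rw [he, Finset.pair_comm]⟩

theorem exists_subCell (F : M.Face) : ∃ t : M.SubCell, t.face = F := by
  classical
  have h := card_filter_face F
  have : 0 < (Finset.univ.filter fun t : M.SubCell => t.face = F).card := by
    by_cases hF : F.IsBoundary
    · rw [h, M.boundary_face F F.2 hF]; norm_num
    · rw [h, M.interior_face F F.2 hF]; norm_num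
  obtain ⟨t, ht⟩ := Finset.card_pos.1 this
  exact ⟨t, by simpa using ht⟩

theorem frontier_cell_eq_iUnion (K : M.Cell) :
    frontier (K : Set (Space d)) = ⋃ t : {t : M.SubCell // t.cell = K}, (t.1.face : Set (Space d)) := by
  rw [M.frontier_cell K K.2]
  ext z
  simp only [Set.mem_iUnion]
  constructor
  · rintro ⟨F, hF, hFK, hz⟩
    exact ⟨⟨⟨(K, ⟨F, hF⟩), hFK⟩, rfl⟩, hz⟩
  · rintro ⟨⟨t, rfl⟩, hz⟩
    exact ⟨t.face, t.face.2, t.2, hz⟩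

theorem null_inter_face {K : M.Cell} (t t' : {t : M.SubCell // t.cell = K}) (h : t ≠ t') :
    μHE[d - 1] ((t.1.face : Set (Space d)) ∩ (t'.1.face : Set (Space d))) = 0 :=
  M.null_inter_faces _ t.1.face.2 _ t'.1.face.2 fun he =>
    h (Subtype.ext (SubCell.ext (t.2.trans t'.2.symm) (Subtype.ext he)))

theorem sum_subCell_eq_sum_cell [DecidableEq M.Cell] (g : M.SubCell → ℝ) :
    ∑ t, g t = ∑ K : M.Cell, ∑ t : {t : M.SubCell // t.cell = K}, g t.1 := by
  rw [← Finset.sum_fiberwise_of_maps_to (s := Finset.univ) (t := Finset.univ)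
    (g := fun t : M.SubCell => t.cell) (fun _ _ => Finset.mem_univ _)]
  refine Finset.sum_congr rfl fun K _ => ?_
  exact Finset.sum_subtype _ (by simp) _

theorem sum_subCell_eq_sum_face [DecidableEq M.Face] (g : M.SubCell → ℝ) :
    ∑ t, g t = ∑ F : M.Face, ∑ t : M.SubCell with t.face = F, g t :=
  (Finset.sum_fiberwise_of_maps_to (fun _ _ => Finset.mem_univ _) _).symm

theorem IsRegular.setIntegral_cell (hreg : M.IsRegular γ η) (hd : 1 ≤ d) (K : M.Cell)
    {g : Space d → ℝ} (hg : IntegrableOn g (K : Set (Space d))) :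
    ∫ z in (K : Set (Space d)), g z =
      ∑ t : {t : M.SubCell // t.cell = K}, ∫ z in t.1.toSet, g z := by
  obtain ⟨ρ, hK, -⟩ := hreg.exists_isStarBody K
  choose L o r ρ' hK' hρ' hface hr hH using
    fun t : {t : M.SubCell // t.cell = K} => hreg.exists_subCell_data t.1
  rw [hK.setIntegral_eq_sum_cone hd hface (frontier_cell_eq_iUnion K) null_inter_face
    (fun t => by
      have := (hK' t).pos.trans_le (hH t)
      rwa [t.2] at this) hg]
  refine Finset.sum_congr rfl fun t _ => ?_
  rw [SubCell.toSet, t.2]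

theorem IsRegular.sum_setIntegral_cell (hreg : M.IsRegular γ η) (hd : 1 ≤ d)
    {g : M.Cell → Space d → ℝ} (hg : ∀ K, Continuous (g K)) :
    ∑ K : M.Cell, ∫ z in (K : Set (Space d)), g K z =
      ∑ t : M.SubCell, ∫ z in t.toSet, g t.cell z := by
  classical
  rw [sum_subCell_eq_sum_cell]
  refine Finset.sum_congr rfl fun K _ => ?_
  rw [hreg.setIntegral_cell hd K ((hg K).continuousOn.integrableOn_compact K.isCompact)]
  exact Finset.sum_congr rfl fun t _ => by rw [t.2]

/-- The divergence theorem for `p z` on an element. -/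
theorem IsRegular.setIntegral_div (hreg : M.IsRegular γ η) (hd : 1 ≤ d) (K : M.Cell)
    {p : Space d → ℝ} (hp : ContDiff ℝ 1 p) :
    ∫ z in (K : Set (Space d)), (d * p z + fderiv ℝ p z z) =
      ∑ t : {t : M.SubCell // t.cell = K},
        ∫ y in (t.1.face : Set (Space d)), p y * ⟪t.1.normal, y⟫ ∂μHE[d - 1] := by
  obtain ⟨ρ, hK, -⟩ := hreg.exists_isStarBody K
  choose L o r ρ' hK' hρ' hface hr hH using
    fun t : {t : M.SubCell // t.cell = K} => hreg.exists_subCell_data t.1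
  have h := hK.setIntegral_div hd hface (frontier_cell_eq_iUnion K) null_inter_face
    (fun t => by
      have := (hK' t).pos.trans_le (hH t)
      rwa [t.2] at this) hp 0
  simp only [sub_zero] at h
  rw [h]
  refine Finset.sum_congr rfl fun t _ => ?_
  rw [← integral_const_mul]
  refine setIntegral_congr_fun (hface t).isCompact.measurableSet fun y hy => ?_
  have := (hface t).inner_eq 0 hy
  simp only [sub_zero] at this
  rw [this, mul_comm]

theorem IsRegular.volume_frontier_cell (hreg : M.IsRegular γ η) (K : M.Cell) :
    volume (frontier (K : Set (Space d))) = 0 := by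
  rw [frontier_cell_eq_iUnion]
  refine measure_iUnion_null fun t => ?_
  obtain ⟨L, o, r, ρ, -, -, h, -⟩ := hreg.exists_subCell_data t.1
  exact h.volume_eq_zero

theorem interior_cell_subset (K : M.Cell) : interior (K : Set (Space d)) ⊆ Ω := by
  refine subset_of_subset_of_eq ?_ M.interior_iUnion_cells
  exact interior_mono fun z hz => Set.mem_biUnion K.2 hz

theorem isBounded_domain (M : PolytopalMesh d Ω) : Bornology.IsBounded Ω := by
  rw [← M.interior_iUnion_cells]
  refine Bornology.IsBounded.subset ?_ interior_subset
  exact (M.cells.finite_toSet.isCompact_biUnion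
    fun K hK => (M.isPolytope_cell K hK).isCompact).isBounded

theorem IsRegular.cell_ae_eq (hreg : M.IsRegular γ η) (K : M.Cell) :
    (K : Set (Space d)) =ᵐ[volume] interior (K : Set (Space d)) :=
  (interior_ae_eq_of_null_frontier (hreg.volume_frontier_cell K)).symm

theorem IsRegular.cell_subset_closure (hreg : M.IsRegular γ η) (K : M.Cell) :
    (K : Set (Space d)) ⊆ closure Ω := by
  obtain ⟨ρ, hK, -⟩ := hreg.exists_isStarBody K
  exact hK.subset_closure_interior.trans (closure_mono (interior_cell_subset K))

/-- The closed element need not lie in `Ω`, but its interior does, and its boundary is null. This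
passes square integrability of the load from `Ω` to the elements. -/
theorem IsRegular.restrict_cell_le (hreg : M.IsRegular γ η) (K : M.Cell) :
    volume.restrict (K : Set (Space d)) ≤ volume.restrict Ω := by
  rw [Measure.restrict_congr_set (hreg.cell_ae_eq K)]
  exact Measure.restrict_mono_set _ (interior_cell_subset K)

theorem IsRegular.sum_setIntegral_cell_le (hreg : M.IsRegular γ η) {g : Space d → ℝ}
    (hg0 : ∀ z, 0 ≤ g z) (hg : IntegrableOn g Ω) :
    ∑ K : M.Cell, ∫ z in (K : Set (Space d)), g z ≤ ∫ z in Ω, g z := by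
  have h1 : ∀ K : M.Cell, ∫ z in (K : Set (Space d)), g z =
      ∫ z in interior (K : Set (Space d)), g z := fun K =>
    setIntegral_congr_set (hreg.cell_ae_eq K)
  simp only [h1]
  rw [← integral_iUnion_fintype (s := fun K : M.Cell => interior (K : Set (Space d)))
    (fun K => isOpen_interior.measurableSet)
    (fun K K' h => M.disjoint_cells K K.2 K' K'.2 fun he => h (Subtype.ext he))
    (fun K => hg.mono_set (interior_cell_subset K))]
  exact setIntegral_mono_set hg (.of_forall hg0)
    (Set.iUnion_subset fun K => interior_cell_subset K).eventuallyLE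

end PolytopalMesh


/-! ### Local estimates on a subcell -/

section Monotone

variable {d : ℕ} {Ω : Set (Space d)} {M : PolytopalMesh d Ω}

theorem PolytopalMesh.IsRegular.mono {γ η γ' η' : ℝ} (h : M.IsRegular γ η) (hγ : γ ≤ γ')
    (hη : η ≤ η') : M.IsRegular γ' η' := by
  refine ⟨fun K hK => ?_, fun F hF => ?_, fun K hK F hF hFK => ?_⟩
  · obtain ⟨ρ, hs, hle⟩ := h.1 K hK
    exact ⟨ρ, hs, hle.trans (mul_le_mul_of_nonneg_right hγ hs.1.le)⟩
  · obtain ⟨y, ρ, hs, hle⟩ := h.2.1 F hF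
    exact ⟨y, ρ, hs, hle.trans (mul_le_mul_of_nonneg_right hγ hs.1.le)⟩
  · exact (h.2.2 K hK F hF hFK).trans (mul_le_mul_of_nonneg_right hη Metric.diam_nonneg)

end Monotone

/-! ### Measures of faces and elements -/

section FaceIntegrals

/-- The volume of the unit ball of `ℝ^d`. -/
noncomputable def unitBallVolume (d : ℕ) : ℝ := volume.real (Metric.ball (0 : Space d) 1)

theorem unitBallVolume_pos (d : ℕ) : 0 < unitBallVolume d :=
  ENNReal.toReal_pos (Metric.measure_ball_pos _ _ one_pos).ne' measure_ball_lt_top.ne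

variable {d : ℕ} {F : Set (Space d)} {n : Space d} {L : Space (d - 1) →ₗᵢ[ℝ] Space d} {o : Space d}
  {r : ℝ}

theorem IsFlatFace.measure_lt_top (h : IsFlatFace F n L o r) : μHE[d - 1] F < ⊤ := by
  rw [euclideanHausdorffMeasure_eq_volume_preimage L o h.subset_range]
  exact ((h.toIsFrame.isometry o).isClosedEmbedding.isCompact_preimage h.isCompact).measure_lt_top

theorem IsFlatFace.integrableOn (h : IsFlatFace F n L o r) {g : Space d → ℝ} (hg : Continuous g) :
    IntegrableOn g F μHE[d - 1] := by
  obtain ⟨C, hC⟩ := h.isCompact.exists_bound_of_continuousOn hg.continuousOn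
  refine Measure.integrableOn_of_bounded (M := C) h.measure_lt_top.ne
    hg.measurable.aestronglyMeasurable ?_
  exact (ae_restrict_iff' h.isCompact.measurableSet).2 (.of_forall hC)

theorem IsFlatFace.measureReal_le (h : IsFlatFace F n L o r) {D : ℝ} (hD0 : 0 ≤ D)
    (hD : ∀ y ∈ F, dist y o ≤ D) :
    (μHE[d - 1]).real F ≤ unitBallVolume (d - 1) * D ^ (d - 1) := by
  rw [measureReal_def, euclideanHausdorffMeasure_eq_volume_preimage L o h.subset_range]
  have hsub : (fun w => o + L w) ⁻¹' F ⊆ Metric.closedBall 0 D := fun w hw => by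
    have := hD _ hw
    simpa [dist_eq_norm] using this
  calc _ ≤ volume.real (Metric.closedBall (0 : Space (d - 1)) D) :=
        measureReal_mono hsub (isCompact_closedBall _ _).measure_lt_top.ne
    _ = _ := by
        rw [measureReal_def, Measure.addHaar_closedBall _ _ hD0, ENNReal.toReal_mul,
          ENNReal.toReal_ofReal (by positivity), unitBallVolume,
          measureReal_def]
        simp [mul_comm]

theorem volumeReal_le_of_dist_le {S : Set (Space d)} {z : Space d} {D : ℝ} (hD0 : 0 ≤ D)
    (hD : ∀ y ∈ S, dist y z ≤ D) :
    volume.real S ≤ unitBallVolume d * D ^ d := by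
  calc volume.real S ≤ volume.real (Metric.closedBall z D) :=
        measureReal_mono hD (isCompact_closedBall _ _).measure_lt_top.ne
    _ = _ := by
        rw [measureReal_def, Measure.addHaar_closedBall _ _ hD0, ENNReal.toReal_mul,
          ENNReal.toReal_ofReal (by positivity), unitBallVolume,
          measureReal_def]
        simp [mul_comm]

theorem setIntegral_le_of_forall_le {X : Type*} [MeasurableSpace X] {μ : Measure X} {S : Set X}
    {g : X → ℝ} {B V : ℝ} (hfin : μ S < ⊤) (h0 : ∀ y ∈ S, 0 ≤ g y) (hB : ∀ y ∈ S, g y ≤ B)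
    (hB0 : 0 ≤ B) (hV : μ.real S ≤ V) : ∫ y in S, g y ∂μ ≤ B * V := by
  have h1 := norm_setIntegral_le_of_norm_le_const (f := g) hfin (C := B) fun y hy => by
    rw [Real.norm_eq_abs, abs_of_nonneg (h0 y hy)]; exact hB y hy
  exact (le_abs_self _).trans (h1.trans (mul_le_mul_of_nonneg_left hV hB0))

end FaceIntegrals

/-- The ratio of the radius of a ball contained in a subcell to the diameter of the element. -/
noncomputable def shapeConst (γ η : ℝ) : ℝ := 1 / (4 * (γ + 1) * γ * η)

/-! ### Scaled polynomial estimates on subcells and faces -/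

namespace PolytopalMesh

variable {d : ℕ} {Ω : Set (Space d)} {M : PolytopalMesh d Ω} {γ η : ℝ}

theorem shapeConst_pos (hγ : 1 ≤ γ) (hη : 1 ≤ η) : 0 < shapeConst γ η := by
  unfold shapeConst; positivity

theorem SubCell.dist_le (t : M.SubCell) {y z : Space d} (hy : y ∈ (t.cell : Set (Space d)))
    (hz : z ∈ (t.cell : Set (Space d))) : dist y z ≤ t.cell.h :=
  Metric.dist_le_diam_of_mem t.cell.isCompact.isBounded hy hz

theorem IsRegular.h_pos (hreg : M.IsRegular γ η) (hd : 1 ≤ d) (K : M.Cell) : 0 < K.h := by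
  obtain ⟨ρ, hK, -⟩ := hreg.exists_isStarBody K
  have : Nonempty (Fin d) := ⟨⟨0, hd⟩⟩
  obtain ⟨v, hv⟩ := exists_ne (0 : Space d)
  have hb : M.center K + (ρ / ‖v‖) • v ∈ (K : Set (Space d)) := hK.closedBall_subset (by
    simp [norm_smul, abs_of_pos hK.pos, hv])
  have h1 : dist (M.center K + (ρ / ‖v‖) • v) (M.center K) ≤ K.h :=
    Metric.dist_le_diam_of_mem K.isCompact.isBounded hb hK.mem
  have h2 : dist (M.center K + (ρ / ‖v‖) • v) (M.center K) = ρ := by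
    simp [norm_smul, abs_of_pos hK.pos, hv]
  exact hK.pos.trans_le (h2 ▸ h1)

/-- The height `H` of the cone is at least `h_K / γ` and the face contains a ball of radius at least
`h_K / (γ η)`, so `closedBall_subset_cone` applies at the scale of `h_K`. -/
theorem IsRegular.exists_local_geometry (hreg : M.IsRegular γ η) (hd : 1 ≤ d) (hγ : 1 ≤ γ)
    (hη : 1 ≤ η) (t : M.SubCell) :
    ∃ L o r z, IsFlatFace (t.face : Set (Space d)) t.normal L o r ∧ shapeConst γ η * t.cell.h ≤ r ∧
      Metric.closedBall z (shapeConst γ η * t.cell.h) ⊆ t.toSet ∧ z ∈ t.toSet ∧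
      t.cell.h ≤ γ * ⟪t.normal, o - M.center t.cell⟫ := by
  obtain ⟨L, o, r, ρ, hK, hKρ, hF, hFr, hH⟩ := hreg.exists_subCell_data t
  have hh := hreg.h_pos hd t.cell
  set h := t.cell.h
  set H := ⟪t.normal, o - M.center t.cell⟫
  set c := shapeConst γ η with hc
  have hc0 : 0 < c := shapeConst_pos hγ hη
  have hη' : h ≤ η * Metric.diam (t.face : Set (Space d)) :=
    hreg.2.2 t.cell t.cell.2 t.face t.face.2 t.2
  have hγ0 : 0 < γ := by linarith
  have hη0 : 0 < η := by linarith
  have hhr : h ≤ η * (γ * r) := hη'.trans (by gcongr)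
  have hhH : h ≤ γ * H := hKρ.trans (by gcongr)
  have hH0 : 0 < H := hK.pos.trans_le hH
  -- With `δ = c h`, `D = h` and `h / H ≤ γ`, the condition `4δD/H + 4δ ≤ r` follows from this
  -- inequality; `c` is defined to make it hold.
  have hcr : 4 * (γ + 1) * (c * h) ≤ r := by
    rw [hc, shapeConst]
    rw [show 4 * (γ + 1) * (1 / (4 * (γ + 1) * γ * η) * h) = h / (γ * η) by field_simp,
      div_le_iff₀ (by positivity)]
    linarith
  have hcH : c * h ≤ H / 4 := by
    have h1 : c * (4 * γ) ≤ 1 := by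
      rw [hc, shapeConst, div_mul_eq_mul_div, div_le_one (by positivity), one_mul]
      have : 4 * γ * 1 ≤ 4 * γ * ((γ + 1) * η) := by gcongr; nlinarith
      linarith
    have h2 : c * h ≤ c * (γ * H) := by gcongr
    nlinarith
  have hball := hF.closedBall_subset_cone hH0
    (t.dist_le (t.face_subset_cell hF.center_mem) hK.mem) hcH (by
      have h3 : 4 * (c * h) * h / H ≤ 4 * (c * h) * γ := by
        rw [div_le_iff₀ hH0]
        have : 0 < c * h := by positivity
        nlinarith
      have : t.cell.h = h := rfl
      rw [this]
      linarith)
  refine ⟨L, o, r, _, hF, ?_, hball, hball (Metric.mem_closedBall_self (by positivity)), hhH⟩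
  have : 0 < c * h := by positivity
  nlinarith

variable (d γ η) in
/-- Polynomials are bounded near an element by their `L²`-norm on any of its subcells. -/
theorem exists_sq_evalAt_le_subCell (hd : 1 ≤ d) (hγ : 1 ≤ γ) (hη : 1 ≤ η) (m : ℕ) :
    ∃ C : ℝ, 0 < C ∧ ∀ {Ω : Set (Space d)} {M : PolytopalMesh d Ω}, M.IsRegular γ η →
      ∀ t : M.SubCell, ∃ z ∈ (t.cell : Set (Space d)), ∀ (p : Poly d m) (y : Space d),
        dist y z ≤ t.cell.h →
        t.cell.h ^ d * evalAt (p : MvPolynomial (Fin d) ℝ) y ^ 2 ≤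
          C * ∫ x in t.toSet, evalAt (p : MvPolynomial (Fin d) ℝ) x ^ 2 := by
  have hc0 := shapeConst_pos hγ hη
  -- The ratio is `1 / c` because the inner ball has radius `c h` and the estimate is wanted up to
  -- distance `h`.
  obtain ⟨C, hC, hp⟩ := exists_sq_evalAt_le d m (1 / shapeConst γ η)
  refine ⟨C / shapeConst γ η ^ d, by positivity, fun {Ω M} hreg t => ?_⟩
  obtain ⟨L, o, r, z, hF, hr, hball, hz, -⟩ := hreg.exists_local_geometry hd hγ hη t
  have hh := hreg.h_pos hd t.cell
  refine ⟨z, hreg.toSet_subset t hz, fun p y hy => ?_⟩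
  have h1 := hp p z y (shapeConst γ η * t.cell.h) (by positivity) (by
    rw [one_div, inv_mul_cancel_left₀ hc0.ne']; exact hy)
  have h2 : ∫ y in Metric.ball z (shapeConst γ η * t.cell.h),
      evalAt (p : MvPolynomial (Fin d) ℝ) y ^ 2 ≤
      ∫ x in t.toSet, evalAt (p : MvPolynomial (Fin d) ℝ) x ^ 2 := by
    have hcont : Continuous fun x => evalAt (p : MvPolynomial (Fin d) ℝ) x ^ 2 := by fun_prop
    exact setIntegral_mono_set (hcont.continuousOn.integrableOn_compact t.isCompact_toSet)
      (.of_forall fun x => sq_nonneg _)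
      (Metric.ball_subset_closedBall.trans hball).eventuallyLE
  rw [mul_pow] at h1
  rw [div_mul_eq_mul_div, le_div_iff₀ (by positivity)]
  calc _ = shapeConst γ η ^ d * t.cell.h ^ d * evalAt (p : MvPolynomial (Fin d) ℝ) y ^ 2 := by ring
    _ ≤ _ := h1
    _ ≤ _ := by gcongr

theorem setIntegral_sq_nonneg {X : Type*} [MeasurableSpace X] (μ : Measure X) (S : Set X)
    (g : X → ℝ) : 0 ≤ ∫ x in S, g x ^ 2 ∂μ := integral_nonneg fun _ => sq_nonneg _

variable (d γ η) in
/-- The discrete trace inequality. -/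
theorem exists_trace_le (hd : 1 ≤ d) (hγ : 1 ≤ γ) (hη : 1 ≤ η) (m : ℕ) :
    ∃ C : ℝ, 0 < C ∧ ∀ {Ω : Set (Space d)} {M : PolytopalMesh d Ω}, M.IsRegular γ η →
      ∀ (t : M.SubCell) (p : Poly d m),
        t.cell.h * ∫ y in (t.face : Set (Space d)), evalAt (p : MvPolynomial (Fin d) ℝ) y ^ 2
            ∂μHE[d - 1] ≤
          C * ∫ x in t.toSet, evalAt (p : MvPolynomial (Fin d) ℝ) x ^ 2 := by
  obtain ⟨C, hC, h⟩ := exists_sq_evalAt_le_subCell d γ η hd hγ hη m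
  have hV := unitBallVolume_pos (d - 1)
  refine ⟨C * unitBallVolume (d - 1), by positivity, fun {Ω M} hreg t p => ?_⟩
  obtain ⟨z, hz, hp⟩ := h hreg t
  obtain ⟨L, o, r, ρ, -, -, hF, -, -⟩ := hreg.exists_subCell_data t
  have hh := hreg.h_pos hd t.cell
  have h1 := setIntegral_le_of_forall_le (μ := μHE[d - 1]) (S := (t.face : Set (Space d)))
    (g := fun y => evalAt (p : MvPolynomial (Fin d) ℝ) y ^ 2)
    (B := C * (∫ x in t.toSet, evalAt (p : MvPolynomial (Fin d) ℝ) x ^ 2) / t.cell.h ^ d)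
    hF.measure_lt_top (fun y _ => sq_nonneg _) (fun y hy => by
      rw [le_div_iff₀ (by positivity), mul_comm]
      exact hp p y (t.dist_le (t.face_subset_cell hy) hz))
    (by have := setIntegral_sq_nonneg volume t.toSet (evalAt (p : MvPolynomial (Fin d) ℝ))
        positivity)
    (hF.measureReal_le hh.le fun y hy =>
      t.dist_le (t.face_subset_cell hy) (t.face_subset_cell hF.center_mem))
  refine (mul_le_mul_of_nonneg_left h1 hh.le).trans_eq ?_
  have : t.cell.h ^ d = t.cell.h ^ (d - 1) * t.cell.h := by
    rw [← pow_succ, Nat.sub_add_cancel hd]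
  rw [this]
  field_simp

variable (d γ η) in
-- The pointwise bound by the subcell norm is integrated over the element, whose volume is at most a
-- multiple of `h_K ^ d`. Thus one subcell controls a polynomial on the whole of `K`.
theorem exists_cell_le_subCell (hd : 1 ≤ d) (hγ : 1 ≤ γ) (hη : 1 ≤ η) (m : ℕ) :
    ∃ C : ℝ, 0 < C ∧ ∀ {Ω : Set (Space d)} {M : PolytopalMesh d Ω}, M.IsRegular γ η →
      ∀ (t : M.SubCell) (p : Poly d m),
        ∫ x in (t.cell : Set (Space d)), evalAt (p : MvPolynomial (Fin d) ℝ) x ^ 2 ≤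
          C * ∫ x in t.toSet, evalAt (p : MvPolynomial (Fin d) ℝ) x ^ 2 := by
  obtain ⟨C, hC, h⟩ := exists_sq_evalAt_le_subCell d γ η hd hγ hη m
  have hV := unitBallVolume_pos d
  refine ⟨C * unitBallVolume d, by positivity, fun {Ω M} hreg t p => ?_⟩
  obtain ⟨z, hz, hp⟩ := h hreg t
  have hh := hreg.h_pos hd t.cell
  have h1 := setIntegral_le_of_forall_le (μ := volume) (S := (t.cell : Set (Space d)))
    (g := fun y => evalAt (p : MvPolynomial (Fin d) ℝ) y ^ 2)
    (B := C * (∫ x in t.toSet, evalAt (p : MvPolynomial (Fin d) ℝ) x ^ 2) / t.cell.h ^ d)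
    t.cell.isCompact.measure_lt_top (fun y _ => sq_nonneg _) (fun y hy => by
      rw [le_div_iff₀ (by positivity), mul_comm]
      exact hp p y (t.dist_le hy hz))
    (by have := setIntegral_sq_nonneg volume t.toSet (evalAt (p : MvPolynomial (Fin d) ℝ))
        positivity)
    (volumeReal_le_of_dist_le hh.le fun y hy => t.dist_le hy hz)
  refine h1.trans_eq ?_
  field_simp

theorem norm_gradAt_sq (p : MvPolynomial (Fin d) ℝ) (x : Space d) :
    ‖gradAt p x‖ ^ 2 = ∑ i, evalAt (MvPolynomial.pderiv i p) x ^ 2 := by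
  rw [EuclideanSpace.norm_sq_eq]; simp [gradAt]

/-- A partial derivative of a polynomial of degree at most `m + 1`. -/
noncomputable def partialPoly {m : ℕ} (p : Poly d (m + 1)) (i : Fin d) : Poly d m :=
  ⟨MvPolynomial.pderiv i (p : MvPolynomial (Fin d) ℝ),
    (MvPolynomial.mem_restrictTotalDegree _ _ _).2
      (totalDegree_pderiv_le i _ ((MvPolynomial.mem_restrictTotalDegree _ _ _).1 p.2))⟩

variable (d γ η) in
/-- On a face a polynomial is close to a constant, in terms of the gradient on the subcell. -/
theorem exists_sub_const_le (hd : 1 ≤ d) (hγ : 1 ≤ γ) (hη : 1 ≤ η) (m : ℕ) :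
    ∃ C : ℝ, 0 < C ∧ ∀ {Ω : Set (Space d)} {M : PolytopalMesh d Ω}, M.IsRegular γ η →
      ∀ (t : M.SubCell) (p : Poly d (m + 1)), ∃ a : ℝ,
        ∫ y in (t.face : Set (Space d)), (evalAt (p : MvPolynomial (Fin d) ℝ) y - a) ^ 2
            ∂μHE[d - 1] ≤
          C * t.cell.h * ∫ x in t.toSet, ‖gradAt (p : MvPolynomial (Fin d) ℝ) x‖ ^ 2 := by
  obtain ⟨C, hC, h⟩ := exists_sq_evalAt_le_subCell d γ η hd hγ hη m
  have hV := unitBallVolume_pos (d - 1)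
  refine ⟨C * unitBallVolume (d - 1), by positivity, fun {Ω M} hreg t p => ?_⟩
  obtain ⟨z, hz, hp⟩ := h hreg t
  obtain ⟨L, o, r, ρ, -, -, hF, -, -⟩ := hreg.exists_subCell_data t
  have hh := hreg.h_pos hd t.cell
  set G := ∫ x in t.toSet, ‖gradAt (p : MvPolynomial (Fin d) ℝ) x‖ ^ 2 with hG
  have hG0 : 0 ≤ G := integral_nonneg fun _ => by positivity
  have hgrad : ∀ y, dist y z ≤ t.cell.h →
      t.cell.h ^ d * ‖gradAt (p : MvPolynomial (Fin d) ℝ) y‖ ^ 2 ≤ C * G := by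
    intro y hy
    have hGs : G = ∑ i, ∫ x in t.toSet,
        evalAt (MvPolynomial.pderiv i (p : MvPolynomial (Fin d) ℝ)) x ^ 2 := by
      rw [hG, ← integral_finsetSum]
      · simp only [norm_gradAt_sq]
      · intro i _
        have : Continuous fun x =>
          evalAt (MvPolynomial.pderiv i (p : MvPolynomial (Fin d) ℝ)) x ^ 2 := by fun_prop
        exact this.continuousOn.integrableOn_compact t.isCompact_toSet
    rw [norm_gradAt_sq, hGs, Finset.mul_sum, Finset.mul_sum]
    exact Finset.sum_le_sum fun i _ => hp (partialPoly p i) y hy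
  set B := C * G / t.cell.h ^ d with hB
  have hB0 : 0 ≤ B := by positivity
  -- The mean value inequality is used on the ball of radius `h_K` around `z`, not on `K`: the ball
  -- is convex and contains the face, and the gradient bound holds throughout it.
  have hlip : ∀ y ∈ (t.face : Set (Space d)),
      (evalAt (p : MvPolynomial (Fin d) ℝ) y - evalAt (p : MvPolynomial (Fin d) ℝ) z) ^ 2 ≤
        B * t.cell.h ^ 2 := by
    intro y hy
    have hyz := t.dist_le (t.face_subset_cell hy) hz
    have h1 := (convex_closedBall z t.cell.h).norm_image_sub_le_of_norm_hasFDerivWithin_le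
      (f := evalAt (p : MvPolynomial (Fin d) ℝ)) (C := √B) (x := z) (y := y)
      (fun x _ => (hasFDerivAt_evalAt (p : MvPolynomial (Fin d) ℝ) x).hasFDerivWithinAt)
      (fun x hx => by
        rw [innerSL_apply_norm]
        refine Real.le_sqrt_of_sq_le ?_
        rw [hB, le_div_iff₀ (by positivity), mul_comm]
        exact hgrad x hx) (by simp [hh.le]) hyz
    rw [← sq_abs, ← Real.norm_eq_abs]
    calc _ ≤ (√B * ‖y - z‖) ^ 2 := by gcongr
      _ = B * ‖y - z‖ ^ 2 := by rw [mul_pow, Real.sq_sqrt hB0]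
      _ ≤ _ := by rw [← dist_eq_norm]; gcongr
  refine ⟨evalAt (p : MvPolynomial (Fin d) ℝ) z, ?_⟩
  have h1 := setIntegral_le_of_forall_le (μ := μHE[d - 1]) (S := (t.face : Set (Space d)))
    hF.measure_lt_top (fun y _ => sq_nonneg _) hlip (by positivity)
    (hF.measureReal_le hh.le fun y hy =>
      t.dist_le (t.face_subset_cell hy) (t.face_subset_cell hF.center_mem))
  refine h1.trans_eq ?_
  have : t.cell.h ^ d = t.cell.h ^ (d - 1) * t.cell.h := by
    rw [← pow_succ, Nat.sub_add_cancel hd]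
  rw [hB, this]
  field_simp

variable (d γ η) in
/-- Polynomials are bounded on the hyperplane of a face, near the face, by their `L²`-norm on
the face. -/
theorem exists_sq_evalAt_le_face (hd : 1 ≤ d) (hγ : 1 ≤ γ) (hη : 1 ≤ η) (m : ℕ) :
    ∃ C : ℝ, 0 < C ∧ ∀ {Ω : Set (Space d)} {M : PolytopalMesh d Ω}, M.IsRegular γ η →
      ∀ t : M.SubCell, ∃ o ∈ (t.face : Set (Space d)), ∀ (p : Poly d m) (y : Space d),
        ⟪t.normal, y - o⟫ = 0 → dist y o ≤ t.cell.h →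
        t.cell.h ^ (d - 1) * evalAt (p : MvPolynomial (Fin d) ℝ) y ^ 2 ≤
          C * ∫ x in (t.face : Set (Space d)), evalAt (p : MvPolynomial (Fin d) ℝ) x ^ 2
            ∂μHE[d - 1] := by
  have hc0 := shapeConst_pos hγ hη
  obtain ⟨C, hC, hp⟩ := exists_sq_evalAt_le (d - 1) m (1 / shapeConst γ η)
  refine ⟨C / shapeConst γ η ^ (d - 1), by positivity, fun {Ω M} hreg t => ?_⟩
  obtain ⟨L, o, r, z, hF, hr, -, -, -⟩ := hreg.exists_local_geometry hd hγ hη t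
  have hh := hreg.h_pos hd t.cell
  refine ⟨o, hF.center_mem, fun p y hy hyo => ?_⟩
  -- In coordinates of the hyperplane the claim is the ball estimate in dimension `d - 1`.
  obtain ⟨q, hq⟩ := exists_poly_comp_affine p L.toLinearMap o
  obtain ⟨w, hw⟩ := hF.exists_eq _ hy
  have h1 := hp q 0 w (shapeConst γ η * t.cell.h) (by positivity) (by
    rw [one_div, inv_mul_cancel_left₀ hc0.ne', dist_zero_right, ← L.norm_map, hw,
      ← dist_eq_norm]
    exact hyo)
  have h2 : ∫ y in Metric.ball 0 (shapeConst γ η * t.cell.h),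
      evalAt (q : MvPolynomial (Fin (d - 1)) ℝ) y ^ 2 ≤
      ∫ x in (t.face : Set (Space d)), evalAt (p : MvPolynomial (Fin d) ℝ) x ^ 2 ∂μHE[d - 1] := by
    have hcont : Continuous fun x => evalAt (q : MvPolynomial (Fin (d - 1)) ℝ) x ^ 2 := by fun_prop
    rw [setIntegral_euclideanHausdorffMeasure L o hF.subset_range]
    have : ∀ w, evalAt (p : MvPolynomial (Fin d) ℝ) (o + L w) =
      evalAt (q : MvPolynomial (Fin (d - 1)) ℝ) w := fun w => (hq w).symm
    simp only [this]
    refine setIntegral_mono_set (hcont.continuousOn.integrableOn_compact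
      ((hF.toIsFrame.isometry o).isClosedEmbedding.isCompact_preimage hF.isCompact))
      (.of_forall fun x => sq_nonneg _) (LE.le.eventuallyLE fun w hw => ?_)
    exact hF.mem_ball w ((mem_ball_zero_iff.1 hw).le.trans hr)
  have h3 : evalAt (q : MvPolynomial (Fin (d - 1)) ℝ) w = evalAt (p : MvPolynomial (Fin d) ℝ) y := by
    rw [hq]; simp [hw]
  rw [h3, mul_pow] at h1
  rw [div_mul_eq_mul_div, le_div_iff₀ (by positivity)]
  calc _ = shapeConst γ η ^ (d - 1) * t.cell.h ^ (d - 1) *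
        evalAt (p : MvPolynomial (Fin d) ℝ) y ^ 2 := by ring
    _ ≤ _ := h1
    _ ≤ _ := by gcongr

variable (d γ η) in
/-- Polynomials on a face extend to the subcell with a scaled bound. -/
theorem exists_extension (hd : 1 ≤ d) (hγ : 1 ≤ γ) (hη : 1 ≤ η) (m : ℕ) :
    ∃ C : ℝ, 0 < C ∧ ∀ {Ω : Set (Space d)} {M : PolytopalMesh d Ω}, M.IsRegular γ η →
      ∀ (t : M.SubCell) (p : Poly d m), ∃ q : Poly d m,
        (∀ y ∈ (t.face : Set (Space d)),
          evalAt (q : MvPolynomial (Fin d) ℝ) y = evalAt (p : MvPolynomial (Fin d) ℝ) y) ∧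
        ∫ x in t.toSet, evalAt (q : MvPolynomial (Fin d) ℝ) x ^ 2 ≤
          C * t.cell.h * ∫ x in (t.face : Set (Space d)),
            evalAt (p : MvPolynomial (Fin d) ℝ) x ^ 2 ∂μHE[d - 1] := by
  obtain ⟨C, hC, h⟩ := exists_sq_evalAt_le_face d γ η hd hγ hη m
  have hV := unitBallVolume_pos d
  refine ⟨C * unitBallVolume d, by positivity, fun {Ω M} hreg t p => ?_⟩
  obtain ⟨o, ho, hp⟩ := h hreg t
  obtain ⟨L, o', r, ρ, -, -, hF, -, -⟩ := hreg.exists_subCell_data t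
  have hh := hreg.h_pos hd t.cell
  set n := t.normal
  -- `A` is the orthogonal projection along `n`. The extension is `p` composed with the projection
  -- onto the hyperplane, hence constant in the normal direction and of unchanged degree.
  let A : Space d →ₗ[ℝ] Space d := LinearMap.id - (innerₛₗ ℝ n).smulRight n
  have hA : ∀ v, A v = v - ⟪n, v⟫ • n := fun v => by simp [A]
  have hnn : ⟪n, n⟫ = 1 := by rw [real_inner_self_eq_norm_sq, hF.norm_eq_one]; norm_num
  obtain ⟨q, hq⟩ := exists_poly_comp_affine p A (⟪n, o⟫ • n)
  have hproj : ∀ y, ⟪n, o⟫ • n + A y = o + A (y - o) := fun y => by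
    rw [hA, hA, inner_sub_right, sub_smul]; abel
  have hnA : ∀ v, ⟪n, A v⟫ = 0 := fun v => by
    rw [hA, inner_sub_right, real_inner_smul_right, hnn]; ring
  have hAn : ∀ v, ‖A v‖ ≤ ‖v‖ := fun v => by
    have h1 : ‖A v‖ ^ 2 = ‖v‖ ^ 2 - ⟪n, v⟫ ^ 2 := by
      rw [hA, norm_sub_sq_real, norm_smul, hF.norm_eq_one, real_inner_smul_right,
        real_inner_comm, mul_one, Real.norm_eq_abs, sq_abs]; ring
    exact (sq_le_sq₀ (norm_nonneg _) (norm_nonneg _)).1 (by nlinarith [sq_nonneg ⟪n, v⟫])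
  set I := ∫ x in (t.face : Set (Space d)), evalAt (p : MvPolynomial (Fin d) ℝ) x ^ 2 ∂μHE[d - 1]
  have hI : 0 ≤ I := setIntegral_sq_nonneg _ _ _
  refine ⟨q, fun y hy => ?_, ?_⟩
  · have h0 : ⟪n, y - o⟫ = 0 := by
      have h1 := hF.inner_sub y hy
      have h2 := hF.inner_sub o ho
      rw [inner_sub_right] at *
      linarith
    rw [hq, hproj, hA, h0]; simp
  · have h1 := setIntegral_le_of_forall_le (μ := volume) (S := t.toSet)
      (g := fun y => evalAt (q : MvPolynomial (Fin d) ℝ) y ^ 2)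
      (B := C * I / t.cell.h ^ (d - 1))
      t.isCompact_toSet.measure_lt_top (fun y _ => sq_nonneg _) (fun y hy => by
        rw [le_div_iff₀ (by positivity), mul_comm, hq, hproj]
        refine hp p _ (by rw [add_sub_cancel_left, hnA]) ?_
        rw [dist_eq_norm, add_sub_cancel_left]
        refine (hAn _).trans ?_
        rw [← dist_eq_norm]
        exact t.dist_le (hreg.toSet_subset t hy) (t.face_subset_cell ho)) (by positivity)
      (volumeReal_le_of_dist_le hh.le fun y hy =>
        t.dist_le (hreg.toSet_subset t hy) (t.face_subset_cell ho))
    refine h1.trans_eq ?_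
    have : t.cell.h ^ d = t.cell.h ^ (d - 1) * t.cell.h := by
      rw [← pow_succ, Nat.sub_add_cancel hd]
    rw [this]
    field_simp

/-- Definiteness of the `L²(F)` norm on polynomials. The quantitative face estimate needs constants
at least `1`, so the regularity constants are first enlarged. -/
theorem IsRegular.eq_zero_of_integral_face (hreg : M.IsRegular γ η) (hd : 1 ≤ d) (t : M.SubCell)
    {m : ℕ} (p : Poly d m)
    (h0 : ∫ x in (t.face : Set (Space d)), evalAt (p : MvPolynomial (Fin d) ℝ) x ^ 2
      ∂μHE[d - 1] = 0) {y : Space d} (hy : y ∈ (t.face : Set (Space d))) :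
    evalAt (p : MvPolynomial (Fin d) ℝ) y = 0 := by
  have hreg' := hreg.mono (le_max_left γ 1) (le_max_left η 1)
  obtain ⟨C, hC, h⟩ := exists_sq_evalAt_le_face d (max γ 1) (max η 1) hd (le_max_right _ _)
    (le_max_right _ _) m
  obtain ⟨o, ho, hp⟩ := h hreg' t
  obtain ⟨L, o', r, ρ, -, -, hF, -, -⟩ := hreg.exists_subCell_data t
  have hh := hreg.h_pos hd t.cell
  have h1 : ⟪t.normal, y - o⟫ = 0 := by
    have h1 := hF.inner_sub y hy
    have h2 := hF.inner_sub o ho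
    rw [inner_sub_right] at *
    linarith
  have h2 := hp p y h1 (t.dist_le (t.face_subset_cell hy) (t.face_subset_cell ho))
  rw [h0, mul_zero] at h2
  have h3 : 0 < t.cell.h ^ (d - 1) := by positivity
  have h4 : evalAt (p : MvPolynomial (Fin d) ℝ) y ^ 2 = 0 :=
    le_antisymm (by nlinarith [sq_nonneg (evalAt (p : MvPolynomial (Fin d) ℝ) y)]) (sq_nonneg _)
  simpa using h4

end PolytopalMesh


/-! ### The face projection and linearity of the forms -/

section FaceSpaces

variable {d : ℕ} {F : Set (Space d)}

instance finite_facePoly (m : ℕ) (F : Set (Space d)) : Module.Finite ℝ (facePoly m F) := by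
  unfold facePoly; infer_instance

theorem mem_facePoly_iff {m : ℕ} {g : Space d → ℝ} :
    g ∈ facePoly m F ↔ ∃ p : Poly d m, F.indicator (evalAt (p : MvPolynomial (Fin d) ℝ)) = g := by
  constructor
  · rintro ⟨p, hp, rfl⟩; exact ⟨⟨p, hp⟩, rfl⟩
  · rintro ⟨p, rfl⟩; exact ⟨p, p.2, rfl⟩

theorem exists_poly_of_mem_facePoly {m : ℕ} {g : Space d → ℝ} (hg : g ∈ facePoly m F) :
    ∃ p : Poly d m, ∀ y ∈ F, g y = evalAt (p : MvPolynomial (Fin d) ℝ) y := by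
  obtain ⟨p, rfl⟩ := mem_facePoly_iff.1 hg
  exact ⟨p, fun y hy => Set.indicator_of_mem hy _⟩

theorem indicator_mem_facePoly {m : ℕ} (p : Poly d m) :
    F.indicator (evalAt (p : MvPolynomial (Fin d) ℝ)) ∈ facePoly m F :=
  mem_facePoly_iff.2 ⟨p, rfl⟩

theorem eq_zero_of_notMem_facePoly {m : ℕ} {g : Space d → ℝ} (hg : g ∈ facePoly m F) {y : Space d}
    (hy : y ∉ F) : g y = 0 := by
  obtain ⟨p, rfl⟩ := mem_facePoly_iff.1 hg
  exact Set.indicator_of_notMem hy _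

theorem continuousOn_of_mem_facePoly {m : ℕ} {g : Space d → ℝ} (hg : g ∈ facePoly m F) :
    ContinuousOn g F := by
  obtain ⟨p, hp⟩ := exists_poly_of_mem_facePoly hg
  exact (continuous_evalAt _).continuousOn.congr hp

end FaceSpaces

namespace PolytopalMesh

variable {d : ℕ} {Ω : Set (Space d)} {M : PolytopalMesh d Ω} {γ η : ℝ} {k : ℕ}

theorem Face.isCompact (F : M.Face) : IsCompact (F : Set (Space d)) :=
  (M.isPolytope_face _ F.2).isCompact

theorem IsRegular.integrableOn_face (hreg : M.IsRegular γ η) (F : M.Face) {g : Space d → ℝ}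
    (hg : ContinuousOn g F) : IntegrableOn g (F : Set (Space d)) μHE[d - 1] := by
  obtain ⟨t, rfl⟩ := exists_subCell F
  obtain ⟨L, o, r, ρ, -, -, hF, -, -⟩ := hreg.exists_subCell_data t
  obtain ⟨C, hC⟩ := hF.isCompact.exists_bound_of_continuousOn hg
  have : IsFiniteMeasure (μHE[d - 1].restrict (t.face : Set (Space d))) :=
    ⟨by simpa using hF.measure_lt_top⟩
  exact Integrable.of_bound (hg.aestronglyMeasurable hF.isCompact.measurableSet) C
    ((ae_restrict_iff' hF.isCompact.measurableSet).2 (.of_forall hC))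

theorem IsRegular.facePoly_eq_zero (hreg : M.IsRegular γ η) (hd : 1 ≤ d) (F : M.Face) {m : ℕ}
    {g : Space d → ℝ} (hg : g ∈ facePoly m (F : Set (Space d)))
    (h0 : ∫ x in (F : Set (Space d)), g x ^ 2 ∂μHE[d - 1] = 0) : g = 0 := by
  obtain ⟨t, rfl⟩ := exists_subCell F
  obtain ⟨p, hp⟩ := exists_poly_of_mem_facePoly hg
  funext y
  by_cases hy : y ∈ (t.face : Set (Space d))
  · rw [hp y hy]
    refine hreg.eq_zero_of_integral_face hd t p ?_ hy
    rw [← h0]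
    exact setIntegral_congr_fun t.isCompact_face.measurableSet fun y hy => by rw [hp y hy]
  · exact eq_zero_of_notMem_facePoly hg hy

theorem IsRegular.exists_isFaceProj (hreg : M.IsRegular γ η) (hd : 1 ≤ d) (F : M.Face) (m : ℕ)
    {g : Space d → ℝ} (hg : ContinuousOn g F) : ∃ q, IsFaceProj m (F : Set (Space d)) g q := by
  have hint : ∀ {a b : Space d → ℝ}, ContinuousOn a F → ContinuousOn b F →
      IntegrableOn (fun x => a x * b x) (F : Set (Space d)) μHE[d - 1] := fun ha hb =>
    hreg.integrableOn_face F (ha.mul hb)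
  have hc : ∀ q : facePoly m (F : Set (Space d)), ContinuousOn (q : Space d → ℝ) F := fun q =>
    continuousOn_of_mem_facePoly q.2
  let B : facePoly m (F : Set (Space d)) →ₗ[ℝ] facePoly m (F : Set (Space d)) →ₗ[ℝ] ℝ :=
    LinearMap.mk₂ ℝ (fun q r => ∫ x in (F : Set (Space d)),
      (q : Space d → ℝ) x * (r : Space d → ℝ) x ∂μHE[d - 1])
      (fun a b c => by
        rw [← integral_add (hint (hc a) (hc c)) (hint (hc b) (hc c))]
        simp [add_mul])
      (fun s a b => by
        rw [smul_eq_mul, ← integral_const_mul]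
        simp [mul_assoc])
      (fun a b c => by
        rw [← integral_add (hint (hc a) (hc b)) (hint (hc a) (hc c))]
        simp [mul_add])
      (fun s a b => by
        rw [smul_eq_mul, ← integral_const_mul]
        simp [mul_left_comm])
  -- The `L²(F)` inner product is definite on `facePoly`, so it identifies this finite-dimensional
  -- space with its dual; the projection represents the functional given by `g`.
  have hinj : Function.Injective B := by
    rw [injective_iff_map_eq_zero]
    intro q hq
    have h1 : B q q = 0 := by rw [hq]; rfl
    refine Subtype.ext (hreg.facePoly_eq_zero hd F q.2 ?_)
    simpa [B, sq] using h1
  have hsurj : Function.Surjective B :=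
    (LinearMap.injective_iff_surjective_of_finrank_eq_finrank
      (Subspace.dual_finrank_eq (K := ℝ)).symm).1 hinj
  let ℓ : facePoly m (F : Set (Space d)) →ₗ[ℝ] ℝ :=
    { toFun := fun r => ∫ x in (F : Set (Space d)), g x * (r : Space d → ℝ) x ∂μHE[d - 1]
      map_add' := fun a b => by
        rw [← integral_add (hint hg (hc a)) (hint hg (hc b))]
        simp [mul_add]
      map_smul' := fun s a => by
        rw [RingHom.id_apply, smul_eq_mul, ← integral_const_mul]
        simp [mul_left_comm] }
  obtain ⟨q, hq⟩ := hsurj ℓ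
  refine ⟨q, q.2, fun r hr => ?_⟩
  have h1 : B q ⟨r, hr⟩ = ℓ ⟨r, hr⟩ := by rw [hq]
  have h2 : ∫ x in (F : Set (Space d)), (q : Space d → ℝ) x * r x ∂μHE[d - 1] =
    ∫ x in (F : Set (Space d)), g x * r x ∂μHE[d - 1] := h1
  simp only [sub_mul]
  rw [integral_sub (hint hg (hc ⟨r, hr⟩)) (hint (hc q) (hc ⟨r, hr⟩)), h2, sub_self]

theorem IsRegular.isFaceProj_unique (hreg : M.IsRegular γ η) (hd : 1 ≤ d) (F : M.Face) {m : ℕ}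
    {g q q' : Space d → ℝ} (hg : ContinuousOn g F) (h : IsFaceProj m (F : Set (Space d)) g q)
    (h' : IsFaceProj m (F : Set (Space d)) g q') : q = q' := by
  have hm := (facePoly m (F : Set (Space d))).sub_mem h.1 h'.1
  have hc := continuousOn_of_mem_facePoly hm
  have h1 := h.2 _ hm
  have h2 := h'.2 _ hm
  rw [← sub_eq_zero]
  refine hreg.facePoly_eq_zero hd F hm ?_
  rw [← sub_eq_zero.2 (h2.trans h1.symm), ← integral_sub]
  · exact integral_congr_ae (.of_forall fun x => by simp; ring)
  · exact hreg.integrableOn_face F ((hg.sub (continuousOn_of_mem_facePoly h'.1)).mul hc)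
  · exact hreg.integrableOn_face F ((hg.sub (continuousOn_of_mem_facePoly h.1)).mul hc)

theorem IsRegular.isFaceProj_faceProj (hreg : M.IsRegular γ η) (hd : 1 ≤ d) (F : M.Face) (m : ℕ)
    {g : Space d → ℝ} (hg : ContinuousOn g F) :
    IsFaceProj m (F : Set (Space d)) g (faceProj m F g) :=
  Classical.epsilon_spec (hreg.exists_isFaceProj hd F m hg)

theorem IsRegular.faceProj_mem (hreg : M.IsRegular γ η) (hd : 1 ≤ d) (F : M.Face) (m : ℕ)
    {g : Space d → ℝ} (hg : ContinuousOn g F) : faceProj m F g ∈ facePoly m (F : Set (Space d)) :=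
  (hreg.isFaceProj_faceProj hd F m hg).1

theorem IsRegular.faceProj_eq (hreg : M.IsRegular γ η) (hd : 1 ≤ d) (F : M.Face) {m : ℕ}
    {g q : Space d → ℝ} (hg : ContinuousOn g F) (h : IsFaceProj m (F : Set (Space d)) g q) :
    faceProj m F g = q :=
  hreg.isFaceProj_unique hd F hg (hreg.isFaceProj_faceProj hd F m hg) h

/-- `faceProj` is a choice operator, so linearity has to come from uniqueness of the projection. -/
theorem IsRegular.faceProj_linear (hreg : M.IsRegular γ η) (hd : 1 ≤ d) (F : M.Face) {m : ℕ}
    {g g' : Space d → ℝ} (hg : ContinuousOn g F) (hg' : ContinuousOn g' F) (c c' : ℝ) :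
    faceProj m F (fun x => c * g x + c' * g' x) =
      fun x => c * faceProj m F g x + c' * faceProj m F g' x := by
  have h := hreg.isFaceProj_faceProj hd F m hg
  have h' := hreg.isFaceProj_faceProj hd F m hg'
  have hp := continuousOn_of_mem_facePoly h.1
  have hp' := continuousOn_of_mem_facePoly h'.1
  refine hreg.faceProj_eq hd F ((continuousOn_const.mul hg).add (continuousOn_const.mul hg'))
    ⟨?_, fun r hr => ?_⟩
  · exact (facePoly m (F : Set (Space d))).add_mem
      ((facePoly m (F : Set (Space d))).smul_mem c h.1)
      ((facePoly m (F : Set (Space d))).smul_mem c' h'.1)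
  · have hrc := continuousOn_of_mem_facePoly hr
    have e : ∀ x, (c * g x + c' * g' x - (c * faceProj m F g x + c' * faceProj m F g' x)) * r x =
        c * ((g x - faceProj m F g x) * r x) + c' * ((g' x - faceProj m F g' x) * r x) :=
      fun x => by ring
    have i1 : IntegrableOn (fun x => (g x - faceProj m F g x) * r x) (F : Set (Space d))
      μHE[d - 1] := hreg.integrableOn_face F ((hg.sub hp).mul hrc)
    have i2 : IntegrableOn (fun x => (g' x - faceProj m F g' x) * r x) (F : Set (Space d))
      μHE[d - 1] := hreg.integrableOn_face F ((hg'.sub hp').mul hrc)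
    simp only [e]
    rw [integral_add (i1.const_mul c) (i2.const_mul c'), integral_const_mul,
      integral_const_mul, h.2 r hr, h'.2 r hr]
    simp

theorem IsRegular.faceProj_zero (hreg : M.IsRegular γ η) (hd : 1 ≤ d) (F : M.Face) (m : ℕ) :
    faceProj m (F : Set (Space d)) (fun _ => 0) = 0 :=
  hreg.faceProj_eq hd F continuousOn_const ⟨Submodule.zero_mem _, fun r _ => by simp⟩

/-! #### Linearity -/

theorem vecAt_add {m : ℕ} (s s' : VecPoly d m) (x : Space d) :
    vecAt (s + s') x = vecAt s x + vecAt s' x := by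
  ext i; simp [vecAt, evalAt]

theorem vecAt_smul {m : ℕ} (c : ℝ) (s : VecPoly d m) (x : Space d) :
    vecAt (c • s) x = c • vecAt s x := by
  ext i; simp [vecAt, evalAt]

theorem gradAt_add (p q : MvPolynomial (Fin d) ℝ) (x : Space d) :
    gradAt (p + q) x = gradAt p x + gradAt q x := by
  ext i; simp [gradAt, evalAt]

theorem gradAt_smul (c : ℝ) (p : MvPolynomial (Fin d) ℝ) (x : Space d) :
    gradAt (c • p) x = c • gradAt p x := by
  ext i; simp [gradAt, evalAt]

@[fun_prop]
theorem continuous_normalTrace (σ : M.SigmaDisc k) (t : M.SubCell) :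
    Continuous (normalTrace σ t) := by
  unfold normalTrace; fun_prop

theorem SubCell.integrableOn (t : M.SubCell) {g : Space d → ℝ} (hg : Continuous g) :
    IntegrableOn g t.toSet :=
  hg.continuousOn.integrableOn_compact t.isCompact_toSet

theorem exists_bilin_aForm : ∃ A : M.SigmaDisc k →ₗ[ℝ] M.SigmaDisc k →ₗ[ℝ] ℝ,
    ∀ σ τ, A σ τ = aForm σ τ := by
  refine ⟨LinearMap.mk₂ ℝ aForm (fun a b c => ?_) (fun s a b => ?_) (fun a b c => ?_)
    (fun s a b => ?_), fun _ _ => rfl⟩ <;> unfold aForm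
  · rw [← Finset.sum_add_distrib]
    refine Finset.sum_congr rfl fun t _ => ?_
    rw [← integral_add (t.integrableOn (by fun_prop)) (t.integrableOn (by fun_prop))]
    simp [vecAt_add, inner_add_left]
  · rw [smul_eq_mul, Finset.mul_sum]
    refine Finset.sum_congr rfl fun t _ => ?_
    rw [← integral_const_mul]
    simp [vecAt_smul, real_inner_smul_left]
  · rw [← Finset.sum_add_distrib]
    refine Finset.sum_congr rfl fun t _ => ?_
    rw [← integral_add (t.integrableOn (by fun_prop)) (t.integrableOn (by fun_prop))]
    simp [vecAt_add, inner_add_right]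
  · rw [smul_eq_mul, Finset.mul_sum]
    refine Finset.sum_congr rfl fun t _ => ?_
    rw [← integral_const_mul]
    simp [vecAt_smul, real_inner_smul_right]

theorem exists_bilin_gradForm : ∃ G : M.SigmaDisc k →ₗ[ℝ] M.U k →ₗ[ℝ] ℝ,
    ∀ σ u, G σ u = gradForm σ u := by
  refine ⟨LinearMap.mk₂ ℝ gradForm (fun a b c => ?_) (fun s a b => ?_) (fun a b c => ?_)
    (fun s a b => ?_), fun _ _ => rfl⟩ <;> unfold gradForm
  · rw [← Finset.sum_add_distrib]
    refine Finset.sum_congr rfl fun t _ => ?_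
    rw [← integral_add (t.integrableOn (by fun_prop)) (t.integrableOn (by fun_prop))]
    simp [vecAt_add, inner_add_left]
  · rw [smul_eq_mul, Finset.mul_sum]
    refine Finset.sum_congr rfl fun t _ => ?_
    rw [← integral_const_mul]
    simp [vecAt_smul, real_inner_smul_left]
  · rw [← Finset.sum_add_distrib]
    refine Finset.sum_congr rfl fun t _ => ?_
    rw [← integral_add (t.integrableOn (by fun_prop)) (t.integrableOn (by fun_prop))]
    simp [gradAt_add, inner_add_right]
  · rw [smul_eq_mul, Finset.mul_sum]
    refine Finset.sum_congr rfl fun t _ => ?_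
    rw [← integral_const_mul]
    simp [gradAt_smul, real_inner_smul_right]

/-- The difference `Q_b u_0 - u_b` on the face of a subcell. -/
noncomputable def traceGap (u : M.MSpace k) (t : M.SubCell) (x : Space d) : ℝ :=
  faceProj k (t.face : Set (Space d)) (evalAt (u.1 t.cell : MvPolynomial (Fin d) ℝ)) x
    - (u.2 t.face : Space d → ℝ) x

theorem IsRegular.traceGap_mem (hreg : M.IsRegular γ η) (hd : 1 ≤ d) (u : M.MSpace k)
    (t : M.SubCell) : traceGap u t ∈ facePoly k (t.face : Set (Space d)) :=
  (facePoly k (t.face : Set (Space d))).sub_mem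
    (hreg.faceProj_mem hd t.face k (continuous_evalAt _).continuousOn) (u.2 t.face).2

theorem IsRegular.continuousOn_traceGap (hreg : M.IsRegular γ η) (hd : 1 ≤ d) (u : M.MSpace k)
    (t : M.SubCell) : ContinuousOn (traceGap u t) (t.face : Set (Space d)) :=
  continuousOn_of_mem_facePoly (hreg.traceGap_mem hd u t)

theorem IsRegular.traceGap_linear (hreg : M.IsRegular γ η) (hd : 1 ≤ d) (u v : M.MSpace k)
    (c c' : ℝ) (t : M.SubCell) (x : Space d) :
    traceGap (c • u + c' • v) t x = c * traceGap u t x + c' * traceGap v t x := by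
  have h := congrFun (hreg.faceProj_linear hd t.face (m := k)
    (continuous_evalAt (u.1 t.cell : MvPolynomial (Fin d) ℝ)).continuousOn
    (continuous_evalAt (v.1 t.cell : MvPolynomial (Fin d) ℝ)).continuousOn c c') x
  have e : (fun x => c * evalAt (u.1 t.cell : MvPolynomial (Fin d) ℝ) x +
      c' * evalAt (v.1 t.cell : MvPolynomial (Fin d) ℝ) x) =
      evalAt ((c • u + c' • v).1 t.cell : MvPolynomial (Fin d) ℝ) := by
    funext x; simp [evalAt]
  rw [e] at h
  unfold traceGap
  rw [h]
  simp only [Prod.snd_add, Prod.smul_snd, Pi.add_apply, Pi.smul_apply, Submodule.coe_add,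
    Submodule.coe_smul, smul_eq_mul]
  ring

theorem bHybrid_eq (σ : M.SigmaDisc k) (u : M.MSpace k) :
    bHybrid σ u = -gradForm σ u.1 + ∑ t : M.SubCell, ∫ x in (t.face : Set (Space d)),
      normalTrace σ t x * traceGap u t x ∂μHE[d - 1] := rfl

theorem normalTrace_add (σ τ : M.SigmaDisc k) (t : M.SubCell) (x : Space d) :
    normalTrace (σ + τ) t x = normalTrace σ t x + normalTrace τ t x := by
  simp [normalTrace, vecAt_add, inner_add_left]

theorem normalTrace_smul (c : ℝ) (σ : M.SigmaDisc k) (t : M.SubCell) (x : Space d) :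
    normalTrace (c • σ) t x = c * normalTrace σ t x := by
  simp [normalTrace, vecAt_smul, real_inner_smul_left]

theorem IsRegular.integrableOn_trace_mul (hreg : M.IsRegular γ η) (hd : 1 ≤ d) (σ : M.SigmaDisc k)
    (u : M.MSpace k) (t : M.SubCell) :
    IntegrableOn (fun x => normalTrace σ t x * traceGap u t x) (t.face : Set (Space d))
      μHE[d - 1] :=
  hreg.integrableOn_face t.face
    ((continuous_normalTrace σ t).continuousOn.mul (hreg.continuousOn_traceGap hd u t))

theorem IsRegular.exists_bilin_bHybrid (hreg : M.IsRegular γ η) (hd : 1 ≤ d) :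
    ∃ B : M.SigmaDisc k →ₗ[ℝ] M.MSpace k →ₗ[ℝ] ℝ, ∀ σ u, B σ u = bHybrid σ u := by
  obtain ⟨G, hG⟩ := exists_bilin_gradForm (M := M) (k := k)
  have hi := hreg.integrableOn_trace_mul (k := k) hd
  let S : M.SigmaDisc k →ₗ[ℝ] M.MSpace k →ₗ[ℝ] ℝ :=
    LinearMap.mk₂ ℝ (fun σ u => ∑ t : M.SubCell, ∫ x in (t.face : Set (Space d)),
      normalTrace σ t x * traceGap u t x ∂μHE[d - 1])
      (fun a b u => by
        rw [← Finset.sum_add_distrib]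
        refine Finset.sum_congr rfl fun t _ => ?_
        rw [← integral_add (hi a u t) (hi b u t)]
        simp only [normalTrace_add, add_mul])
      (fun c a u => by
        rw [smul_eq_mul, Finset.mul_sum]
        refine Finset.sum_congr rfl fun t _ => ?_
        rw [← integral_const_mul]
        simp only [normalTrace_smul, mul_assoc])
      (fun a u v => by
        rw [← Finset.sum_add_distrib]
        refine Finset.sum_congr rfl fun t _ => ?_
        rw [← integral_add (hi a u t) (hi a v t)]
        refine integral_congr_ae (.of_forall fun x => ?_)
        have := hreg.traceGap_linear hd u v 1 1 t x
        simp only [one_smul, one_mul] at this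
        simp only [this, mul_add])
      (fun c a u => by
        rw [smul_eq_mul, Finset.mul_sum]
        refine Finset.sum_congr rfl fun t _ => ?_
        rw [← integral_const_mul]
        refine integral_congr_ae (.of_forall fun x => ?_)
        have := hreg.traceGap_linear hd u u c 0 t x
        simp only [zero_smul, add_zero, zero_mul] at this
        simp only [this]; ring)
  refine ⟨-(G.compl₂ (LinearMap.fst ℝ _ _)) + S, fun σ u => ?_⟩
  rw [bHybrid_eq, ← hG]
  rfl

theorem IsRegular.memLp_cell (hreg : M.IsRegular γ η) {f : Space d → ℝ}
    (hf : MemLp f 2 (volume.restrict Ω)) (K : M.Cell) :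
    MemLp f 2 (volume.restrict (K : Set (Space d))) :=
  hf.mono_measure (hreg.restrict_cell_le K)

theorem Cell.memLp (K : M.Cell) {g : Space d → ℝ} (hg : Continuous g) :
    MemLp g 2 (volume.restrict (K : Set (Space d))) := by
  have : IsFiniteMeasure (volume.restrict (K : Set (Space d))) :=
    ⟨by simpa using K.isCompact.measure_lt_top⟩
  obtain ⟨C, hC⟩ := K.isCompact.exists_bound_of_continuousOn hg.continuousOn
  exact MemLp.of_bound hg.aestronglyMeasurable C
    ((ae_restrict_iff' K.isCompact.measurableSet).2 (.of_forall hC))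

theorem IsRegular.exists_linear_load (hreg : M.IsRegular γ η) {f : Space d → ℝ}
    (hf : MemLp f 2 (volume.restrict Ω)) :
    ∃ ℓ : M.U k →ₗ[ℝ] ℝ, ∀ v, ℓ v = load f v := by
  have hi : ∀ (K : M.Cell) (p : MvPolynomial (Fin d) ℝ),
      IntegrableOn (fun x => f x * evalAt p x) (K : Set (Space d)) := fun K p =>
    (hreg.memLp_cell hf K).integrable_mul (K.memLp (continuous_evalAt p))
  refine ⟨⟨⟨load f, fun u v => ?_⟩, fun c u => ?_⟩, fun _ => rfl⟩
  · unfold load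
    rw [← Finset.sum_add_distrib]
    refine Finset.sum_congr rfl fun K _ => ?_
    rw [← integral_add (hi K _) (hi K _)]
    simp [evalAt_add, mul_add]
  · unfold load
    rw [RingHom.id_apply, smul_eq_mul, Finset.mul_sum]
    refine Finset.sum_congr rfl fun K _ => ?_
    rw [← integral_const_mul]
    simp [evalAt_smul, mul_left_comm]

end PolytopalMesh

/-- A square saddle point problem is uniquely solvable if its homogeneous version is. -/
theorem existsUnique_saddlePoint {V W : Type*} [AddCommGroup V] [Module ℝ V]
    [FiniteDimensional ℝ V] [AddCommGroup W] [Module ℝ W] [FiniteDimensional ℝ W]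
    (A : V →ₗ[ℝ] V →ₗ[ℝ] ℝ) (B : V →ₗ[ℝ] W →ₗ[ℝ] ℝ) (ℓ : W →ₗ[ℝ] ℝ)
    (h : ∀ σ u, (∀ τ, A σ τ + B τ u = 0) → (∀ v, B σ v = 0) → σ = 0 ∧ u = 0) :
    ∃! p : V × W, (∀ τ, A p.1 τ + B τ p.2 = 0) ∧ ∀ v, B p.1 v = ℓ v := by
  let T : V × W →ₗ[ℝ] (V →ₗ[ℝ] ℝ) × (W →ₗ[ℝ] ℝ) :=
    (A.coprod B.flip).prod (B.comp (LinearMap.fst ℝ V W))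
  have hT : ∀ p, T p = (A p.1 + B.flip p.2, B p.1) := fun p => rfl
  have hinj : Function.Injective T := by
    rw [injective_iff_map_eq_zero]
    intro p hp
    rw [hT, Prod.mk_eq_zero] at hp
    have := h p.1 p.2 (fun τ => LinearMap.congr_fun hp.1 τ) (fun v => LinearMap.congr_fun hp.2 v)
    exact Prod.ext this.1 this.2
  -- `V × W` and the product of the two duals have the same dimension, so injectivity suffices.
  have hsurj : Function.Surjective T :=
    (LinearMap.injective_iff_surjective_of_finrank_eq_finrank (by
      rw [Module.finrank_prod, Module.finrank_prod]
      congr 1 <;> exact (Subspace.dual_finrank_eq (K := ℝ)).symm)).1 hinj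
  obtain ⟨p, hp⟩ := hsurj (0, ℓ)
  have hiff : ∀ q : V × W, ((∀ τ, A q.1 τ + B τ q.2 = 0) ∧ ∀ v, B q.1 v = ℓ v) ↔
      T q = (0, ℓ) := fun q => by
    rw [hT, Prod.mk.injEq]
    exact ⟨fun hq => ⟨LinearMap.ext hq.1, LinearMap.ext hq.2⟩,
      fun hq => ⟨LinearMap.congr_fun hq.1, LinearMap.congr_fun hq.2⟩⟩
  exact ⟨p, (hiff p).2 hp, fun q hq => hinj (((hiff q).1 hq).trans hp.symm)⟩


/-! ### The discrete Poincaré inequality -/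

namespace PolytopalMesh

variable {d : ℕ} {Ω : Set (Space d)} {M : PolytopalMesh d Ω} {γ η : ℝ} {k : ℕ}

/-- `∑_K ‖∇u_0‖_K²`. -/
noncomputable def gradEnergy (u : M.U k) : ℝ :=
  ∑ K : M.Cell, ∫ x in (K : Set (Space d)), ‖gradAt (u K : MvPolynomial (Fin d) ℝ) x‖ ^ 2

/-- `∑_K h_K⁻¹ ‖u_0 - u_b‖_{∂K}²`. -/
noncomputable def jumpEnergy (u : M.MSpace k) : ℝ :=
  ∑ t : M.SubCell, t.cell.h⁻¹ * ∫ x in (t.face : Set (Space d)),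
    (evalAt (u.1 t.cell : MvPolynomial (Fin d) ℝ) x - (u.2 t.face : Space d → ℝ) x) ^ 2 ∂μHE[d - 1]

/-- `∑_K ‖u_0‖_K²`. -/
noncomputable def massEnergy (u : M.U k) : ℝ :=
  ∑ K : M.Cell, ∫ x in (K : Set (Space d)), evalAt (u K : MvPolynomial (Fin d) ℝ) x ^ 2

theorem Cell.h_nonneg (K : M.Cell) : 0 ≤ K.h := Metric.diam_nonneg

theorem gradEnergy_nonneg (u : M.U k) : 0 ≤ gradEnergy u :=
  Finset.sum_nonneg fun _ _ => integral_nonneg fun _ => by positivity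

theorem jumpEnergy_nonneg (u : M.MSpace k) : 0 ≤ jumpEnergy u :=
  Finset.sum_nonneg fun t _ => mul_nonneg (inv_nonneg.2 t.cell.h_nonneg)
    (integral_nonneg fun _ => by positivity)

theorem massEnergy_nonneg (u : M.U k) : 0 ≤ massEnergy u :=
  Finset.sum_nonneg fun _ _ => integral_nonneg fun _ => by positivity

theorem norm1_eq (u : M.MSpace k) : norm1 u = √(gradEnergy u.1 + jumpEnergy u) := rfl

theorem Cell.integrableOn (K : M.Cell) {g : Space d → ℝ} (hg : Continuous g) :
    IntegrableOn g (K : Set (Space d)) :=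
  hg.continuousOn.integrableOn_compact K.isCompact

theorem continuousOn_faceValue (u : M.MSpace k) (F : M.Face) :
    ContinuousOn (u.2 F : Space d → ℝ) (F : Set (Space d)) :=
  continuousOn_of_mem_facePoly (u.2 F).2

/-- On an interior face the two normals are opposite while `u_b` is single valued; on a boundary
face `u_b` is zero. -/
theorem IsRegular.sum_faceValue_normal (hreg : M.IsRegular γ η) (u : M.MZero k) :
    ∑ t : M.SubCell, ∫ y in (t.face : Set (Space d)),
      ((u : M.MSpace k).2 t.face : Space d → ℝ) y ^ 2 * ⟪t.normal, y⟫ ∂μHE[d - 1] = 0 := by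
  classical
  rw [sum_subCell_eq_sum_face]
  refine Finset.sum_eq_zero fun F _ => ?_
  obtain ⟨t, ht⟩ := exists_subCell F
  by_cases hF : F.IsBoundary
  · rw [filter_face_of_isBoundary hF ht, Finset.sum_singleton, ht, u.2 F hF]
    simp
  · obtain ⟨t', ht', hne, he⟩ := exists_filter_face_of_not_isBoundary hF ht
    have hn := hreg.normal_add_normal hne (ht.trans ht'.symm)
    rw [he, Finset.sum_pair hne, ht, ht', ← integral_add]
    · rw [← integral_zero (α := Space d) (G := ℝ) (μ := μHE[d - 1].restrict (F : Set (Space d)))]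
      refine integral_congr_ae (.of_forall fun y => ?_)
      dsimp only
      rw [← mul_add, ← inner_add_left, hn, inner_zero_left, mul_zero]
    all_goals
      exact hreg.integrableOn_face F (((continuousOn_faceValue _ F).pow 2).mul
        (by fun_prop))

theorem IsRegular.norm_le (hreg : M.IsRegular γ η) {R : ℝ} (hR : Ω ⊆ Metric.closedBall 0 R)
    {K : M.Cell} {y : Space d} (hy : y ∈ (K : Set (Space d))) : ‖y‖ ≤ R := by
  have h := closure_minimal hR Metric.isClosed_closedBall (hreg.cell_subset_closure K hy)
  simpa using h

theorem IsRegular.h_le (hreg : M.IsRegular γ η) {R : ℝ} (hR0 : 0 ≤ R)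
    (hR : Ω ⊆ Metric.closedBall 0 R) (K : M.Cell) : K.h ≤ 2 * R := by
  refine Metric.diam_le_of_forall_dist_le (by positivity) fun x hx y hy => ?_
  have := dist_le_norm_add_norm x y
  linarith [hreg.norm_le hR hx, hreg.norm_le hR hy]

/-- The divergence theorem for `u_0² x` on each element, from which the vanishing sum of `u_b² n ·
x` is subtracted so that the boundary terms involve only the mismatch of `u_0` and `u_b`. -/
theorem IsRegular.mass_identity (hreg : M.IsRegular γ η) (hd : 1 ≤ d) (u : M.MZero k) :
    d * massEnergy (u : M.MSpace k).1 =
      (∑ K : M.Cell, ∫ x in (K : Set (Space d)),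
        -(2 * evalAt ((u : M.MSpace k).1 K : MvPolynomial (Fin d) ℝ) x *
          ⟪gradAt ((u : M.MSpace k).1 K : MvPolynomial (Fin d) ℝ) x, x⟫)) +
      ∑ t : M.SubCell, ∫ y in (t.face : Set (Space d)),
        (evalAt ((u : M.MSpace k).1 t.cell : MvPolynomial (Fin d) ℝ) y ^ 2 -
          ((u : M.MSpace k).2 t.face : Space d → ℝ) y ^ 2) * ⟪t.normal, y⟫ ∂μHE[d - 1] := by
  classical
  have h1 : ∀ t : M.SubCell, ∫ y in (t.face : Set (Space d)),
        (evalAt ((u : M.MSpace k).1 t.cell : MvPolynomial (Fin d) ℝ) y ^ 2 -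
          ((u : M.MSpace k).2 t.face : Space d → ℝ) y ^ 2) * ⟪t.normal, y⟫ ∂μHE[d - 1] =
      (∫ y in (t.face : Set (Space d)),
        evalAt ((u : M.MSpace k).1 t.cell : MvPolynomial (Fin d) ℝ) y ^ 2 * ⟪t.normal, y⟫
          ∂μHE[d - 1]) - ∫ y in (t.face : Set (Space d)),
        ((u : M.MSpace k).2 t.face : Space d → ℝ) y ^ 2 * ⟪t.normal, y⟫ ∂μHE[d - 1] := fun t => by
    rw [← integral_sub]
    · simp only [sub_mul]
    · exact hreg.integrableOn_face t.face (by fun_prop)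
    · exact hreg.integrableOn_face t.face (((continuousOn_faceValue _ t.face).pow 2).mul
        (by fun_prop))
  simp only [h1]
  rw [Finset.sum_sub_distrib, hreg.sum_faceValue_normal u, sub_zero, sum_subCell_eq_sum_cell,
    massEnergy, Finset.mul_sum, ← Finset.sum_add_distrib]
  refine Finset.sum_congr rfl fun K _ => ?_
  set p := ((u : M.MSpace k).1 K : MvPolynomial (Fin d) ℝ) with hp
  have h2 := hreg.setIntegral_div hd K (p := fun x => evalAt p x ^ 2) ((contDiff_evalAt p).pow 2)
  have h3 : ∀ z : Space d, fderiv ℝ (fun x => evalAt p x ^ 2) z z =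
      2 * evalAt p z * ⟪gradAt p z, z⟫ := fun z => by
    rw [((hasFDerivAt_evalAt p z).pow 2).fderiv]
    simp
  simp only [h3] at h2
  have h4 : ∑ t : {t : M.SubCell // t.cell = K}, ∫ y in (t.1.face : Set (Space d)),
        evalAt ((u : M.MSpace k).1 t.1.cell : MvPolynomial (Fin d) ℝ) y ^ 2 * ⟪t.1.normal, y⟫
          ∂μHE[d - 1] = ∑ t : {t : M.SubCell // t.cell = K},
        ∫ y in (t.1.face : Set (Space d)), evalAt p y ^ 2 * ⟪t.1.normal, y⟫ ∂μHE[d - 1] :=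
    Finset.sum_congr rfl fun t _ => by rw [hp, t.2]
  rw [h4, ← h2, ← integral_const_mul, ← integral_add]
  · refine integral_congr_ae (.of_forall fun x => ?_)
    dsimp only; ring
  · exact K.integrableOn (by fun_prop)
  · exact K.integrableOn (by fun_prop)

variable (d γ η) in
-- In `mass_identity` the element terms and the face terms each cost at most half of the mass
-- energy, up to gradient and jump terms. The factor `d ≥ 2` on the left leaves at least one copy of
-- the mass energy after absorption.
theorem exists_poincare (hd : 2 ≤ d) (hγ : 1 ≤ γ) (hη : 1 ≤ η) (k : ℕ) {R : ℝ} (hR0 : 0 ≤ R) :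
    ∃ C : ℝ, 0 < C ∧ ∀ {Ω : Set (Space d)} {M : PolytopalMesh d Ω}, M.IsRegular γ η →
      Ω ⊆ Metric.closedBall 0 R → ∀ u : M.MZero k,
        massEnergy (u : M.MSpace k).1 ≤
          C * (gradEnergy (u : M.MSpace k).1 + jumpEnergy (u : M.MSpace k)) := by
  have hd1 : 1 ≤ d := by omega
  obtain ⟨C, hC, htr⟩ := exists_trace_le d γ η hd1 hγ hη (k + 1)
  -- The final `1` only keeps the constant positive when `R = 0`.
  refine ⟨2 * R ^ 2 * C + 2 * R ^ 2 + 1, by positivity, fun {Ω M} hreg hΩ u => ?_⟩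
  have hid := hreg.mass_identity hd1 u
  have hcell : ∑ K : M.Cell, ∫ x in (K : Set (Space d)),
        -(2 * evalAt ((u : M.MSpace k).1 K : MvPolynomial (Fin d) ℝ) x *
          ⟪gradAt ((u : M.MSpace k).1 K : MvPolynomial (Fin d) ℝ) x, x⟫) ≤
      1 / 2 * massEnergy (u : M.MSpace k).1 + 2 * R ^ 2 * gradEnergy (u : M.MSpace k).1 := by
    rw [massEnergy, gradEnergy, Finset.mul_sum, Finset.mul_sum, ← Finset.sum_add_distrib]
    refine Finset.sum_le_sum fun K _ => ?_
    rw [← integral_const_mul, ← integral_const_mul, ← integral_add]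
    rotate_left
    · exact K.integrableOn (by fun_prop)
    · exact K.integrableOn (by fun_prop)
    refine setIntegral_mono_on (K.integrableOn (by fun_prop)) (K.integrableOn (by fun_prop))
      K.isCompact.measurableSet fun x hx => ?_
    set a := evalAt ((u : M.MSpace k).1 K : MvPolynomial (Fin d) ℝ) x
    set g := gradAt ((u : M.MSpace k).1 K : MvPolynomial (Fin d) ℝ) x
    have h1 : |⟪g, x⟫| ≤ ‖g‖ * R := (abs_real_inner_le_norm g x).trans
      (mul_le_mul_of_nonneg_left (hreg.norm_le hΩ hx) (norm_nonneg _))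
    have h2 : ⟪g, x⟫ ^ 2 ≤ ‖g‖ ^ 2 * R ^ 2 := by
      rw [← sq_abs, ← mul_pow]; gcongr
    nlinarith [sq_nonneg (a / 2 + ⟪g, x⟫)]
  have hface : ∑ t : M.SubCell, ∫ y in (t.face : Set (Space d)),
        (evalAt ((u : M.MSpace k).1 t.cell : MvPolynomial (Fin d) ℝ) y ^ 2 -
          ((u : M.MSpace k).2 t.face : Space d → ℝ) y ^ 2) * ⟪t.normal, y⟫ ∂μHE[d - 1] ≤
      1 / 2 * massEnergy (u : M.MSpace k).1 +
        (2 * R ^ 2 * C + 2 * R ^ 2) * jumpEnergy (u : M.MSpace k) := by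
    have hm : massEnergy (u : M.MSpace k).1 = ∑ t : M.SubCell, ∫ x in t.toSet,
        evalAt ((u : M.MSpace k).1 t.cell : MvPolynomial (Fin d) ℝ) x ^ 2 :=
      hreg.sum_setIntegral_cell hd1 fun K => by fun_prop
    rw [hm, jumpEnergy, Finset.mul_sum, Finset.mul_sum, ← Finset.sum_add_distrib]
    refine Finset.sum_le_sum fun t _ => ?_
    have hh := hreg.h_pos hd1 t.cell
    have hh2 := hreg.h_le hR0 hΩ t.cell
    have htr' := htr hreg t ((u : M.MSpace k).1 t.cell)
    have hub := continuousOn_faceValue (u : M.MSpace k) t.face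
    obtain ⟨L, o, r, ρ, -, -, hF, -, -⟩ := hreg.exists_subCell_data t
    have i1 : IntegrableOn (fun y =>
        evalAt ((u : M.MSpace k).1 t.cell : MvPolynomial (Fin d) ℝ) y ^ 2)
        (t.face : Set (Space d)) μHE[d - 1] := hreg.integrableOn_face t.face (by fun_prop)
    have i2 : IntegrableOn (fun y =>
        (evalAt ((u : M.MSpace k).1 t.cell : MvPolynomial (Fin d) ℝ) y -
          ((u : M.MSpace k).2 t.face : Space d → ℝ) y) ^ 2)
        (t.face : Set (Space d)) μHE[d - 1] := hreg.integrableOn_face t.face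
          (((continuous_evalAt _).continuousOn.sub hub).pow 2)
    have hle : ∫ y in (t.face : Set (Space d)),
        (evalAt ((u : M.MSpace k).1 t.cell : MvPolynomial (Fin d) ℝ) y ^ 2 -
          ((u : M.MSpace k).2 t.face : Space d → ℝ) y ^ 2) * ⟪t.normal, y⟫ ∂μHE[d - 1] ≤
        t.cell.h / (2 * C) * (∫ y in (t.face : Set (Space d)),
          evalAt ((u : M.MSpace k).1 t.cell : MvPolynomial (Fin d) ℝ) y ^ 2 ∂μHE[d - 1]) +
        (2 * R ^ 2 * C + 2 * R ^ 2) * t.cell.h⁻¹ * ∫ y in (t.face : Set (Space d)),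
          (evalAt ((u : M.MSpace k).1 t.cell : MvPolynomial (Fin d) ℝ) y -
            ((u : M.MSpace k).2 t.face : Space d → ℝ) y) ^ 2 ∂μHE[d - 1] := by
      rw [← integral_const_mul, ← integral_const_mul, ← integral_add (i1.const_mul _)
        (i2.const_mul _)]
      refine setIntegral_mono_on (hreg.integrableOn_face t.face
        ((((continuous_evalAt _).continuousOn.pow 2).sub (hub.pow 2)).mul (by fun_prop)))
        ((i1.const_mul _).add (i2.const_mul _)) t.isCompact_face.measurableSet fun y hy => ?_
      set a := evalAt ((u : M.MSpace k).1 t.cell : MvPolynomial (Fin d) ℝ) y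
      set b := ((u : M.MSpace k).2 t.face : Space d → ℝ) y
      set h := t.cell.h
      have h1 : |⟪t.normal, y⟫| ≤ R := by
        have := abs_real_inner_le_norm t.normal y
        rw [hF.norm_eq_one, one_mul] at this
        exact this.trans (hreg.norm_le hΩ (t.face_subset_cell hy))
      set s := ⟪t.normal, y⟫
      have hs2 : s ^ 2 ≤ R ^ 2 := by rw [← sq_abs]; gcongr
      set w := a - b with hw
      -- With `w = a - b`, the cross term `2aws` is split by Young's inequality, weighted so that
      -- the trace inequality turns the `a²` part into half of the mass on the subcell. The term `w²
      -- s` is handled by `|s| ≤ R` and `h ≤ 2R`.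
      have e1 : (a ^ 2 - b ^ 2) * s = 2 * a * w * s - w ^ 2 * s := by rw [hw]; ring
      have h2 : 2 * a * w * s ≤ h / (2 * C) * a ^ 2 + 2 * C * h⁻¹ * (w ^ 2 * s ^ 2) := by
        have := sq_nonneg (h * a - 2 * C * (w * s))
        have e : h / (2 * C) * a ^ 2 + 2 * C * h⁻¹ * (w ^ 2 * s ^ 2) - 2 * a * w * s =
            (h * a - 2 * C * (w * s)) ^ 2 / (2 * C * h) := by field_simp; ring
        have := div_nonneg this (by positivity : (0 : ℝ) ≤ 2 * C * h)
        linarith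
      have h3 : 2 * C * h⁻¹ * (w ^ 2 * s ^ 2) ≤ 2 * C * h⁻¹ * (w ^ 2 * R ^ 2) := by gcongr
      have h4 : -(w ^ 2 * s) ≤ 2 * R ^ 2 * h⁻¹ * w ^ 2 := by
        have h5 : -s ≤ R := (neg_le_abs s).trans h1
        have h6 : R ≤ 2 * R ^ 2 * h⁻¹ := by
          rw [← div_eq_mul_inv, le_div_iff₀ hh]
          nlinarith
        nlinarith [sq_nonneg w]
      rw [e1]
      nlinarith
    refine hle.trans ?_
    have : t.cell.h / (2 * C) * (∫ y in (t.face : Set (Space d)),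
          evalAt ((u : M.MSpace k).1 t.cell : MvPolynomial (Fin d) ℝ) y ^ 2 ∂μHE[d - 1]) ≤
        1 / 2 * ∫ x in t.toSet,
          evalAt ((u : M.MSpace k).1 t.cell : MvPolynomial (Fin d) ℝ) x ^ 2 := by
      rw [div_mul_eq_mul_div, div_le_iff₀ (by positivity)]
      linarith
    linarith
  have hd2 : (2 : ℝ) ≤ d := by exact_mod_cast hd
  have hX := massEnergy_nonneg (u : M.MSpace k).1
  have hG := gradEnergy_nonneg (u : M.MSpace k).1
  have hJ := jumpEnergy_nonneg (u : M.MSpace k)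
  have hRC : 0 ≤ R ^ 2 * C := by positivity
  have hR2 : 0 ≤ R ^ 2 := by positivity
  nlinarith [mul_nonneg hRC hG, mul_nonneg (sub_nonneg.2 hd2) hX]

end PolytopalMesh


/-! ### Stability -/

namespace PolytopalMesh

variable {d : ℕ} {Ω : Set (Space d)} {M : PolytopalMesh d Ω} {γ η : ℝ} {k : ℕ}

theorem norm_vecAt_sq {m : ℕ} (s : VecPoly d m) (x : Space d) :
    ‖vecAt s x‖ ^ 2 = ∑ i, evalAt (s i : MvPolynomial (Fin d) ℝ) x ^ 2 := by
  rw [EuclideanSpace.norm_sq_eq]; simp [vecAt]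

/-- The component of a polynomial field in a fixed direction. -/
noncomputable def dotPoly {m : ℕ} (n : Space d) (s : VecPoly d m) : Poly d m := ∑ i, n i • s i

theorem evalAt_dotPoly {m : ℕ} (n : Space d) (s : VecPoly d m) (x : Space d) :
    evalAt (dotPoly n s : MvPolynomial (Fin d) ℝ) x = ⟪n, vecAt s x⟫ := by
  simp [dotPoly, evalAt, vecAt, PiLp.inner_apply, mul_comm]

/-- The field `q c` for a polynomial `q` and a fixed vector `c`. -/
noncomputable def smulVec {m : ℕ} (q : Poly d m) (c : Space d) : VecPoly d m := fun i => c i • q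

theorem vecAt_smulVec {m : ℕ} (q : Poly d m) (c : Space d) (x : Space d) :
    vecAt (smulVec q c) x = evalAt (q : MvPolynomial (Fin d) ℝ) x • c := by
  ext i; simp [vecAt, smulVec, evalAt, mul_comm]

/-- The gradient as a polynomial field. -/
noncomputable def gradVec {m : ℕ} (p : Poly d (m + 1)) : VecPoly d m := partialPoly p

theorem vecAt_gradVec {m : ℕ} (p : Poly d (m + 1)) (x : Space d) :
    vecAt (gradVec p) x = gradAt (p : MvPolynomial (Fin d) ℝ) x := rfl

/-- The part of the gradient orthogonal to a fixed direction. -/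
noncomputable def tangGrad {m : ℕ} (n : Space d) (p : Poly d (m + 1)) : VecPoly d m :=
  gradVec p + (-1 : ℝ) • smulVec (dotPoly n (gradVec p)) n

theorem vecAt_tangGrad {m : ℕ} (n : Space d) (p : Poly d (m + 1)) (x : Space d) :
    vecAt (tangGrad n p) x = gradAt (p : MvPolynomial (Fin d) ℝ) x -
      ⟪n, gradAt (p : MvPolynomial (Fin d) ℝ) x⟫ • n := by
  rw [tangGrad, vecAt_add, vecAt_smul, vecAt_smulVec, evalAt_dotPoly, vecAt_gradVec]
  module

variable (d γ η) in
theorem exists_cell_le_subCell_vec (hd : 1 ≤ d) (hγ : 1 ≤ γ) (hη : 1 ≤ η) (m : ℕ) :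
    ∃ C : ℝ, 0 < C ∧ ∀ {Ω : Set (Space d)} {M : PolytopalMesh d Ω}, M.IsRegular γ η →
      ∀ (t : M.SubCell) (s : VecPoly d m),
        ∫ x in (t.cell : Set (Space d)), ‖vecAt s x‖ ^ 2 ≤
          C * ∫ x in t.toSet, ‖vecAt s x‖ ^ 2 := by
  obtain ⟨C, hC, h⟩ := exists_cell_le_subCell d γ η hd hγ hη m
  refine ⟨C, hC, fun {Ω M} hreg t s => ?_⟩
  simp only [norm_vecAt_sq]
  rw [integral_finsetSum _ fun i _ => t.cell.integrableOn (by fun_prop),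
    integral_finsetSum _ fun i _ => t.integrableOn (by fun_prop), Finset.mul_sum]
  exact Finset.sum_le_sum fun i _ => h hreg t (s i)

/-- Since `v ⟂ w`, only the part of `n` orthogonal to `w` meets `v`, and its squared length is `1 -
⟪n, w⟫²`. -/
theorem inner_sq_le_of_orthogonal {n v w : Space d} (hn : ‖n‖ = 1) (hw : ‖w‖ = 1)
    (hvw : ⟪w, v⟫ = 0) : ⟪n, v⟫ ^ 2 ≤ (1 - ⟪n, w⟫ ^ 2) * ‖v‖ ^ 2 := by
  have h1 : ⟪n - ⟪n, w⟫ • w, v⟫ = ⟪n, v⟫ := by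
    rw [inner_sub_left, real_inner_smul_left, hvw]; ring
  have h2 : ‖n - ⟪n, w⟫ • w‖ ^ 2 = 1 - ⟪n, w⟫ ^ 2 := by
    rw [norm_sub_sq_real, norm_smul, hn, hw, real_inner_smul_right, mul_one, Real.norm_eq_abs,
      sq_abs]; ring
  have h3 := abs_real_inner_le_norm (n - ⟪n, w⟫ • w) v
  rw [h1] at h3
  calc ⟪n, v⟫ ^ 2 = |⟪n, v⟫| ^ 2 := (sq_abs _).symm
    _ ≤ (‖n - ⟪n, w⟫ • w‖ * ‖v‖) ^ 2 := by gcongr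
    _ = _ := by rw [mul_pow, h2]

theorem exists_unit_orthogonal (hd : 2 ≤ d) (v : Space d) : ∃ w : Space d, ‖w‖ = 1 ∧ ⟪w, v⟫ = 0 := by
  have h1 := (ℝ ∙ v).finrank_add_finrank_orthogonal
  rw [finrank_euclideanSpace, Fintype.card_fin] at h1
  have h2 := finrank_span_le_card (R := ℝ) ({v} : Set (Space d))
  simp only [Set.toFinset_singleton, Finset.card_singleton] at h2
  have h3 : 0 < Module.finrank ℝ (ℝ ∙ v)ᗮ := by omega
  obtain ⟨⟨w, hw⟩, hw0⟩ := (Module.finrank_pos_iff_exists_ne_zero (R := ℝ)).1 h3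
  have hw0' : w ≠ 0 := fun h => hw0 (Subtype.ext h)
  refine ⟨‖w‖⁻¹ • w, by simp [norm_smul, hw0'], ?_⟩
  rw [real_inner_smul_left, Submodule.mem_orthogonal_singleton_iff_inner_left.1 hw, mul_zero]

/-- The tangential parts of a vector on the faces of an element control the vector. -/
theorem IsRegular.norm_sq_le_sum_tangential (hreg : M.IsRegular γ η) (hd : 2 ≤ d) (hγ : 1 ≤ γ)
    (K : M.Cell) (v : Space d) :
    ‖v‖ ^ 2 ≤ γ ^ 2 * ∑ t : {t : M.SubCell // t.cell = K}, (‖v‖ ^ 2 - ⟪t.1.normal, v⟫ ^ 2) := by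
  -- Here `d ≥ 2` is needed. The face hit by the ray from `x_K` in direction `w` is the one whose
  -- tangential part controls `v`.
  obtain ⟨w, hw, hwv⟩ := exists_unit_orthogonal hd v
  obtain ⟨ρ, hK, -⟩ := hreg.exists_isStarBody K
  have hw0 : w ≠ 0 := fun h => by simp [h] at hw
  have hz : M.center K + ρ • w ∈ (K : Set (Space d)) := hK.closedBall_subset (by
    simp [norm_smul, hw, abs_of_pos hK.pos])
  obtain ⟨y, hy, hzy⟩ := hK.exists_frontier hz (by simp [hK.pos.ne', hw0])
  rw [segment_eq_image'] at hzy
  obtain ⟨s, hs, hsy⟩ := hzy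
  have hsy' : s • (y - M.center K) = ρ • w := add_left_cancel hsy
  have hs0 : 0 < s := lt_of_le_of_ne hs.1 fun h0 => by
    rw [← h0, zero_smul, eq_comm, smul_eq_zero] at hsy'
    exact hsy'.elim hK.pos.ne' hw0
  have hyw : y - M.center K = (ρ / s) • w := by
    rw [div_eq_inv_mul, mul_smul, ← hsy', inv_smul_smul₀ hs0.ne']
  rw [frontier_cell_eq_iUnion, Set.mem_iUnion] at hy
  obtain ⟨⟨t, rfl⟩, hyt⟩ := hy
  obtain ⟨L, o, r, ρ', hK', hKρ', hF, -, hH⟩ := hreg.exists_subCell_data t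
  have hh := hreg.h_pos (by omega) t.cell
  have ha0 : 0 < ρ / s := div_pos hK.pos hs0
  have hah : ρ / s ≤ t.cell.h := by
    have := t.dist_le (t.face_subset_cell hyt) hK.mem
    rw [dist_eq_norm, hyw, norm_smul, hw, mul_one, Real.norm_eq_abs] at this
    exact (le_abs_self _).trans this
  have hγ0 : 0 < γ := by linarith
  -- The height of the face is `(ρ / s) ⟪n, w⟫`. It is at least `h / γ`, while the distance `ρ / s`
  -- to the boundary point is at most `h`.
  have hnw : 1 ≤ γ * ⟪t.normal, w⟫ := by
    have h1 := hF.inner_eq (M.center t.cell) hyt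
    rw [hyw, real_inner_smul_right] at h1
    have h2 : t.cell.h ≤ γ * (ρ / s * ⟪t.normal, w⟫) := by
      rw [h1]; exact hKρ'.trans (by gcongr)
    have h3 : 0 < ⟪t.normal, w⟫ := by
      by_contra! h
      have : γ * (ρ / s * ⟪t.normal, w⟫) ≤ 0 :=
        mul_nonpos_of_nonneg_of_nonpos hγ0.le (mul_nonpos_of_nonneg_of_nonpos ha0.le h)
      linarith
    have h4 : t.cell.h ≤ γ * (t.cell.h * ⟪t.normal, w⟫) := h2.trans (by gcongr)
    by_contra! h
    nlinarith
  have hle : ∀ t' : {t' : M.SubCell // t'.cell = t.cell},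
      0 ≤ ‖v‖ ^ 2 - ⟪t'.1.normal, v⟫ ^ 2 := fun t' => by
    obtain ⟨L, o, r, ρ', -, -, hF', -, -⟩ := hreg.exists_subCell_data t'.1
    have := abs_real_inner_le_norm t'.1.normal v
    rw [hF'.norm_eq_one, one_mul] at this
    have h2 : ⟪t'.1.normal, v⟫ ^ 2 ≤ ‖v‖ ^ 2 := by rw [← sq_abs]; gcongr
    linarith
  have h5 := Finset.single_le_sum (f := fun t' : {t' : M.SubCell // t'.cell = t.cell} =>
    ‖v‖ ^ 2 - ⟪t'.1.normal, v⟫ ^ 2) (fun t' _ => hle t') (Finset.mem_univ ⟨t, rfl⟩)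
  have h6 := inner_sq_le_of_orthogonal (n := t.normal) hF.norm_eq_one hw hwv
  have h7 : 1 ≤ (γ * ⟪t.normal, w⟫) ^ 2 := one_le_pow₀ hnw
  dsimp only at h5
  calc ‖v‖ ^ 2 ≤ γ ^ 2 * (‖v‖ ^ 2 - ⟪t.normal, v⟫ ^ 2) := by
        have : 0 ≤ ‖v‖ ^ 2 := by positivity
        nlinarith [mul_le_mul_of_nonneg_right h7 this, mul_le_mul_of_nonneg_left h6 (sq_nonneg γ)]
    _ ≤ _ := by gcongr

theorem SubCell.norm_tangGrad_sq {hreg : M.IsRegular γ η} (t : M.SubCell) (p : Poly d (k + 1))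
    (x : Space d) : ‖vecAt (tangGrad t.normal p) x‖ ^ 2 =
      ‖gradAt (p : MvPolynomial (Fin d) ℝ) x‖ ^ 2 -
        ⟪t.normal, gradAt (p : MvPolynomial (Fin d) ℝ) x⟫ ^ 2 := by
  obtain ⟨L, o, r, ρ, -, -, hF, -, -⟩ := hreg.exists_subCell_data t
  rw [vecAt_tangGrad, norm_sub_sq_real, norm_smul, hF.norm_eq_one, real_inner_smul_right,
    real_inner_comm, mul_one, Real.norm_eq_abs, sq_abs]
  ring

/-- `∑_T ‖σ‖_T²`. -/
noncomputable def fieldEnergy (σ : M.SigmaDisc k) : ℝ :=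
  ∑ t : M.SubCell, ∫ x in t.toSet, ‖vecAt (σ t) x‖ ^ 2

theorem aForm_self (σ : M.SigmaDisc k) : aForm σ σ = fieldEnergy σ := by
  simp [aForm, fieldEnergy]

/-- `∑_T ‖∇u - (n · ∇u) n‖_T²`. -/
noncomputable def tangEnergy (u : M.U k) : ℝ :=
  ∑ t : M.SubCell, ∫ x in t.toSet, ‖vecAt (tangGrad t.normal (u t.cell)) x‖ ^ 2

open Classical in
-- The face that controls the gradient changes from point to point, so all faces of the element are
-- summed before integrating, each tangential field being taken as a polynomial on the whole
-- element.
theorem IsRegular.setIntegral_gradAt_sq_le (hreg : M.IsRegular γ η) (hd : 2 ≤ d) (hγ : 1 ≤ γ)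
    (K : M.Cell) (p : Poly d (k + 1)) :
    ∫ x in (K : Set (Space d)), ‖gradAt (p : MvPolynomial (Fin d) ℝ) x‖ ^ 2 ≤
      γ ^ 2 * ∑ t : {t : M.SubCell // t.cell = K}, ∫ x in (K : Set (Space d)),
        ‖vecAt (tangGrad t.1.normal p) x‖ ^ 2 := by
  have h0 : ∀ n : Space d, Continuous fun x => ‖vecAt (tangGrad n p) x‖ ^ 2 := fun n => by
    fun_prop
  have h1 : Continuous fun x => ‖gradAt (p : MvPolynomial (Fin d) ℝ) x‖ ^ 2 := by fun_prop
  have h2 : Continuous fun x => γ ^ 2 * ∑ t : {t : M.SubCell // t.cell = K},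
      ‖vecAt (tangGrad t.1.normal p) x‖ ^ 2 :=
    continuous_const.mul (continuous_finsetSum _ fun t _ => h0 t.1.normal)
  rw [← integral_finsetSum _ fun t _ => K.integrableOn (h0 _), ← integral_const_mul]
  refine integral_mono (K.integrableOn h1) (K.integrableOn h2) fun x => ?_
  refine (hreg.norm_sq_le_sum_tangential hd hγ K
    (gradAt (p : MvPolynomial (Fin d) ℝ) x)).trans_eq ?_
  exact congrArg (γ ^ 2 * ·) (Finset.sum_congr (by congr!) fun t _ =>
    (SubCell.norm_tangGrad_sq (hreg := hreg) t.1 p x).symm)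

variable (d γ η) in
-- Each tangential field is brought back from the element to its own subcell by the comparison of
-- polynomial norms, because the test function can realize it only there.
theorem exists_gradEnergy_le_tangEnergy (hd : 2 ≤ d) (hγ : 1 ≤ γ) (hη : 1 ≤ η) (k : ℕ) :
    ∃ C : ℝ, 0 < C ∧ ∀ {Ω : Set (Space d)} {M : PolytopalMesh d Ω}, M.IsRegular γ η →
      ∀ u : M.U k, gradEnergy u ≤ C * tangEnergy u := by
  obtain ⟨C, hC, hvec⟩ := exists_cell_le_subCell_vec d γ η (by omega) hγ hη k
  refine ⟨γ ^ 2 * C, by positivity, fun {Ω M} hreg u => ?_⟩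
  classical
  have e : tangEnergy u = ∑ K : M.Cell, ∑ t : {t : M.SubCell // t.cell = K},
      ∫ x in t.1.toSet, ‖vecAt (tangGrad t.1.normal (u K)) x‖ ^ 2 := by
    rw [tangEnergy, sum_subCell_eq_sum_cell]
    refine Finset.sum_congr rfl fun K _ => Finset.sum_congr rfl fun t _ => ?_
    rw [t.2]
  rw [gradEnergy, e, Finset.mul_sum]
  refine Finset.sum_le_sum fun K _ => (hreg.setIntegral_gradAt_sq_le hd hγ K (u K)).trans ?_
  rw [mul_assoc]
  refine mul_le_mul_of_nonneg_left ?_ (sq_nonneg γ)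
  rw [Finset.mul_sum]
  refine (Finset.sum_le_sum fun t _ => ?_).trans_eq (Finset.sum_congr (by congr!) fun _ _ => rfl)
  have h := hvec hreg t.1 (tangGrad t.1.normal (u K))
  rwa [t.2] at h

/-- The test field is minus the tangential gradient. It has zero normal trace on the face, so the
face terms drop out of `b_h` and `tangEnergy` is what remains. -/
theorem IsRegular.tangEnergy_le (hreg : M.IsRegular γ η) (σ : M.SigmaDisc k) (u : M.MSpace k)
    (heq : ∀ τ, aForm σ τ + bHybrid τ u = 0) : tangEnergy u.1 ≤ fieldEnergy σ := by
  let τ : M.SigmaDisc k := fun t => (-1 : ℝ) • tangGrad t.normal (u.1 t.cell)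
  have hb : bHybrid τ u = tangEnergy u.1 := by
    have hn : ∀ t x, normalTrace τ t x = 0 := fun t x => by
      obtain ⟨L, o, r, ρ, -, -, hF, -, -⟩ := hreg.exists_subCell_data t
      simp only [normalTrace, τ, vecAt_smul, vecAt_tangGrad]
      rw [real_inner_smul_left, inner_sub_left, real_inner_smul_left,
        real_inner_self_eq_norm_sq, hF.norm_eq_one, real_inner_comm]
      ring
    rw [bHybrid_eq]
    simp only [hn, zero_mul, integral_zero, Finset.sum_const_zero, add_zero]
    simp only [tangEnergy, gradForm]
    rw [← Finset.sum_neg_distrib]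
    refine Finset.sum_congr rfl fun t _ => ?_
    rw [← integral_neg]
    refine integral_congr_ae (.of_forall fun x => ?_)
    dsimp only
    rw [SubCell.norm_tangGrad_sq (hreg := hreg)]
    simp only [τ, vecAt_smul, vecAt_tangGrad]
    rw [real_inner_smul_left, inner_sub_left, real_inner_smul_left, real_inner_self_eq_norm_sq]
    ring
  have ha : -aForm σ τ ≤ 1 / 2 * fieldEnergy σ + 1 / 2 * tangEnergy u.1 := by
    simp only [tangEnergy, fieldEnergy, aForm]
    rw [← Finset.sum_neg_distrib, Finset.mul_sum, Finset.mul_sum, ← Finset.sum_add_distrib]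
    refine Finset.sum_le_sum fun t _ => ?_
    rw [← integral_neg, ← integral_const_mul, ← integral_const_mul, ← integral_add]
    rotate_left
    · exact t.integrableOn (by fun_prop)
    · exact t.integrableOn (by fun_prop)
    refine integral_mono (t.integrableOn (by fun_prop)) (t.integrableOn (by fun_prop))
      fun x => ?_
    simp only [τ, vecAt_smul, real_inner_smul_right]
    have := norm_sub_sq_real (vecAt (σ t) x) (vecAt (tangGrad t.normal (u.1 t.cell)) x)
    nlinarith [sq_nonneg ‖vecAt (σ t) x - vecAt (tangGrad t.normal (u.1 t.cell)) x‖]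
  have := heq τ
  linarith

variable (d γ η) in
theorem exists_gradEnergy_le (hd : 2 ≤ d) (hγ : 1 ≤ γ) (hη : 1 ≤ η) (k : ℕ) :
    ∃ C : ℝ, 0 < C ∧ ∀ {Ω : Set (Space d)} {M : PolytopalMesh d Ω}, M.IsRegular γ η →
      ∀ (σ : M.SigmaDisc k) (u : M.MSpace k), (∀ τ, aForm σ τ + bHybrid τ u = 0) →
        gradEnergy u.1 ≤ C * fieldEnergy σ := by
  obtain ⟨C, hC, h⟩ := exists_gradEnergy_le_tangEnergy d γ η hd hγ hη k
  refine ⟨C, hC, fun {Ω M} hreg σ u heq => (h hreg u.1).trans ?_⟩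
  have := hreg.tangEnergy_le σ u heq
  gcongr

/-- `∑_K h_K⁻¹ ‖Q_b u_0 - u_b‖_{∂K}²`. -/
noncomputable def gapEnergy (u : M.MSpace k) : ℝ :=
  ∑ t : M.SubCell, t.cell.h⁻¹ * ∫ x in (t.face : Set (Space d)), traceGap u t x ^ 2 ∂μHE[d - 1]

variable (d γ η) in
-- The test field `h_K⁻¹ q n`, with `q` a polynomial extension of `Q_b u_0 - u_b`, reproduces the
-- gap energy on the faces. The volume terms are absorbed using the scaled bound on the extension.
theorem exists_gapEnergy_le (hd : 1 ≤ d) (hγ : 1 ≤ γ) (hη : 1 ≤ η) (k : ℕ) :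
    ∃ C : ℝ, 0 < C ∧ ∀ {Ω : Set (Space d)} {M : PolytopalMesh d Ω}, M.IsRegular γ η →
      ∀ (σ : M.SigmaDisc k) (u : M.MSpace k), (∀ τ, aForm σ τ + bHybrid τ u = 0) →
        gapEnergy u ≤ C * (fieldEnergy σ + gradEnergy u.1) := by
  obtain ⟨C, hC, hext⟩ := exists_extension d γ η hd hγ hη k
  refine ⟨2 * C, by positivity, fun {Ω M} hreg σ u heq => ?_⟩
  choose p hp using fun t : M.SubCell => exists_poly_of_mem_facePoly (hreg.traceGap_mem hd u t)
  choose q hq hqle using fun t : M.SubCell => hext hreg t (p t)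
  have hqg : ∀ t, ∀ y ∈ (t.face : Set (Space d)),
      evalAt (q t : MvPolynomial (Fin d) ℝ) y = traceGap u t y := fun t y hy => by
    rw [hq t y hy, hp t y hy]
  have hqle' : ∀ t : M.SubCell, ∫ x in t.toSet, evalAt (q t : MvPolynomial (Fin d) ℝ) x ^ 2 ≤
      C * t.cell.h * ∫ x in (t.face : Set (Space d)), traceGap u t x ^ 2 ∂μHE[d - 1] := fun t => by
    refine (hqle t).trans_eq ?_
    congr 1
    exact setIntegral_congr_fun t.isCompact_face.measurableSet fun y hy => by
      rw [hp t y hy]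
  let τ : M.SigmaDisc k := fun t => t.cell.h⁻¹ • smulVec (q t) t.normal
  have hb : bHybrid τ u = gapEnergy u - ∑ t : M.SubCell, ∫ x in t.toSet, t.cell.h⁻¹ *
      (evalAt (q t : MvPolynomial (Fin d) ℝ) x *
        ⟪t.normal, gradAt (u.1 t.cell : MvPolynomial (Fin d) ℝ) x⟫) := by
    rw [bHybrid_eq, neg_add_eq_sub]
    congr 1
    · refine Finset.sum_congr rfl fun t _ => ?_
      obtain ⟨L, o, r, ρ, -, -, hF, -, -⟩ := hreg.exists_subCell_data t
      rw [← integral_const_mul]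
      refine setIntegral_congr_fun t.isCompact_face.measurableSet fun y hy => ?_
      simp only [normalTrace, τ, vecAt_smul, vecAt_smulVec, real_inner_smul_left,
        real_inner_self_eq_norm_sq, hF.norm_eq_one, hqg t y hy]
      ring
    · refine Finset.sum_congr rfl fun t _ => ?_
      simp only [τ, vecAt_smul, vecAt_smulVec, real_inner_smul_left]
  have ha : aForm σ τ = ∑ t : M.SubCell, ∫ x in t.toSet, t.cell.h⁻¹ *
      (evalAt (q t : MvPolynomial (Fin d) ℝ) x * ⟪t.normal, vecAt (σ t) x⟫) := by
    refine Finset.sum_congr rfl fun t _ => ?_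
    simp only [τ, vecAt_smul, vecAt_smulVec, real_inner_smul_right]
    refine integral_congr_ae (.of_forall fun x => ?_)
    dsimp only
    rw [real_inner_comm]
  have hm : gradEnergy u.1 = ∑ t : M.SubCell, ∫ x in t.toSet,
      ‖gradAt (u.1 t.cell : MvPolynomial (Fin d) ℝ) x‖ ^ 2 :=
    hreg.sum_setIntegral_cell hd fun K => by fun_prop
  have hle : gapEnergy u ≤ 1 / 2 * gapEnergy u + C * (fieldEnergy σ + gradEnergy u.1) := by
    have h0 : gapEnergy u = (∑ t : M.SubCell, ∫ x in t.toSet, t.cell.h⁻¹ *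
      (evalAt (q t : MvPolynomial (Fin d) ℝ) x *
        ⟪t.normal, gradAt (u.1 t.cell : MvPolynomial (Fin d) ℝ) x⟫)) - aForm σ τ := by
      have := heq τ
      linarith
    conv_lhs => rw [h0, ha]
    rw [hm, gapEnergy, fieldEnergy, ← Finset.sum_add_distrib, Finset.mul_sum, Finset.mul_sum,
      ← Finset.sum_add_distrib, ← Finset.sum_sub_distrib]
    refine Finset.sum_le_sum fun t _ => ?_
    have hh := hreg.h_pos hd t.cell
    obtain ⟨L, o, r, ρ, -, -, hF, -, -⟩ := hreg.exists_subCell_data t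
    rw [← integral_sub (t.integrableOn (by fun_prop)) (t.integrableOn (by fun_prop)),
      ← integral_add (t.integrableOn (by fun_prop)) (t.integrableOn (by fun_prop))]
    calc _ ≤ ∫ x in t.toSet, (t.cell.h⁻¹ ^ 2 / (2 * C) *
            evalAt (q t : MvPolynomial (Fin d) ℝ) x ^ 2 +
          C * (‖vecAt (σ t) x‖ ^ 2 + ‖gradAt (u.1 t.cell : MvPolynomial (Fin d) ℝ) x‖ ^ 2)) := by
          refine integral_mono (t.integrableOn (by fun_prop)) (t.integrableOn (by fun_prop))
            fun x => ?_
          dsimp only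
          set a := evalAt (q t : MvPolynomial (Fin d) ℝ) x
          set g := gradAt (u.1 t.cell : MvPolynomial (Fin d) ℝ) x
          set s := vecAt (σ t) x
          set b := ⟪t.normal, g - s⟫ with hb'
          have h1 : b ^ 2 ≤ 2 * (‖s‖ ^ 2 + ‖g‖ ^ 2) := by
            have h2 := abs_real_inner_le_norm t.normal (g - s)
            rw [hF.norm_eq_one, one_mul] at h2
            have h3 := h2.trans (norm_sub_le g s)
            have h4 : b ^ 2 ≤ (‖g‖ + ‖s‖) ^ 2 := by rw [← sq_abs]; gcongr
            nlinarith [sq_nonneg (‖g‖ - ‖s‖)]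
          have h2 : t.cell.h⁻¹ * (a * ⟪t.normal, g⟫) - t.cell.h⁻¹ * (a * ⟪t.normal, s⟫) =
              (t.cell.h⁻¹ * a) * b := by rw [hb', inner_sub_right]; ring
          -- The weight `1 / (2C)` matches the extension constant, so the `a²` term integrates to at
          -- most half of the gap energy.
          have h3 : (t.cell.h⁻¹ * a) * b ≤ t.cell.h⁻¹ ^ 2 / (2 * C) * a ^ 2 + C / 2 * b ^ 2 := by
            have e : t.cell.h⁻¹ ^ 2 / (2 * C) * a ^ 2 + C / 2 * b ^ 2 - (t.cell.h⁻¹ * a) * b =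
              (t.cell.h⁻¹ * a - C * b) ^ 2 / (2 * C) := by
              have := hC.ne'
              generalize t.cell.h⁻¹ = j
              field_simp; ring
            have := div_nonneg (sq_nonneg (t.cell.h⁻¹ * a - C * b))
              (by positivity : (0 : ℝ) ≤ 2 * C)
            linarith
          rw [h2]
          nlinarith
      _ = t.cell.h⁻¹ ^ 2 / (2 * C) * (∫ x in t.toSet,
            evalAt (q t : MvPolynomial (Fin d) ℝ) x ^ 2) + C * ∫ x in t.toSet,
          (‖vecAt (σ t) x‖ ^ 2 + ‖gradAt (u.1 t.cell : MvPolynomial (Fin d) ℝ) x‖ ^ 2) := by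
          rw [integral_add (t.integrableOn (by fun_prop)) (t.integrableOn (by fun_prop)),
            integral_const_mul, integral_const_mul]
      _ ≤ _ := by
          gcongr ?_ + _
          calc _ ≤ t.cell.h⁻¹ ^ 2 / (2 * C) * (C * t.cell.h *
                ∫ x in (t.face : Set (Space d)), traceGap u t x ^ 2 ∂μHE[d - 1]) := by
                gcongr
                exact hqle' t
            _ = _ := by field_simp
  linarith

variable (d γ η) in
-- `u_0 - u_b` is split at `Q_b u_0`. The part `u_0 - Q_b u_0` is no larger than the distance of
-- `u_0` to a constant, which the gradient bounds.
theorem exists_jumpEnergy_le (hd : 1 ≤ d) (hγ : 1 ≤ γ) (hη : 1 ≤ η) (k : ℕ) :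
    ∃ C : ℝ, 0 < C ∧ ∀ {Ω : Set (Space d)} {M : PolytopalMesh d Ω}, M.IsRegular γ η →
      ∀ u : M.MSpace k, jumpEnergy u ≤ C * gradEnergy u.1 + 2 * gapEnergy u := by
  obtain ⟨C, hC, hconst⟩ := exists_sub_const_le d γ η hd hγ hη k
  refine ⟨2 * C, by positivity, fun {Ω M} hreg u => ?_⟩
  have hm : gradEnergy u.1 = ∑ t : M.SubCell, ∫ x in t.toSet,
      ‖gradAt (u.1 t.cell : MvPolynomial (Fin d) ℝ) x‖ ^ 2 :=
    hreg.sum_setIntegral_cell hd fun K => by fun_prop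
  rw [hm, jumpEnergy, gapEnergy, Finset.mul_sum, Finset.mul_sum, ← Finset.sum_add_distrib]
  refine Finset.sum_le_sum fun t _ => ?_
  have hh := hreg.h_pos hd t.cell
  obtain ⟨a, ha⟩ := hconst hreg t (u.1 t.cell)
  have hgc : ContinuousOn (evalAt (u.1 t.cell : MvPolynomial (Fin d) ℝ))
    (t.face : Set (Space d)) := (continuous_evalAt _).continuousOn
  have hQ := hreg.isFaceProj_faceProj hd t.face k hgc
  have hub := continuousOn_faceValue u t.face
  have hQc := continuousOn_of_mem_facePoly hQ.1
  have hgap := hreg.continuousOn_traceGap hd u t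
  set g := evalAt (u.1 t.cell : MvPolynomial (Fin d) ℝ)
  set q := faceProj k (t.face : Set (Space d)) g with hq
  have hint : ∀ {φ : Space d → ℝ}, ContinuousOn φ (t.face : Set (Space d)) →
      IntegrableOn φ (t.face : Set (Space d)) μHE[d - 1] := fun h => hreg.integrableOn_face t.face h
  -- Constants belong to `ℙ_k(F)` even for `k = 0`; the inequality is Pythagoras for the orthogonal
  -- projection.
  have hbest : ∫ x in (t.face : Set (Space d)), (g x - q x) ^ 2 ∂μHE[d - 1] ≤
      ∫ x in (t.face : Set (Space d)), (g x - a) ^ 2 ∂μHE[d - 1] := by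
    let r : Space d → ℝ := (t.face : Set (Space d)).indicator (evalAt (MvPolynomial.C a))
    have hr : r ∈ facePoly k (t.face : Set (Space d)) :=
      indicator_mem_facePoly ⟨MvPolynomial.C a,
        (MvPolynomial.mem_restrictTotalDegree _ _ _).2 (by simp)⟩
    have hra : ∀ x ∈ (t.face : Set (Space d)), r x = a := fun x hx => by
      simp only [r]; rw [Set.indicator_of_mem hx, evalAt_C]
    have hqr := (facePoly k (t.face : Set (Space d))).sub_mem hQ.1 hr
    have hqrc := continuousOn_of_mem_facePoly hqr
    have h0 := hQ.2 _ hqr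
    have e : ∫ x in (t.face : Set (Space d)), (g x - a) ^ 2 ∂μHE[d - 1] =
        (∫ x in (t.face : Set (Space d)), (g x - q x) ^ 2 ∂μHE[d - 1]) +
        ((∫ x in (t.face : Set (Space d)), (q - r) x ^ 2 ∂μHE[d - 1]) +
        2 * ∫ x in (t.face : Set (Space d)), (g x - q x) * (q - r) x ∂μHE[d - 1]) := by
      have i1 : IntegrableOn (fun x => (q - r) x ^ 2) (t.face : Set (Space d)) μHE[d - 1] :=
        hint (hqrc.pow 2)
      have i2 : IntegrableOn (fun x => 2 * ((g x - q x) * (q - r) x)) (t.face : Set (Space d))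
          μHE[d - 1] := (hint ((hgc.sub hQc).mul hqrc)).const_mul 2
      have i3 : IntegrableOn (fun x => (g x - q x) ^ 2) (t.face : Set (Space d)) μHE[d - 1] :=
        hint ((hgc.sub hQc).pow 2)
      have i4 : IntegrableOn (fun x => (q - r) x ^ 2 + 2 * ((g x - q x) * (q - r) x))
          (t.face : Set (Space d)) μHE[d - 1] := i1.add i2
      rw [← integral_const_mul, ← integral_add i1 i2, ← integral_add i3 i4]
      refine setIntegral_congr_fun t.isCompact_face.measurableSet fun x hx => ?_
      simp only [Pi.sub_apply, hra x hx]; ring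
    rw [e, h0]
    have := setIntegral_sq_nonneg μHE[d - 1] (t.face : Set (Space d)) (q - r)
    linarith
  have hsplit : ∫ x in (t.face : Set (Space d)),
      (g x - (u.2 t.face : Space d → ℝ) x) ^ 2 ∂μHE[d - 1] ≤
      2 * (∫ x in (t.face : Set (Space d)), (g x - q x) ^ 2 ∂μHE[d - 1]) +
      2 * ∫ x in (t.face : Set (Space d)), traceGap u t x ^ 2 ∂μHE[d - 1] := by
    have i1 := (hint ((hgc.sub hQc).pow 2)).const_mul 2
    have i2 := (hint (hgap.pow 2)).const_mul 2
    rw [← integral_const_mul, ← integral_const_mul]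
    refine le_trans (integral_mono (hint ((hgc.sub hub).pow 2)) (i1.add i2) fun x => ?_)
      (integral_add i1 i2).le
    have : traceGap u t x = q x - (u.2 t.face : Space d → ℝ) x := rfl
    simp only [Pi.add_apply, Pi.sub_apply, Pi.pow_apply, this]
    nlinarith [sq_nonneg ((g x - q x) - (q x - (u.2 t.face : Space d → ℝ) x))]
  have hinv : 0 ≤ t.cell.h⁻¹ := by positivity
  calc _ ≤ t.cell.h⁻¹ * (2 * (C * t.cell.h *
        ∫ x in t.toSet, ‖gradAt (u.1 t.cell : MvPolynomial (Fin d) ℝ) x‖ ^ 2) +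
        2 * ∫ x in (t.face : Set (Space d)), traceGap u t x ^ 2 ∂μHE[d - 1]) := by
        refine mul_le_mul_of_nonneg_left (hsplit.trans ?_) hinv
        linarith [hbest.trans ha]
    _ = _ := by field_simp

variable (d γ η) in
/-- The inf-sup estimate: the primal energy is controlled by the dual one. -/
theorem exists_energy_le (hd : 2 ≤ d) (hγ : 1 ≤ γ) (hη : 1 ≤ η) (k : ℕ) :
    ∃ C : ℝ, 0 < C ∧ ∀ {Ω : Set (Space d)} {M : PolytopalMesh d Ω}, M.IsRegular γ η →
      ∀ (σ : M.SigmaDisc k) (u : M.MSpace k), (∀ τ, aForm σ τ + bHybrid τ u = 0) →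
        gradEnergy u.1 + jumpEnergy u ≤ C * fieldEnergy σ := by
  have hd1 : 1 ≤ d := by omega
  obtain ⟨C₁, h₁, hG⟩ := exists_gradEnergy_le d γ η hd hγ hη k
  obtain ⟨C₂, h₂, hE⟩ := exists_gapEnergy_le d γ η hd1 hγ hη k
  obtain ⟨C₃, h₃, hJ⟩ := exists_jumpEnergy_le d γ η hd1 hγ hη k
  refine ⟨(1 + C₃ + 2 * C₂) * C₁ + 2 * C₂, by positivity, fun {Ω M} hreg σ u heq => ?_⟩
  have a1 := hG hreg σ u heq
  have a2 := hE hreg σ u heq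
  have a3 := hJ hreg u
  -- The jump bound, with the gap bound inserted, leaves `gradEnergy` with this coefficient; it is
  -- then replaced by `fieldEnergy`.
  have : (1 + C₃ + 2 * C₂) * gradEnergy u.1 ≤ (1 + C₃ + 2 * C₂) * (C₁ * fieldEnergy σ) := by
    gcongr
  linarith

variable (d γ η) in
-- The normal component is itself a polynomial on the subcell, so the discrete trace inequality
-- bounds the weighted boundary terms by the volume term.
theorem exists_norm0_le (hd : 1 ≤ d) (hγ : 1 ≤ γ) (hη : 1 ≤ η) (k : ℕ) :
    ∃ C : ℝ, 0 < C ∧ ∀ {Ω : Set (Space d)} {M : PolytopalMesh d Ω}, M.IsRegular γ η →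
      ∀ σ : M.SigmaDisc k, norm0 σ ≤ √(C * fieldEnergy σ) := by
  obtain ⟨C, hC, htr⟩ := exists_trace_le d γ η hd hγ hη k
  refine ⟨1 + C, by positivity, fun {Ω M} hreg σ => Real.sqrt_le_sqrt ?_⟩
  rw [add_mul, one_mul]
  refine add_le_add le_rfl ?_
  rw [fieldEnergy, Finset.mul_sum]
  refine Finset.sum_le_sum fun t _ => ?_
  obtain ⟨L, o, r, ρ, -, -, hF, -, -⟩ := hreg.exists_subCell_data t
  have h := htr hreg t (dotPoly t.normal (σ t))
  simp only [evalAt_dotPoly] at h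
  have e : ∀ x, normalTrace σ t x = ⟪t.normal, vecAt (σ t) x⟫ := fun x => real_inner_comm _ _
  simp only [e]
  refine h.trans (mul_le_mul_of_nonneg_left (integral_mono (t.integrableOn (by fun_prop))
    (t.integrableOn (by fun_prop)) fun x => ?_) hC.le)
  have := abs_real_inner_le_norm t.normal (vecAt (σ t) x)
  rw [hF.norm_eq_one, one_mul] at this
  dsimp only
  rw [← sq_abs]
  gcongr

end PolytopalMesh


/-! ### Solvability and equivalence -/

theorem poly_eq_zero_of_setIntegral {d : ℕ} {p : MvPolynomial (Fin d) ℝ} {S : Set (Space d)}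
    {z : Space d} {r : ℝ} (hS : IsCompact S) (hr : 0 < r) (hz : Metric.closedBall z r ⊆ S)
    (h : ∫ x in S, evalAt p x ^ 2 = 0) : p = 0 := by
  refine poly_eq_zero_of_integral hr (z := z)
    (le_antisymm (le_of_le_of_eq ?_ h) (integral_nonneg fun _ => sq_nonneg _))
  exact setIntegral_mono_set (((continuous_evalAt p).pow 2).continuousOn.integrableOn_compact hS)
    (.of_forall fun x => sq_nonneg _) (Metric.ball_subset_closedBall.trans hz).eventuallyLE

namespace PolytopalMesh

variable {d : ℕ} {Ω : Set (Space d)} {M : PolytopalMesh d Ω} {γ η : ℝ} {k : ℕ}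

theorem eq_zero_of_sum_nonpos {ι : Type*} [Fintype ι] {g : ι → ℝ} (h0 : ∀ i, 0 ≤ g i)
    (h : ∑ i, g i ≤ 0) (i : ι) : g i = 0 :=
  (Finset.sum_eq_zero_iff_of_nonneg fun i _ => h0 i).1
    (le_antisymm h (Finset.sum_nonneg fun i _ => h0 i)) i (Finset.mem_univ i)

theorem IsRegular.eq_zero_of_fieldEnergy (hreg : M.IsRegular γ η) (hd : 1 ≤ d) (hγ : 1 ≤ γ)
    (hη : 1 ≤ η) {σ : M.SigmaDisc k} (h : fieldEnergy σ ≤ 0) : σ = 0 := by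
  funext t i
  obtain ⟨L, o, r, z, -, -, hz, -, -⟩ := hreg.exists_local_geometry hd hγ hη t
  refine Subtype.ext (poly_eq_zero_of_setIntegral t.isCompact_toSet
    (mul_pos (shapeConst_pos hγ hη) (hreg.h_pos hd t.cell)) hz ?_)
  have h1 := eq_zero_of_sum_nonpos
    (fun t : M.SubCell => integral_nonneg fun _ => by positivity) h t
  simp only [norm_vecAt_sq] at h1
  rw [integral_finsetSum _ fun i _ => t.integrableOn (by fun_prop)] at h1
  exact eq_zero_of_sum_nonpos (fun i => setIntegral_sq_nonneg _ _ _) h1.le i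

theorem IsRegular.eq_zero_of_massEnergy (hreg : M.IsRegular γ η) {u : M.U k}
    (h : massEnergy u ≤ 0) : u = 0 := by
  funext K
  obtain ⟨ρ, hK, -⟩ := hreg.exists_isStarBody K
  exact Subtype.ext (poly_eq_zero_of_setIntegral K.isCompact hK.pos hK.closedBall_subset
    (eq_zero_of_sum_nonpos (fun K : M.Cell => setIntegral_sq_nonneg _ _ _) h K))

theorem IsRegular.eq_zero_of_jumpEnergy (hreg : M.IsRegular γ η) (hd : 1 ≤ d) {u : M.MSpace k}
    (hu : u.1 = 0) (h : jumpEnergy u ≤ 0) : u = 0 := by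
  refine Prod.ext hu (funext fun F => Subtype.ext (hreg.facePoly_eq_zero hd F (u.2 F).2 ?_))
  obtain ⟨t, rfl⟩ := exists_subCell F
  have h1 := eq_zero_of_sum_nonpos (fun t : M.SubCell =>
    mul_nonneg (inv_nonneg.2 t.cell.h_nonneg) (integral_nonneg fun _ => by positivity)) h t
  have h2 := (mul_eq_zero.1 h1).resolve_left (inv_ne_zero (hreg.h_pos hd t.cell).ne')
  simpa [hu, evalAt] using h2

/-- For a homogeneous solution, testing with itself gives `σ = 0`. Inf-sup then kills the gradient
and jump energies, Poincaré kills `u_0`, and the jump energy with `u_0 = 0` kills `u_b`. -/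
theorem IsRegular.existsUnique_solvesHybrid (hreg : M.IsRegular γ η) (hd : 2 ≤ d) (hγ : 1 ≤ γ)
    (hη : 1 ≤ η) {f : Space d → ℝ} (hf : MemLp f 2 (volume.restrict Ω)) :
    ∃! p : M.SigmaDisc k × M.MZero k, SolvesHybrid f p.1 p.2 := by
  have hd1 : 1 ≤ d := by omega
  obtain ⟨A, hA⟩ := exists_bilin_aForm (M := M) (k := k)
  obtain ⟨B, hB⟩ := hreg.exists_bilin_bHybrid (k := k) hd1
  obtain ⟨ℓ, hℓ⟩ := hreg.exists_linear_load (k := k) hf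
  obtain ⟨R, hR⟩ := (isBounded_domain M).subset_closedBall 0
  obtain ⟨C, -, hE⟩ := exists_energy_le d γ η hd hγ hη k
  obtain ⟨C', -, hP⟩ := exists_poincare d γ η hd hγ hη k (le_max_right R 0)
  have hsolve : ∀ p : M.SigmaDisc k × M.MZero k, SolvesHybrid f p.1 p.2 ↔
      (∀ τ, A p.1 τ + (B.compl₂ (M.MZero k).subtype) τ p.2 = 0) ∧
        ∀ v, (B.compl₂ (M.MZero k).subtype) p.1 v =
          (-(ℓ.comp ((LinearMap.fst ℝ _ _).comp (M.MZero k).subtype))) v := fun p => by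
    simp [SolvesHybrid, hA, hB, hℓ]
  simp only [hsolve]
  refine existsUnique_saddlePoint (V := M.SigmaDisc k) (W := M.MZero k) A _ _ fun σ u h1 h2 => ?_
  have h1' : ∀ τ, aForm σ τ + bHybrid τ (u : M.MSpace k) = 0 := fun τ => by
    rw [← hA, ← hB]; exact h1 τ
  have h2' : bHybrid σ (u : M.MSpace k) = 0 := by rw [← hB]; exact h2 u
  have hσ : fieldEnergy σ = 0 := by
    have := h1' σ
    rwa [h2', add_zero, aForm_self] at this
  have hu := hE hreg σ u h1'
  rw [hσ, mul_zero] at hu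
  have hg := gradEnergy_nonneg (u : M.MSpace k).1
  have hj := jumpEnergy_nonneg (u : M.MSpace k)
  have hm := hP hreg (hR.trans (Metric.closedBall_subset_closedBall (le_max_left R 0))) u
  rw [le_antisymm hu (add_nonneg hg hj), mul_zero] at hm
  exact ⟨hreg.eq_zero_of_fieldEnergy hd1 hγ hη hσ.le, Subtype.ext
    (hreg.eq_zero_of_jumpEnergy hd1 (hreg.eq_zero_of_massEnergy hm) (by linarith))⟩

/-- The energy of the flux of a solution, given a Poincaré inequality for its potential. -/
theorem IsRegular.fieldEnergy_le (hreg : M.IsRegular γ η) {f : Space d → ℝ}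
    (hf : MemLp f 2 (volume.restrict Ω)) {c : ℝ} (hc : 0 < c) {σ : M.SigmaDisc k} {u : M.MZero k}
    (h : SolvesHybrid f σ u) (hm : massEnergy (u : M.MSpace k).1 ≤ c * fieldEnergy σ) :
    fieldEnergy σ ≤ c * ∫ x in Ω, f x ^ 2 := by
  -- The two equations are tested with `σ` and with `u`; the coupling terms cancel.
  have h1 : fieldEnergy σ = load f (u : M.MSpace k).1 := by
    have := h.1 σ
    rw [aForm_self, h.2 u u.2] at this
    linarith
  have h2 : load f (u : M.MSpace k).1 ≤ c / 2 * (∑ K : M.Cell, ∫ x in (K : Set (Space d)), f x ^ 2) +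
      1 / (2 * c) * massEnergy (u : M.MSpace k).1 := by
    rw [load, massEnergy, Finset.mul_sum, Finset.mul_sum, ← Finset.sum_add_distrib]
    refine Finset.sum_le_sum fun K _ => ?_
    have hK := hreg.memLp_cell hf K
    have hp := K.memLp (continuous_evalAt ((u : M.MSpace k).1 K : MvPolynomial (Fin d) ℝ))
    rw [← integral_const_mul, ← integral_const_mul,
      ← integral_add (hK.integrable_sq.const_mul _) (hp.integrable_sq.const_mul _)]
    refine integral_mono (hK.integrable_mul hp)
      ((hK.integrable_sq.const_mul _).add (hp.integrable_sq.const_mul _)) fun x => ?_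
    set a := evalAt ((u : M.MSpace k).1 K : MvPolynomial (Fin d) ℝ) x
    have e : c / 2 * f x ^ 2 + 1 / (2 * c) * a ^ 2 - f x * a = (c * f x - a) ^ 2 / (2 * c) := by
      field_simp; ring
    have := div_nonneg (sq_nonneg (c * f x - a)) (by positivity : (0 : ℝ) ≤ 2 * c)
    change f x * a ≤ c / 2 * f x ^ 2 + 1 / (2 * c) * a ^ 2
    linarith
  have h3 := hreg.sum_setIntegral_cell_le (g := fun x => f x ^ 2) (fun x => sq_nonneg _)
    hf.integrable_sq
  have h4 : 1 / (2 * c) * massEnergy (u : M.MSpace k).1 ≤ 1 / 2 * fieldEnergy σ := by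
    calc _ ≤ 1 / (2 * c) * (c * fieldEnergy σ) := by gcongr
      _ = _ := by field_simp
  have h5 : c / 2 * (∑ K : M.Cell, ∫ x in (K : Set (Space d)), f x ^ 2) ≤
    c / 2 * ∫ x in Ω, f x ^ 2 := by gcongr
  linarith

/-- Poincaré after inf-sup bounds the mass of `u_0` by `C₂ C₁` times the energy of `σ`, the
hypothesis under which the energy of `σ` is bounded by the load. -/
theorem exists_stability (hd : 2 ≤ d) (hγ : 1 ≤ γ) (hη : 1 ≤ η) (k : ℕ) {R : ℝ} (hR0 : 0 ≤ R) :
    ∃ C : ℝ, 0 < C ∧ ∀ {Ω : Set (Space d)} {M : PolytopalMesh d Ω}, M.IsRegular γ η →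
      Ω ⊆ Metric.closedBall 0 R → ∀ {f : Space d → ℝ}, MemLp f 2 (volume.restrict Ω) →
      ∀ {σ : M.SigmaDisc k} {u : M.MZero k}, SolvesHybrid f σ u →
        norm0 σ + norm1 (u : M.MSpace k) ≤ C * √(∫ x in Ω, f x ^ 2) := by
  obtain ⟨C₁, h₁, hE⟩ := exists_energy_le d γ η hd hγ hη k
  obtain ⟨C₂, h₂, hP⟩ := exists_poincare d γ η hd hγ hη k hR0
  obtain ⟨C₃, h₃, hN⟩ := exists_norm0_le d γ η (by omega) hγ hη k
  refine ⟨√(C₃ * (C₂ * C₁)) + √(C₁ * (C₂ * C₁)), by positivity,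
    fun {Ω M} hreg hΩ f hf σ u h => ?_⟩
  have hu := hE hreg σ u h.1
  have hm : massEnergy (u : M.MSpace k).1 ≤ C₂ * C₁ * fieldEnergy σ := by
    rw [mul_assoc]
    exact (hP hreg hΩ u).trans (by gcongr)
  have hσ := hreg.fieldEnergy_le hf (by positivity) h hm
  rw [add_mul, ← Real.sqrt_mul (by positivity), ← Real.sqrt_mul (by positivity), norm1_eq]
  refine add_le_add ((hN hreg σ).trans (Real.sqrt_le_sqrt ?_)) (Real.sqrt_le_sqrt (hu.trans ?_))
  · rw [mul_assoc C₃]; gcongr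
  · rw [mul_assoc C₁]; gcongr

theorem load_zero (f : Space d → ℝ) : load f (0 : M.U k) = 0 := by simp [load, evalAt]

theorem gradForm_zero (σ : M.SigmaDisc k) : gradForm σ 0 = 0 := by
  have h : gradAt (0 : MvPolynomial (Fin d) ℝ) = fun _ => 0 := by
    funext x; ext i; simp [gradAt, evalAt]
  simp [gradForm, h]

theorem traceGap_eq (u : M.MSpace k) {t : M.SubCell} {F : M.Face} (ht : t.face = F) (x : Space d) :
    traceGap u t x = faceProj k (F : Set (Space d))
      (evalAt (u.1 t.cell : MvPolynomial (Fin d) ℝ)) x - (u.2 F : Space d → ℝ) x := by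
  subst ht; rfl

open Classical in
/-- Solutions of the hybridized problem have continuous normal components. -/
theorem IsRegular.mem_sigma (hreg : M.IsRegular γ η) (hd : 1 ≤ d) {f : Space d → ℝ}
    {σ : M.SigmaDisc k} {u : M.MZero k} (h : SolvesHybrid f σ u) : σ ∈ M.Sigma k := by
  intro F hF
  -- The normal jump is a polynomial of degree at most `k` on `F`, so it is an admissible face test
  -- function. The second equation then says that its `L²(F)` norm vanishes.
  let p : Poly d k := ∑ t : M.SubCell with t.face = F, dotPoly t.normal (σ t)
  have hp : ∀ x, normalJump σ F x = evalAt (p : MvPolynomial (Fin d) ℝ) x := fun x => by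
    simp only [p, normalJump, normalTrace, Submodule.coe_sum, evalAt_sum, evalAt_dotPoly]
    exact Finset.sum_congr rfl fun t _ => real_inner_comm _ _
  let v : M.MSpace k := (0, Pi.single F ⟨_, indicator_mem_facePoly p⟩)
  have hv : v ∈ M.MZero k := fun G hG => Pi.single_eq_of_ne (fun e => hF (by rwa [e] at hG)) _
  have h1 := h.2 v hv
  rw [bHybrid_eq, show v.1 = 0 from rfl, gradForm_zero, load_zero, neg_zero, zero_add,
    sum_subCell_eq_sum_face, Finset.sum_eq_single F] at h1
  rotate_left
  · intro G _ hG
    refine Finset.sum_eq_zero fun t ht => ?_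
    have hz : ∀ x, traceGap v t x = 0 := fun x => by
      rw [traceGap_eq v (Finset.mem_filter.1 ht).2]
      simp only [v, Pi.zero_apply, ZeroMemClass.coe_zero, Pi.single_eq_of_ne hG, sub_zero]
      have e : evalAt (0 : MvPolynomial (Fin d) ℝ) = fun _ => 0 := by funext; simp [evalAt]
      rw [e, hreg.faceProj_zero hd G k, Pi.zero_apply]
    simp [hz]
  · intro h; exact absurd (Finset.mem_univ F) h
  have h2 : ∫ x in (F : Set (Space d)), evalAt (p : MvPolynomial (Fin d) ℝ) x ^ 2 ∂μHE[d - 1] = 0 := by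
    have e : ∀ t ∈ Finset.univ.filter (fun t : M.SubCell => t.face = F),
        ∫ x in (t.face : Set (Space d)), normalTrace σ t x * traceGap v t x ∂μHE[d - 1] =
          ∫ x in (F : Set (Space d)), normalTrace σ t x * traceGap v t x ∂μHE[d - 1] :=
      fun t ht => by rw [(Finset.mem_filter.1 ht).2]
    rw [Finset.sum_congr rfl e] at h1
    rw [← neg_eq_zero, ← h1, ← integral_neg, ← integral_finsetSum]
    swap
    · intro t ht
      have := hreg.integrableOn_trace_mul hd σ v t
      rwa [(Finset.mem_filter.1 ht).2] at this
    obtain ⟨s, rfl⟩ := exists_subCell F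
    refine setIntegral_congr_fun s.isCompact_face.measurableSet fun x hx => ?_
    have hg : ∀ t ∈ Finset.univ.filter (fun t : M.SubCell => t.face = s.face),
        normalTrace σ t x * traceGap v t x =
          normalTrace σ t x * -evalAt (p : MvPolynomial (Fin d) ℝ) x := fun t ht => by
      have e : evalAt (0 : MvPolynomial (Fin d) ℝ) = fun _ => 0 := by funext; simp [evalAt]
      rw [traceGap_eq v (Finset.mem_filter.1 ht).2]
      simp only [v, Pi.zero_apply, ZeroMemClass.coe_zero, Pi.single_eq_same]
      rw [e, hreg.faceProj_zero hd, Pi.zero_apply, Set.indicator_of_mem hx, zero_sub]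
    rw [Finset.sum_congr rfl hg, ← Finset.sum_mul]
    have := hp x
    rw [normalJump] at this
    rw [this]; ring
  obtain ⟨s, rfl⟩ := exists_subCell F
  intro x hx
  rw [hp x]
  exact hreg.eq_zero_of_integral_face hd s p h2 hx

open Classical in
/-- On `Σ_h` the single-valued face variable drops out of the hybridized form. -/
theorem IsRegular.bForm_eq_bHybrid (hreg : M.IsRegular γ η) (hd : 1 ≤ d) {T₁ : M.Face → M.SubCell}
    (hT : ∀ F, (T₁ F).face = F) {σ : M.SigmaDisc k} (hσ : σ ∈ M.Sigma k) (u : M.MZero k) :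
    bForm T₁ σ (u : M.MSpace k).1 = bHybrid σ (u : M.MSpace k) := by
  obtain ⟨u, hu⟩ := u
  rw [bHybrid_eq, bForm, sum_subCell_eq_sum_face]
  congr 1
  refine Finset.sum_congr rfl fun F _ => ?_
  have hFm : MeasurableSet (F : Set (Space d)) := by
    have := (T₁ F).isCompact_face.measurableSet; rwa [hT] at this
  by_cases hF : F.IsBoundary
  · have hfil := filter_face_of_isBoundary hF (hT F)
    have hjump : jump T₁ u.1 F = evalAt (u.1 (T₁ F).cell : MvPolynomial (Fin d) ℝ) := by
      funext x
      rw [jump, hfil, Finset.sum_singleton, if_pos rfl, one_mul]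
    rw [hfil, Finset.sum_singleton, hT]
    refine setIntegral_congr_fun hFm fun x _ => ?_
    simp only [hjump, traceGap_eq u (hT F), hu F hF, ZeroMemClass.coe_zero, Pi.zero_apply, sub_zero]
  · obtain ⟨t', ht', hne, hfil⟩ := exists_filter_face_of_not_isBoundary hF (hT F)
    have hjump : jump T₁ u.1 F = fun x =>
        1 * evalAt (u.1 (T₁ F).cell : MvPolynomial (Fin d) ℝ) x +
          (-1) * evalAt (u.1 t'.cell : MvPolynomial (Fin d) ℝ) x := by
      funext x
      rw [jump, hfil, Finset.sum_pair hne, if_pos rfl, if_neg hne.symm]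
    have hi : ∀ t : M.SubCell, t.face = F → IntegrableOn
        (fun x => normalTrace σ t x * traceGap u t x) (F : Set (Space d)) μHE[d - 1] :=
      fun t ht => ht ▸ hreg.integrableOn_trace_mul hd σ u t
    rw [hfil, Finset.sum_pair hne, hT, ht', ← integral_add (hi _ (hT F)) (hi _ ht')]
    refine setIntegral_congr_fun hFm fun x hx => ?_
    have h0 := hσ F hF x hx
    rw [normalJump, hfil, Finset.sum_pair hne] at h0
    simp only [hjump, traceGap_eq u (hT F), traceGap_eq u ht']
    rw [hreg.faceProj_linear hd F (continuous_evalAt _).continuousOn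
      (continuous_evalAt _).continuousOn]
    -- The normal traces are opposite, so `u_b` cancels between the two sides and the difference of
    -- the two projections is `Q_b` of the jump.
    rw [eq_neg_of_add_eq_zero_right h0]
    ring

/-- Both forms agree on `Σ_h`: the first equation is restricted to test fields in `Σ_h`, and the
second is tested with `v_b = 0`. -/
theorem IsRegular.solvesSDG (hreg : M.IsRegular γ η) (hd : 1 ≤ d) {f : Space d → ℝ}
    {σ : M.SigmaDisc k} {u : M.MZero k} (h : SolvesHybrid f σ u) {T₁ : M.Face → M.SubCell}
    (hT : ∀ F, (T₁ F).face = F) : SolvesSDG T₁ f σ (u : M.MSpace k).1 := by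
  have hσ := hreg.mem_sigma hd h
  refine ⟨hσ, fun τ hτ => ?_, fun v => ?_⟩
  · rw [hreg.bForm_eq_bHybrid hd hT hτ u]
    exact h.1 τ
  · have hv : ((v, 0) : M.MSpace k) ∈ M.MZero k := fun F _ => rfl
    exact (hreg.bForm_eq_bHybrid hd hT hσ ⟨_, hv⟩).trans (h.2 _ hv)

end PolytopalMesh

end SDG

/-! ### The main theorem -/

theorem theorem3p4 (d : ℕ) (hd : 2 ≤ d) (k : ℕ) (Ω : Set (SDG.Space d)) (γ η : ℝ) :
    ∃ C : ℝ, 0 < C ∧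
      ∀ M : SDG.PolytopalMesh d Ω, M.IsRegular γ η →
      ∀ f : SDG.Space d → ℝ, MemLp f 2 (volume.restrict Ω) →
        (∃! p : M.SigmaDisc k × M.MZero k, SDG.PolytopalMesh.SolvesHybrid f p.1 p.2) ∧
        ∀ (σ : M.SigmaDisc k) (u : M.MZero k), SDG.PolytopalMesh.SolvesHybrid f σ u →
          SDG.PolytopalMesh.norm0 σ + SDG.PolytopalMesh.norm1 (u : M.MSpace k)
            ≤ C * √(∫ x in Ω, f x ^ 2) ∧
          σ ∈ M.Sigma k ∧
          ∀ T₁ : M.Face → M.SubCell, (∀ F, (T₁ F).face = F) →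
            SDG.PolytopalMesh.SolvesSDG T₁ f σ (u : M.MSpace k).1 := by
  -- The constant is chosen before the mesh and needs a ball containing `Ω`. An unbounded `Ω` admits
  -- no mesh at all, since a mesh consists of finitely many compact elements.
  by_cases hΩ : Bornology.IsBounded Ω
  swap
  · exact ⟨1, one_pos, fun M _ => absurd M.isBounded_domain hΩ⟩
  obtain ⟨R, hR⟩ := hΩ.subset_closedBall 0
  -- The estimates assume `γ, η ≥ 1` and `R ≥ 0`; enlarging the constants preserves regularity and
  -- the inclusion in the ball.
  obtain ⟨C, hC, h⟩ := SDG.PolytopalMesh.exists_stability hd (le_max_right γ 1) (le_max_right η 1) k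
    (le_max_right R 0)
  refine ⟨C, hC, fun M hreg f hf => ?_⟩
  have hreg' := hreg.mono (le_max_left γ 1) (le_max_left η 1)
  refine ⟨hreg'.existsUnique_solvesHybrid hd (le_max_right γ 1) (le_max_right η 1) hf,
    fun σ u hs => ⟨h hreg' (hR.trans (Metric.closedBall_subset_closedBall (le_max_left R 0))) hf hs,
      hreg.mem_sigma (by omega) hs, fun T₁ hT => hreg.solvesSDG (by omega) hs hT⟩⟩
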